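/- Let $\mathfrak g_0$ be a finite-dimensional nonabelian real Lie algebra, $\mathfrak g=\mathfrak g_0\otimes\mathbb C$, and let $z\mapsto\bar z$ be the induced conjugation of $\mathfrak g^*$. Let $c$ be the holomorphic linear Poisson bivector of $\mathfrak g^*$, $c(z)(\xi,\eta)=\langle z,[\xi,\eta]\rangle$, let $\operatorname{Sing}\mathfrak g^*$ be the set of points where the rank of $c$ is not maximal, and assume $\operatorname{codim}_{\mathbb C}\operatorname{Sing}\mathfrak g^*\ge 3$. Let $G$ and $G_0$ be connected Lie groups with Lie algebras $\mathfrak g$ and $\mathfrak g_0$, acting on $\mathfrak g^*$ by the (complexified) coadjoint action. Put $$\mathcal C=\{z\in\mathfrak g^*:\ \lambda_1z+\lambda_2\bar z\in\operatorname{Sing}\mathfrak g^*\text{ for some }(\lambda_1,\lambda_2)\in\mathbb C^2\setminus\{0\}\},\qquad \mu(z)=\dim_{\mathbb C}\big(\ker c(z)\cap\ker c(\bar z)\big)$$ (kernels in $\mathfrak g$, the space of $(1,0)$-covectors), and let the Kronecker irregularity set be $\mathcal R=\mathcal C\cup\{z:\mu(z)>\min_{\mathfrak g^*}\mu\}$.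 Let $M\subset\mathfrak g^*$ be a $G$-orbit with holomorphic symplectic form $\omega=(c|_M)^{-1}$, and let $U\subset M$ be open (in the manifold topology of $M$) such that $U'=U/G_0$ (the points of $U$ modulo the relation of lying in one $G_0$-orbit) is a smooth manifold for which the canonical map $p:U\to U'$ is a smooth submersion. Let $J$ be the real span of $\operatorname{Re}c|_M$ and $\operatorname{Im}c|_M$. For $z\in U$ put $T_z\mathcal K=\ker dp_z$ and $T^{1,0}_z\mathcal K=(T_z\mathcal K\otimes\mathbb C)\cap T^{1,0}_zM$. For real bivector fields $c_1',c_2'$ on $U'$ let $R_0'$ be the maximum of the rank of $(\lambda_1c_1'+\lambda_2c_2')(x)$ over $\lambda\in\mathbb R^2$ and $x\in U'$. Their span is called complete at $x$ if $\operatorname{rank}(\lambda_1c_1'+\lambda_2c_2')(x)=R_0'$ for all $(\lambda_1,\lambda_2)\in\mathbb C^2\setminus\{0\}$, and complete if it is so at all points of an open dense subset of $U'$. Then: 1. $\operatorname{Re}c|_U$ and $\operatorname{Im}c|_U$ have smooth push-forwards $c_1',c_2'$ along $p$; let $J'$ (the reduction of $J|_U$) be their real span. $J'$ is complete at every $z'\in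 U'\setminus p(U\cap\mathcal R)$. 2. If $U\not\subset\mathcal R$, then $J'$ is a bihamiltonian structure (all $\lambda_1c'_1+\lambda_2c'_2$ with $\lambda\in\mathbb R^2$ are Poisson, and $c_1',c_2'$ are linearly independent or both zero), $J'$ is complete, and the realization $(U,J,\mathcal K)$ of $J'$ is minimal, i.e. the foliation of $U$ by the leaves of $p$ is CR-isotropic: $\dim T^{1,0}_z\mathcal K$ is constant along the fibres of $p$, and $\omega$ vanishes on $T^{1,0}_z\mathcal K$ for every $z\in U$. 3. If $M\cap\operatorname{Sing}\mathfrak g^*=\emptyset$ (a generic orbit), then the foliation of $U$ by the leaves of $p$ is CR-isotropic, whether or not $U\subset\mathcal R$. -/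

import Mathlib

open scoped Manifold ContDiff Topology Matrix
open Matrix

noncomputable section

namespace Coadjoint

/-! ### The Lie algebra, its complexification and the linear Poisson structure

`𝔤₀` is a real Lie algebra with basis `e`, and `𝔤 = ℂ ⊗ 𝔤₀`.  Elements of `𝔤` are written by their
complex coordinates `ξ` with respect to `e`, and elements of `𝔤*` by the coordinates
`z k = ⟨z, e k⟩`; both are functions `ι → ℂ`.  The conjugation of `𝔤` and of `𝔤*` defined by `𝔤₀`
is `star`, and `𝔤₀ ⊆ 𝔤` consists of the real vectors. -/

section Algebra

variable {𝔤₀ : Type*} [LieRing 𝔤₀] [LieAlgebra ℝ 𝔤₀] {ι : Type*} [Fintype ι]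

/-- The structure constants: `⁅e i, e j⁆ = ∑ k, structConst e i j k • e k`. -/
def structConst (e : Module.Basis ι ℝ 𝔤₀) (i j k : ι) : ℝ := e.repr ⁅e i, e j⁆ k

/-- The matrix at `z` of the linear Poisson bivector `c` of `𝔤*`: its `(i, j)` entry is
`{z_i, z_j} = ⟨z, [e i, e j]⟩`. -/
def poissonMatrix (e : Module.Basis ι ℝ 𝔤₀) (z : ι → ℂ) : Matrix ι ι ℂ :=
  Matrix.of fun i j => ∑ k, (structConst e i j k : ℂ) * z k

/-- `⟨z, [ξ, η]⟩` for `z ∈ 𝔤*` and `ξ, η ∈ 𝔤`. -/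
def liePairing (e : Module.Basis ι ℝ 𝔤₀) (z ξ η : ι → ℂ) : ℂ := ξ ⬝ᵥ poissonMatrix e z *ᵥ η

/-- `ξ ↦ ad*(ξ) z`, where `⟨ad*(ξ) z, η⟩ = ⟨z, [ξ, η]⟩`: the infinitesimal coadjoint action
at `z`. -/
def coadAt (e : Module.Basis ι ℝ 𝔤₀) (z : ι → ℂ) : (ι → ℂ) →ₗ[ℂ] (ι → ℂ) :=
  (poissonMatrix e z).vecMulLinear

/-- The matrix of the endomorphism `z ↦ ad*(ξ) z` of `𝔤*`. -/
def coadMatrix (e : Module.Basis ι ℝ 𝔤₀) (ξ : ι → ℂ) : Matrix ι ι ℂ :=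
  Matrix.of fun j k => ∑ i, ξ i * (structConst e i j k : ℂ)

lemma coadMatrix_mulVec (e : Module.Basis ι ℝ 𝔤₀) (ξ z : ι → ℂ) :
    coadMatrix e ξ *ᵥ z = coadAt e z ξ := by
  funext j
  simp only [coadMatrix, coadAt, poissonMatrix, Matrix.mulVec, dotProduct, Matrix.of_apply,
    Matrix.vecMulLinear_apply, Matrix.vecMul, Finset.sum_mul, Finset.mul_sum]
  rw [Finset.sum_comm]
  simp only [mul_assoc]

lemma coadAt_dotProduct (e : Module.Basis ι ℝ 𝔤₀) (z ξ η : ι → ℂ) :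
    coadAt e z ξ ⬝ᵥ η = liePairing e z ξ η := by
  simp [coadAt, liePairing, Matrix.dotProduct_mulVec]

lemma liePairing_skew (e : Module.Basis ι ℝ 𝔤₀) (z ξ η : ι → ℂ) :
    liePairing e z ξ η = - liePairing e z η ξ := by
  have h : (poissonMatrix e z)ᵀ = - poissonMatrix e z := by
    ext i j
    have hs : ∀ k, structConst e j i k = - structConst e i j k := fun k => by
      have hl : ⁅e j, e i⁆ = -⁅e i, e j⁆ := (lie_skew (e j) (e i)).symm
      rw [structConst, structConst, hl, map_neg, Finsupp.neg_apply]
    simp [poissonMatrix, hs, Finset.sum_neg_distrib]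
  have h' : poissonMatrix e z = - (poissonMatrix e z)ᵀ := by rw [h, neg_neg]
  unfold liePairing
  rw [h', Matrix.neg_mulVec, dotProduct_neg, Matrix.mulVec_transpose, dotProduct_comm,
    Matrix.dotProduct_mulVec, ← h']

variable [DecidableEq ι]

/-- The flow `exp(ad*(ξ))` on `𝔤*`. -/
def coadExp (e : Module.Basis ι ℝ 𝔤₀) (ξ z : ι → ℂ) : ι → ℂ :=
  NormedSpace.exp (coadMatrix e ξ) *ᵥ z

/-- The image in `GL(𝔤*)` of the connected complex Lie group `G` with Lie algebra `𝔤` under its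
coadjoint representation: a connected Lie group is generated by exponentials, so it is the
group generated by the `exp(ad*(ξ))`, `ξ ∈ 𝔤`. -/
def coadjointGroup (e : Module.Basis ι ℝ 𝔤₀) : Subgroup (Matrix ι ι ℂ)ˣ :=
  Subgroup.closure {u | ∃ ξ : ι → ℂ, (u : Matrix ι ι ℂ) = NormedSpace.exp (coadMatrix e ξ)}

/-- The image in `GL(𝔤*)` of the connected real Lie group `G₀` with Lie algebra `𝔤₀`: the group
generated by the `exp(ad*(ξ))`, `ξ ∈ 𝔤₀`. -/
def realCoadjointGroup (e : Module.Basis ι ℝ 𝔤₀) : Subgroup (Matrix ι ι ℂ)ˣ :=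
  Subgroup.closure {u | ∃ ξ : ι → ℝ,
    (u : Matrix ι ι ℂ) = NormedSpace.exp (coadMatrix e fun i => (ξ i : ℂ))}

/-- The `G`-orbit of `z₀` in `𝔤*`. -/
def coadjointOrbit (e : Module.Basis ι ℝ 𝔤₀) (z₀ : ι → ℂ) : Set (ι → ℂ) :=
  {z | ∃ u ∈ coadjointGroup e, (u : Matrix ι ι ℂ) *ᵥ z₀ = z}

/-- The leaf topology of `𝔤*`: the disjoint union topology of the `G`-orbits, each of which
carries its topology as a homogeneous space (which can be finer than the subspace topology).
A set is open if with each point `z` it contains `exp(ad*(ξ)) z` for all small `ξ ∈ 𝔤`. -/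
@[reducible]
def orbitTopology (e : Module.Basis ι ℝ 𝔤₀) : TopologicalSpace (ι → ℂ) where
  IsOpen V := ∀ z ∈ V, ∀ᶠ ξ in 𝓝 (0 : ι → ℂ), coadExp e ξ z ∈ V
  isOpen_univ := by simp
  isOpen_inter := fun s t hs ht z hz => (hs z hz.1).and (ht z hz.2)
  isOpen_sUnion := fun S hS z ⟨t, ht, hz⟩ =>
    (hS t ht z hz).mono fun _ h => ⟨t, ht, h⟩

/-- The maximal (over `𝔤*`) rank of the linear Poisson bivector `c`. -/
def genericRank (e : Module.Basis ι ℝ 𝔤₀) : ℕ := sSup (Set.range fun z => (poissonMatrix e z).rank)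

/-- `Sing 𝔤*`: the union of the symplectic leaves of `c` of nonmaximal dimension. -/
def singularSet (e : Module.Basis ι ℝ 𝔤₀) : Set (ι → ℂ) :=
  {z | (poissonMatrix e z).rank < genericRank e}

/-- The codimension of the complex algebraic set `Sing 𝔤*`, as the height of its ideal. -/
def singularCodim (e : Module.Basis ι ℝ 𝔤₀) : ℕ∞ :=
  (MvPolynomial.vanishingIdeal ℂ (singularSet e)).height

/-- The incompleteness set `𝒞`. -/
def incompletenessSet (e : Module.Basis ι ℝ 𝔤₀) : Set (ι → ℂ) :=
  {z | ∃ l₁ l₂ : ℂ, (l₁, l₂) ≠ (0, 0) ∧ l₁ • z + l₂ • star z ∈ singularSet e}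

/-- `μ(z) = dim (ker c(z) ∩ ker c̃(z))` on `(1,0)`-covectors, where `c̃(z) = c(z̄)` as matrices. -/
def commonKernelDim (e : Module.Basis ι ℝ 𝔤₀) (z : ι → ℂ) : ℕ :=
  Module.finrank ℂ
    (LinearMap.ker (poissonMatrix e z).mulVecLin ⊓
      LinearMap.ker (poissonMatrix e (star z)).mulVecLin : Submodule ℂ (ι → ℂ))

/-- The trivial Kronecker dimension `μ`, the minimal value of `μ(z)`. -/
def kroneckerDim (e : Module.Basis ι ℝ 𝔤₀) : ℕ := sInf (Set.range (commonKernelDim e))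

/-- The Kronecker irregularity set `ℛ`: the smallest set that contains `𝒞` and outside of which
`μ(z)` is constant and minimal. -/
def irregularitySet (e : Module.Basis ι ℝ 𝔤₀) : Set (ι → ℂ) :=
  incompletenessSet e ∪ {z | commonKernelDim e z ≠ kroneckerDim e}

/-- The component on `∂/∂z_i` of a real covector `φ` of `𝔤*`, i.e. `φ(∂/∂z_i)`, where
`∂/∂z_i = (∂/∂x_i - I ∂/∂y_i) / 2`. -/
def holComponent (φ : (ι → ℂ) →ₗ[ℝ] ℝ) (i : ι) : ℂ :=
  ((φ (Pi.single i 1) : ℂ) - Complex.I * (φ (Pi.single i Complex.I) : ℂ)) / 2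

/-- The value `c(z)(φ, ψ)` of the holomorphic linear Poisson bivector on real covectors of `𝔤*`.
It is tangent to the orbits: it depends only on the restrictions of `φ` and `ψ` to the tangent
space at `z` of the orbit of `z`, and so it is also the value of `c|_M = ω⁻¹` on these. -/
def linearPoisson (e : Module.Basis ι ℝ 𝔤₀) (z : ι → ℂ) (φ ψ : (ι → ℂ) →ₗ[ℝ] ℝ) : ℂ :=
  liePairing e z (holComponent φ) (holComponent ψ)

open Classical in
/-- The holomorphic symplectic form `ω = (c|_M)⁻¹` of the orbit through `z`, on tangent vectors
`v, w ∈ T_z M = {ad*(ξ) z}`, see `symplecticForm_apply`. -/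
def symplecticForm (e : Module.Basis ι ℝ 𝔤₀) (z v w : ι → ℂ) : ℂ :=
  v ⬝ᵥ Classical.epsilon fun η => coadAt e z η = w

lemma symplecticForm_apply (e : Module.Basis ι ℝ 𝔤₀) (z ξ η : ι → ℂ) :
    symplecticForm e z (coadAt e z ξ) (coadAt e z η) = liePairing e z ξ η := by
  have h : coadAt e z (Classical.epsilon fun η' => coadAt e z η' = coadAt e z η) =
      coadAt e z η :=
    Classical.epsilon_spec (p := fun η' => coadAt e z η' = coadAt e z η) ⟨η, rfl⟩
  unfold symplecticForm
  rw [coadAt_dotProduct, liePairing_skew, ← coadAt_dotProduct, h, coadAt_dotProduct,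
    ← liePairing_skew]

open Classical in
/-- The exponential parametrization `ξ ↦ exp(ad*(ξ)) z` of a neighbourhood of `z` in an open
subset `U` of an orbit (with a dummy value where it leaves `U`). -/
def expAt (e : Module.Basis ι ℝ 𝔤₀) {U : Set (ι → ℂ)} (z : U) (ξ : ι → ℂ) : U :=
  if h : coadExp e ξ z ∈ U then ⟨coadExp e ξ z, h⟩ else z

end Algebra

/-! ### Bivector fields and bihamiltonian structures on a real manifold -/

section Bihamiltonian

variable (E : Type*) [NormedAddCommGroup E] [NormedSpace ℝ E]
  (N : Type*) [TopologicalSpace N] [ChartedSpace E N]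

/-- A field of bilinear forms on the cotangent spaces; a bivector field if alternating. -/
abbrev BivectorField := (x : N) → LinearMap.BilinForm ℝ (Module.Dual ℝ (TangentSpace 𝓘(ℝ, E) x))

variable {E N}

/-- The bracket `{f, g}_c = c(df, dg)`. -/
def bracket (c : BivectorField E N) (f g : N → ℝ) (x : N) : ℝ :=
  c x (mfderiv 𝓘(ℝ, E) 𝓘(ℝ, ℝ) f x).toLinearMap (mfderiv 𝓘(ℝ, E) 𝓘(ℝ, ℝ) g x).toLinearMap

/-- A smooth bivector field: alternating, and the bracket of smooth functions defined on an open
set is smooth. -/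
structure IsSmoothBivector (c : BivectorField E N) : Prop where
  alt : ∀ x, (c x).IsAlt
  smooth : ∀ (V : Set N) (f g : N → ℝ), IsOpen V →
    ContMDiffOn 𝓘(ℝ, E) 𝓘(ℝ, ℝ) ∞ f V → ContMDiffOn 𝓘(ℝ, E) 𝓘(ℝ, ℝ) ∞ g V →
    ContMDiffOn 𝓘(ℝ, E) 𝓘(ℝ, ℝ) ∞ (bracket c f g) V

/-- A Poisson bivector field: the bracket satisfies the Jacobi identity. -/
structure IsPoisson (c : BivectorField E N) : Prop extends IsSmoothBivector c where
  jacobi : ∀ (V : Set N) (f g h : N → ℝ), IsOpen V →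
    ContMDiffOn 𝓘(ℝ, E) 𝓘(ℝ, ℝ) ∞ f V → ContMDiffOn 𝓘(ℝ, E) 𝓘(ℝ, ℝ) ∞ g V →
    ContMDiffOn 𝓘(ℝ, E) 𝓘(ℝ, ℝ) ∞ h V → ∀ x ∈ V,
    bracket c f (bracket c g h) x + bracket c g (bracket c h f) x +
      bracket c h (bracket c f g) x = 0

/-- The real span of `c₁, c₂` is a bihamiltonian structure: all its elements are Poisson, and
`c₁, c₂` are linearly independent or both zero (the trivial structure). -/
structure IsBihamiltonian (c₁ c₂ : BivectorField E N) : Prop where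
  poisson : ∀ a b : ℝ, IsPoisson fun x => a • c₁ x + b • c₂ x
  indep_or_trivial :
    (∀ a b : ℝ, (∀ x, a • c₁ x + b • c₂ x = 0) → a = 0 ∧ b = 0) ∨
      ((∀ x, c₁ x = 0) ∧ ∀ x, c₂ x = 0)

/-- The rank at `x` of `l₁ c₁ + l₂ c₂`, a bivector on the complexified cotangent space. -/
def pencilRank (c₁ c₂ : BivectorField E N) (l₁ l₂ : ℂ) (x : N) : ℕ :=
  Module.finrank ℂ (LinearMap.range
    (l₁ • (c₁ x).baseChange ℂ + l₂ • (c₂ x).baseChange ℂ))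

/-- The maximal rank `R₀` of the bivectors of the real bihamiltonian structure, over all points. -/
def maxRank (c₁ c₂ : BivectorField E N) : ℕ :=
  sSup {k | ∃ (a b : ℝ) (x : N), k = pencilRank c₁ c₂ a b x}

/-- Completeness at `x`: all nonzero bivectors of the complexified structure have rank `R₀`
at `x`. (The trivial structure satisfies this, in agreement with the convention for it.) -/
def IsCompleteAt (c₁ c₂ : BivectorField E N) (x : N) : Prop :=
  ∀ l₁ l₂ : ℂ, (l₁, l₂) ≠ (0, 0) → pencilRank c₁ c₂ l₁ l₂ x = maxRank c₁ c₂

/-- Completeness: completeness at all points of an open dense set. -/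
def IsComplete (c₁ c₂ : BivectorField E N) : Prop :=
  ∃ V : Set N, IsOpen V ∧ Dense V ∧ ∀ x ∈ V, IsCompleteAt c₁ c₂ x

end Bihamiltonian

/-! ### The quotient of an open subset of a coadjoint orbit by the real form, and the reduction -/

section Reduction

variable {𝔤₀ : Type*} [LieRing 𝔤₀] [LieAlgebra ℝ 𝔤₀] {ι : Type*} [Fintype ι] [DecidableEq ι]
  {E : Type*} [NormedAddCommGroup E] [NormedSpace ℝ E]
  {N : Type*} [TopologicalSpace N] [ChartedSpace E N]

/-- The differential of `p : U → N` at `z`, composed with `𝔤 → T_z M, ξ ↦ ad*(ξ) z`: the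
derivative at `0` of `ξ ↦ p (exp(ad*(ξ)) z)`. -/
def orbitDifferential (e : Module.Basis ι ℝ 𝔤₀) {U : Set (ι → ℂ)} (p : U → N) (z : U) :
    (ι → ℂ) →ₗ[ℝ] TangentSpace 𝓘(ℝ, E) (p z) :=
  (mfderiv 𝓘(ℝ, ι → ℂ) 𝓘(ℝ, E) (fun ξ => p (expAt e z ξ)) 0 : (ι → ℂ) →L[ℝ] E).toLinearMap

/-- `p : U → N` presents the manifold `N` as `U / G₀`: it is onto, its fibres are the
intersections of `U` with the `G₀`-orbits, and it is a smooth submersion (for the manifold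
structure of the `G`-orbit, which is given by the exponential parametrizations). -/
structure IsQuotientByRealForm (E : Type*) [NormedAddCommGroup E] [NormedSpace ℝ E]
    {N : Type*} [TopologicalSpace N] [ChartedSpace E N]
    (e : Module.Basis ι ℝ 𝔤₀) {U : Set (ι → ℂ)} (p : U → N) : Prop where
  surjective : Function.Surjective p
  fiber : ∀ z w : U, p z = p w ↔
    ∃ u ∈ realCoadjointGroup e, (u : Matrix ι ι ℂ) *ᵥ (z : ι → ℂ) = w
  smooth : ∀ z : U, ContMDiffAt 𝓘(ℝ, ι → ℂ) 𝓘(ℝ, E) ∞ (fun ξ => p (expAt e z ξ)) 0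
  submersion : ∀ z : U, Function.Surjective (orbitDifferential (E := E) e p z)

/-- `c₁, c₂` are the push-forwards along `p` of `Re c|_M` and `Im c|_M`: they are smooth, and
their values on covectors `α, β` at `p z` are those of `Re c|_M, Im c|_M` on the covectors
`α ∘ dp_z, β ∘ dp_z` of `M` (the restrictions to `T_z M` of covectors `φ, ψ` of `𝔤*`). -/
structure IsReduction (e : Module.Basis ι ℝ 𝔤₀) {U : Set (ι → ℂ)} (p : U → N)
    (c₁ c₂ : BivectorField E N) : Prop where
  smooth₁ : IsSmoothBivector c₁
  smooth₂ : IsSmoothBivector c₂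
  push : ∀ (z : U) (α β : Module.Dual ℝ (TangentSpace 𝓘(ℝ, E) (p z)))
    (φ ψ : (ι → ℂ) →ₗ[ℝ] ℝ),
    (∀ ξ, φ (coadAt e z ξ) = α (orbitDifferential e p z ξ)) →
    (∀ ξ, ψ (coadAt e z ξ) = β (orbitDifferential e p z ξ)) →
    c₁ (p z) α β = (linearPoisson e z φ ψ).re ∧ c₂ (p z) α β = (linearPoisson e z φ ψ).im

/-- The tangent space `T_z 𝒦 = ker dp_z ⊆ T_z M` of the leaves of `p`. -/
def leafTangent (E : Type*) [NormedAddCommGroup E] [NormedSpace ℝ E]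
    {N : Type*} [TopologicalSpace N] [ChartedSpace E N]
    (e : Module.Basis ι ℝ 𝔤₀) {U : Set (ι → ℂ)} (p : U → N) (z : U) : Submodule ℝ (ι → ℂ) :=
  (LinearMap.ker (orbitDifferential (E := E) e p z)).map ((coadAt e z).restrictScalars ℝ)

/-- `T^{CR}_z 𝒦 = T_z 𝒦 ∩ I T_z 𝒦`, isomorphic to `T^{1,0}_z 𝒦` by `v ↦ v - I 𝒥 v`. -/
def leafCRTangent (E : Type*) [NormedAddCommGroup E] [NormedSpace ℝ E]
    {N : Type*} [TopologicalSpace N] [ChartedSpace E N]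
    (e : Module.Basis ι ℝ 𝔤₀) {U : Set (ι → ℂ)} (p : U → N) (z : U) : Submodule ℝ (ι → ℂ) :=
  leafTangent E e p z ⊓
    (leafTangent E e p z).map
      ((Complex.I • (LinearMap.id : (ι → ℂ) →ₗ[ℂ] (ι → ℂ))).restrictScalars ℝ)

/-- The leaves of `p` form a CR-isotropic foliation of `U`: the dimension of `T^{1,0}𝒦` is constant
along the leaves, and `T^{1,0}𝒦` is contained in its `ω`-orthogonal complement.  Since `ω` is of
type `(2,0)`, its value on `v - I 𝒥 v, w - I 𝒥 w` is four times that on `v, w`. -/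
structure IsCRIsotropicFoliation (E : Type*) [NormedAddCommGroup E] [NormedSpace ℝ E]
    {N : Type*} [TopologicalSpace N] [ChartedSpace E N]
    (e : Module.Basis ι ℝ 𝔤₀) {U : Set (ι → ℂ)} (p : U → N) : Prop where
  cr : ∀ z w : U, p z = p w →
    Module.finrank ℝ (leafCRTangent E e p z) = Module.finrank ℝ (leafCRTangent E e p w)
  isotropic : ∀ z : U, ∀ v ∈ leafCRTangent E e p z, ∀ w ∈ leafCRTangent E e p z,
    symplecticForm e z v w = 0

/-- `(U, J, 𝒦)` is a minimal realization of the reduction spanned by `c₁, c₂`. -/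
structure IsMinimalRealization (e : Module.Basis ι ℝ 𝔤₀) {U : Set (ι → ℂ)} (p : U → N)
    (c₁ c₂ : BivectorField E N) : Prop where
  reduction : IsReduction e p c₁ c₂
  complete : IsComplete c₁ c₂
  isotropic : IsCRIsotropicFoliation E e p

end Reduction

end Coadjoint

end

/-!
Since `c` is invariant under the real group, the value of `Re c` or `Im c` on two covectors pulled
back from the quotient depends only on the point of the quotient; this gives `c₁'` and `c₂'`.

The fibre of `p` through `z` lies in an orbit of `G₀`, a countable union of plaques of the dimension
of `ad*(𝔤₀) z`, so by Hausdorff dimension the fibre has no larger dimension and its tangent space is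
exactly `ad*(𝔤₀) z`.  A covector of `U'` is therefore a class of `a ∈ 𝔤` with
`c(z)(a, ·) + c(z̄)(ā, ·) = 0` on `𝔤₀`.  With this description the rank of `λ₁ c₁' + λ₂ c₂'` at
`p z` is a matter of linear algebra on the skew pencil spanned by `c(z)` and `c(z̄)`: if `rank c(z)`
is maximal, it equals `2 rank c(z) + 2 μ(z) + rank c(l z + m z̄) - 2 dim 𝔤`, where `(l, m)` is an
invertible linear function of `(λ₁, λ₂)` and `μ` is constant on `U`.  So `J'` is complete at `p z`
when every nonzero combination of `z` and `z̄` is regular.  By elimination theory over the ring of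
real-analytic functions, that holds wherever a suitable real-analytic function does not vanish; one
good point makes this function nonzero on a dense part of the connected orbit.

The `(1, 0)`-vectors of the leaf through `z` are the `ad*(ξ) z` with `c(z̄)(ξ, ·) = 0`.  Where the
rank of `c(z̄)` is maximal, it cannot grow along the pencil through `c(z)`, so `c(z)` maps the
kernel of `c(z̄)` into its range; hence `ω(ad*(ξ) z, ad*(η) z) = c(z)(ξ, η)` vanishes on these
vectors.
-/

noncomputable section

namespace Coadjoint

/-! ### The Baker–Campbell–Hausdorff product of a Banach algebra -/

section BakerCampbellHausdorff

open NormedSpace Set Filter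

attribute [local instance] LieRing.ofAssociativeRing

lemma mem_of_hasDerivAt_of_lipschitzOnWith {F : Type*} [NormedAddCommGroup F] [NormedSpace ℝ F]
    {W : Submodule ℝ F} (P : F →L[ℝ] W) (hP : ∀ x : W, P x = x) {v : F → F} {S : Set F}
    {K : NNReal} (hv : LipschitzOnWith K v S) (hvW : ∀ x ∈ W, x ∈ S → v x ∈ W) {γ : ℝ → F}
    (hγ : ∀ s ∈ Icc (0 : ℝ) 1, HasDerivAt γ (v (γ s)) s) (hS : ∀ s ∈ Icc (0 : ℝ) 1, γ s ∈ S)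
    (hPS : ∀ s ∈ Icc (0 : ℝ) 1, (P (γ s) : F) ∈ S) (h0 : γ 0 ∈ W) : γ 1 ∈ W := by
  set Q : F →L[ℝ] F := ContinuousLinearMap.id ℝ F - W.subtypeL ∘L P
  have hQ (x : F) : Q x = x - P x := rfl
  have hQW {x : F} (hx : x ∈ W) : Q x = 0 := by rw [hQ, hP ⟨x, hx⟩, sub_self]
  have hd (s) (hs : s ∈ Icc (0 : ℝ) 1) : HasDerivAt (fun t => Q (γ t)) (Q (v (γ s))) s :=
    Q.hasFDerivAt.comp_hasDerivAt s (hγ s hs)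
  have hbound (s) (hs : s ∈ Icc (0 : ℝ) 1) : ‖Q (v (γ s))‖ ≤ ‖Q‖ * K * ‖Q (γ s)‖ :=
    calc ‖Q (v (γ s))‖ = ‖Q (v (γ s) - v (P (γ s)))‖ := by
          rw [map_sub, hQW (hvW _ (P (γ s)).2 (hPS s hs)), sub_zero]
      _ ≤ ‖Q‖ * (K * ‖γ s - P (γ s)‖) :=
          (Q.le_opNorm _).trans (by gcongr; exact hv.norm_sub_le (hS s hs) (hPS s hs))
      _ = ‖Q‖ * K * ‖Q (γ s)‖ := by rw [hQ, mul_assoc]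
  have hzero : Q (γ 1) = 0 :=
    eq_zero_of_abs_deriv_le_mul_abs_self_of_eq_zero_right (b := 1)
      (fun s hs => (hd s hs).continuousAt.continuousWithinAt)
      (fun s hs => (hd s (Ico_subset_Icc_self hs)).hasDerivWithinAt) (hQW h0)
      (fun s hs => hbound s (Ico_subset_Icc_self hs)) 1 (by simp)
  rw [hQ, sub_eq_zero] at hzero
  exact hzero ▸ (P (γ 1)).2

variable {𝔸 : Type*} [NormedRing 𝔸] [NormedAlgebra ℝ 𝔸] [CompleteSpace 𝔸]

lemma exp_neg_mul_exp (X : 𝔸) : exp (-X) * exp X = 1 := by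
  let _ : NormedAlgebra ℚ 𝔸 := NormedAlgebra.restrictScalars ℚ ℝ 𝔸
  rw [← exp_add_of_commute (Commute.refl X).neg_left, neg_add_cancel, exp_zero]

lemma exp_mul_exp_neg (X : 𝔸) : exp X * exp (-X) = 1 := by
  simpa using exp_neg_mul_exp (-X)

lemma contDiff_exp {n : WithTop ℕ∞} : ContDiff ℝ n (exp : 𝔸 → 𝔸) :=
  contDiff_iff_contDiffAt.2 fun x => (exp_analytic (𝕂 := ℝ) x).contDiffAt

lemma continuous_exp : Continuous (exp : 𝔸 → 𝔸) :=
  (contDiff_exp (n := 0)).continuous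

lemma hasFDerivAt_exp (X : 𝔸) : HasFDerivAt exp (fderiv ℝ exp X) X :=
  ((contDiff_exp (n := 1)).differentiable one_ne_zero X).hasFDerivAt

lemma hasDerivAt_exp_neg_smul (X : 𝔸) (s : ℝ) :
    HasDerivAt (fun s : ℝ => exp (-(s • X))) (-(exp (-(s • X)) * X)) s := by
  simpa using hasDerivAt_exp_smul_const (𝕂 := ℝ) (-X) s

lemma exp_conj_mem {𝔥 : LieSubalgebra ℝ 𝔸} [FiniteDimensional ℝ 𝔥] {X H : 𝔸} (hX : X ∈ 𝔥)
    (hH : H ∈ 𝔥) : exp (-X) * H * exp X ∈ 𝔥 := by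
  obtain ⟨P, hP⟩ := Submodule.ClosedComplemented.of_finiteDimensional 𝔥.toSubmodule
  let v : 𝔸 →L[ℝ] 𝔸 := (ContinuousLinearMap.mul ℝ 𝔸).flip X - ContinuousLinearMap.mul ℝ 𝔸 X
  have hv (Y : 𝔸) : v Y = ⁅Y, X⁆ := rfl
  have hd (s : ℝ) : HasDerivAt (fun s : ℝ => exp (-(s • X)) * H * exp (s • X))
      (v (exp (-(s • X)) * H * exp (s • X))) s := by
    refine (((hasDerivAt_exp_neg_smul X s).mul_const H).mul
      (hasDerivAt_exp_smul_const (𝕂 := ℝ) X s)).congr_deriv ?_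
    have hc : exp (-(s • X)) * X = X * exp (-(s • X)) :=
      ((Commute.refl X).smul_right s).neg_right.exp_right.eq.symm
    rw [hv, Ring.lie_def, hc]
    noncomm_ring
  simpa using mem_of_hasDerivAt_of_lipschitzOnWith P hP v.lipschitz.lipschitzOnWith (S := univ)
    (fun Y hY _ => 𝔥.lie_mem hY hX) (fun s _ => hd s) (by simp) (by simp) (by simpa)

lemma exp_neg_mul_exp_sub_one (X Z : 𝔸) :
    exp (-X) * exp Z - 1 = ∫ s in (0 : ℝ)..1, exp (-(s • X)) * (Z - X) * exp (s • Z) := by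
  have hd (s : ℝ) : HasDerivAt (fun s : ℝ => exp (-(s • X)) * exp (s • Z))
      (exp (-(s • X)) * (Z - X) * exp (s • Z)) s := by
    refine ((hasDerivAt_exp_neg_smul X s).mul
      (hasDerivAt_exp_smul_const' (𝕂 := ℝ) Z s)).congr_deriv ?_
    noncomm_ring
  have := continuous_exp (𝔸 := 𝔸)
  rw [intervalIntegral.integral_eq_sub_of_hasDerivAt (fun s _ => hd s)
    (Continuous.intervalIntegrable (by fun_prop) _ _)]
  simp

lemma exp_neg_mul_fderiv_exp (X H : 𝔸) :
    exp (-X) * fderiv ℝ exp X H = ∫ s in (0 : ℝ)..1, exp (-(s • X)) * H * exp (s • X) := by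
  have hc := continuous_exp (𝔸 := 𝔸)
  have hline : HasDerivAt (fun t : ℝ => X + t • H) H 0 := by
    simpa using ((hasDerivAt_id (0 : ℝ)).smul_const H).const_add X
  have hderiv : HasDerivAt (fun t : ℝ => exp (-X) * exp (X + t • H) - 1)
      (exp (-X) * fderiv ℝ exp X H) 0 := by
    have he : HasFDerivAt exp (fderiv ℝ exp X) (X + (0 : ℝ) • H) := by
      simpa using hasFDerivAt_exp X
    exact ((he.comp_hasDerivAt 0 hline).const_mul _).sub_const _
  let I : ℝ → 𝔸 := fun t => ∫ s in (0 : ℝ)..1, exp (-(s • X)) * H * exp (s • (X + t • H))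
  have hI : Continuous I := by
    apply intervalIntegral.continuous_parametric_intervalIntegral_of_continuous'
    dsimp only [Function.uncurry_def]
    fun_prop
  have hfactor : (fun t : ℝ => exp (-X) * exp (X + t • H) - 1) = fun t => t • I t := by
    funext t
    rw [exp_neg_mul_exp_sub_one, ← intervalIntegral.integral_smul]
    simp
  have hderiv' : HasDerivAt (fun t : ℝ => t • I t) (I 0) 0 := by
    rw [hasDerivAt_iff_tendsto_slope]
    refine (hI.continuousAt.tendsto (x := 0)).mono_left nhdsWithin_le_nhds |>.congr' ?_
    filter_upwards [self_mem_nhdsWithin] with t ht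
    simp [slope_def_module, smul_smul, inv_mul_cancel₀ (show t ≠ 0 from ht)]
  rw [hfactor] at hderiv
  simpa [I] using hderiv.unique hderiv'

lemma exp_neg_mul_fderiv_exp_mem {𝔥 : LieSubalgebra ℝ 𝔸} [FiniteDimensional ℝ 𝔥] {X H : 𝔸}
    (hX : X ∈ 𝔥) (hH : H ∈ 𝔥) : exp (-X) * fderiv ℝ exp X H ∈ 𝔥 := by
  obtain ⟨P, hP⟩ := Submodule.ClosedComplemented.of_finiteDimensional 𝔥.toSubmodule
  have hc := continuous_exp (𝔸 := 𝔸)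
  have hfix : (P (exp (-X) * fderiv ℝ exp X H) : 𝔸) = exp (-X) * fderiv ℝ exp X H := by
    rw [exp_neg_mul_fderiv_exp, ← Submodule.subtypeL_apply, ← ContinuousLinearMap.comp_apply,
      ← ContinuousLinearMap.intervalIntegral_comp_comm _
        (Continuous.intervalIntegrable (by fun_prop) _ _)]
    congr with s
    exact congrArg Subtype.val (hP ⟨_, exp_conj_mem (𝔥.smul_mem s hX) hH⟩)
  exact hfix ▸ (P _).2

/-- The logarithm near `1`: the local inverse of the exponential given by the inverse function
theorem. It is an unspecified function away from `1`. -/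
def localLog : 𝔸 → 𝔸 :=
  (contDiff_exp.contDiffAt (n := ∞) (x := (0 : 𝔸))).localInverse
    (f' := ContinuousLinearEquiv.refl ℝ 𝔸) hasFDerivAt_exp_zero (by simp)

lemma hasStrictFDerivAt_exp_zero_refl :
    HasStrictFDerivAt (exp : 𝔸 → 𝔸) (ContinuousLinearEquiv.refl ℝ 𝔸 : 𝔸 →L[ℝ] 𝔸) 0 :=
  hasStrictFDerivAt_exp_zero

lemma contDiffAt_localLog : ContDiffAt ℝ ∞ (localLog : 𝔸 → 𝔸) 1 := by
  simpa [localLog] using (contDiff_exp.contDiffAt (n := ∞) (x := (0 : 𝔸))).to_localInverse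
    (f' := ContinuousLinearEquiv.refl ℝ 𝔸) hasFDerivAt_exp_zero (by simp)

lemma localLog_one : localLog (1 : 𝔸) = 0 := by
  simpa [localLog] using
    (contDiff_exp.contDiffAt (n := ∞) (x := (0 : 𝔸))).localInverse_apply_image
      (f' := ContinuousLinearEquiv.refl ℝ 𝔸) hasFDerivAt_exp_zero (by simp)

lemma eventually_localLog_exp : ∀ᶠ X in 𝓝 (0 : 𝔸), localLog (exp X) = X :=
  hasStrictFDerivAt_exp_zero_refl.eventually_left_inverse

lemma eventually_exp_localLog : ∀ᶠ g in 𝓝 (1 : 𝔸), exp (localLog g) = g := by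
  exact exp_zero (𝔸 := 𝔸) ▸ (hasStrictFDerivAt_exp_zero_refl (𝔸 := 𝔸)).eventually_right_inverse

lemma hasStrictFDerivAt_localLog_one :
    HasStrictFDerivAt localLog (ContinuousLinearMap.id ℝ 𝔸) 1 := by
  exact exp_zero (𝔸 := 𝔸) ▸ (hasStrictFDerivAt_exp_zero_refl (𝔸 := 𝔸)).to_localInverse

lemma eventually_contDiffAt_localLog :
    ∀ᶠ g in 𝓝 (1 : 𝔸), ContDiffAt ℝ 1 (localLog : 𝔸 → 𝔸) g :=
  (contDiffAt_localLog.of_le (by simp)).eventually (by simp)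

lemma tendsto_exp_zero : Tendsto (exp : 𝔸 → 𝔸) (𝓝 0) (𝓝 1) := by
  simpa using continuous_exp.tendsto (0 : 𝔸)

lemma eventually_fderiv_localLog_fderiv_exp :
    ∀ᶠ Y in 𝓝 (0 : 𝔸), ∀ H, fderiv ℝ localLog (exp Y) (fderiv ℝ exp Y H) = H := by
  filter_upwards [eventually_localLog_exp.eventually_nhds,
    tendsto_exp_zero.eventually eventually_contDiffAt_localLog] with Y hY hlog H
  have hcomp : HasFDerivAt (fun X => localLog (exp X))
      ((fderiv ℝ localLog (exp Y)).comp (fderiv ℝ exp Y)) Y :=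
    (hlog.differentiableAt one_ne_zero).hasFDerivAt.comp Y (hasFDerivAt_exp Y)
  have hid : HasFDerivAt (fun X => localLog (exp X)) (ContinuousLinearMap.id ℝ 𝔸) Y :=
    (hasFDerivAt_id Y).congr_of_eventuallyEq hY
  exact DFunLike.congr_fun (hcomp.unique hid) H

/-- The Baker–Campbell–Hausdorff product `log (exp X * exp Y)`, meaningful for small `X, Y`. -/
def bchMul (q : 𝔸 × 𝔸) : 𝔸 := localLog (exp q.1 * exp q.2)

lemma bchMul_zero : bchMul (0 : 𝔸 × 𝔸) = 0 := by simp [bchMul, localLog_one]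

lemma bchMul_neg_self (X : 𝔸) : bchMul (-X, X) = 0 := by
  simp [bchMul, exp_neg_mul_exp, localLog_one]

lemma continuous_exp_mul_exp : Continuous fun q : 𝔸 × 𝔸 => exp q.1 * exp q.2 :=
  (continuous_exp.comp continuous_fst).mul (continuous_exp.comp continuous_snd)

lemma tendsto_exp_mul_exp : Tendsto (fun q : 𝔸 × 𝔸 => exp q.1 * exp q.2) (𝓝 0) (𝓝 1) := by
  simpa using continuous_exp_mul_exp.tendsto (0 : 𝔸 × 𝔸)

lemma eventually_exp_bchMul : ∀ᶠ q in 𝓝 (0 : 𝔸 × 𝔸), exp (bchMul q) = exp q.1 * exp q.2 :=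
  tendsto_exp_mul_exp.eventually eventually_exp_localLog

lemma eventually_continuousAt_bchMul : ∀ᶠ q in 𝓝 (0 : 𝔸 × 𝔸), ContinuousAt bchMul q := by
  filter_upwards [tendsto_exp_mul_exp.eventually eventually_contDiffAt_localLog] with q hq
  exact ContinuousAt.comp (f := fun q : 𝔸 × 𝔸 => exp q.1 * exp q.2) hq.continuousAt
    continuous_exp_mul_exp.continuousAt

lemma tendsto_bchMul : Tendsto bchMul (𝓝 (0 : 𝔸 × 𝔸)) (𝓝 0) := by
  simpa [ContinuousAt, bchMul_zero] using (eventually_continuousAt_bchMul (𝔸 := 𝔸)).self_of_nhds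

lemma hasStrictFDerivAt_bchMul : HasStrictFDerivAt bchMul
    (ContinuousLinearMap.fst ℝ 𝔸 𝔸 + ContinuousLinearMap.snd ℝ 𝔸 𝔸) 0 := by
  have hfst : HasStrictFDerivAt (fun q : 𝔸 × 𝔸 => exp q.1)
      ((1 : 𝔸 →L[ℝ] 𝔸).comp (ContinuousLinearMap.fst ℝ 𝔸 𝔸)) 0 :=
    HasStrictFDerivAt.comp (0 : 𝔸 × 𝔸) (f := Prod.fst) (hasStrictFDerivAt_exp_zero (𝕂 := ℝ))
      hasStrictFDerivAt_fst
  have hsnd : HasStrictFDerivAt (fun q : 𝔸 × 𝔸 => exp q.2)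
      ((1 : 𝔸 →L[ℝ] 𝔸).comp (ContinuousLinearMap.snd ℝ 𝔸 𝔸)) 0 :=
    HasStrictFDerivAt.comp (0 : 𝔸 × 𝔸) (f := Prod.snd) (hasStrictFDerivAt_exp_zero (𝕂 := ℝ))
      hasStrictFDerivAt_snd
  have hlog : HasStrictFDerivAt localLog (ContinuousLinearMap.id ℝ 𝔸)
      (exp (0 : 𝔸 × 𝔸).1 * exp (0 : 𝔸 × 𝔸).2) := by simpa using hasStrictFDerivAt_localLog_one
  refine (hlog.comp (0 : 𝔸 × 𝔸) (hfst.mul' hsnd)).congr_fderiv ?_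
  ext q <;> simp

/-- The velocity at `Y` of the curves `t ↦ log (exp Y * exp (t ζ))`, as a function of `(Y, ζ)`. -/
def bchField (p : 𝔸 × 𝔸) : 𝔸 := fderiv ℝ localLog (exp p.1) (exp p.1 * p.2)

lemma contDiffAt_bchField : ContDiffAt ℝ 1 bchField (0 : 𝔸 × 𝔸) := by
  have hlog : ContDiffAt ℝ 1 (fderiv ℝ (localLog : 𝔸 → 𝔸)) (exp (0 : 𝔸 × 𝔸).1) := by
    simpa using contDiffAt_localLog.fderiv_right (m := ∞) le_rfl |>.of_le (by simp)
  have hexp : ContDiffAt ℝ 1 (fun p : 𝔸 × 𝔸 => exp p.1) 0 :=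
    (contDiff_exp.comp contDiff_fst).contDiffAt
  exact (hlog.comp (0 : 𝔸 × 𝔸) hexp).clm_apply (hexp.mul contDiffAt_snd)

lemma hasDerivAt_bchMul_smul {X ζ : 𝔸} {s : ℝ}
    (hlog : ContDiffAt ℝ 1 localLog (exp X * exp (s • ζ)))
    (hexp : exp (bchMul (X, s • ζ)) = exp X * exp (s • ζ)) :
    HasDerivAt (fun s : ℝ => bchMul (X, s • ζ)) (bchField (bchMul (X, s • ζ), ζ)) s := by
  refine ((hlog.differentiableAt one_ne_zero).hasFDerivAt.comp_hasDerivAt s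
    ((hasDerivAt_exp_smul_const (𝕂 := ℝ) ζ s).const_mul (exp X))).congr_deriv ?_
  simp only [bchField, hexp, mul_assoc]

/- `ζ ↦ exp (-Y) * d exp_Y ζ` maps `𝔥` injectively to itself, hence onto `𝔥` as `dim 𝔥 < ∞`. -/
lemma eventually_bchField_mem (𝔥 : LieSubalgebra ℝ 𝔸) [FiniteDimensional ℝ 𝔥] :
    ∀ᶠ Y in 𝓝 (0 : 𝔸), Y ∈ 𝔥 → ∀ ζ ∈ 𝔥, bchField (Y, ζ) ∈ 𝔥 := by
  filter_upwards [eventually_fderiv_localLog_fderiv_exp] with Y hlog hY ζ hζ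
  let A : 𝔥 →ₗ[ℝ] 𝔥 := LinearMap.restrict (p := 𝔥.toSubmodule) (q := 𝔥.toSubmodule)
    (LinearMap.mulLeft ℝ (exp (-Y)) ∘ₗ (fderiv ℝ exp Y).toLinearMap)
    (fun H hH => exp_neg_mul_fderiv_exp_mem (𝔥 := 𝔥) hY hH)
  have hA (H : 𝔥) : exp Y * (A H : 𝔸) = fderiv ℝ exp Y H := by
    change exp Y * (exp (-Y) * fderiv ℝ exp Y H) = fderiv ℝ exp Y H
    rw [← mul_assoc, exp_mul_exp_neg, one_mul]
  have hinj : Function.Injective A := fun H₁ H₂ h => by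
    apply Subtype.ext
    rw [← hlog H₁, ← hlog H₂, ← hA, ← hA, h]
  obtain ⟨H, hH⟩ := LinearMap.injective_iff_surjective.1 hinj ⟨ζ, hζ⟩
  have hH' : bchField (Y, ζ) = H := by rw [bchField, ← hlog H, ← hA, hH]
  rw [hH']
  exact H.2

lemma eventually_bchMul_mem (𝔥 : LieSubalgebra ℝ 𝔸) [FiniteDimensional ℝ 𝔥] :
    ∀ᶠ q in 𝓝 (0 : 𝔸 × 𝔸), q.1 ∈ 𝔥 → q.2 ∈ 𝔥 → bchMul q ∈ 𝔥 := by
  obtain ⟨P, hP⟩ := Submodule.ClosedComplemented.of_finiteDimensional 𝔥.toSubmodule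
  obtain ⟨K, t, ht, hK⟩ := (contDiffAt_bchField (𝔸 := 𝔸)).exists_lipschitzOnWith
  let T (ζ : 𝔸) : Set 𝔸 := {Y | (Y, ζ) ∈ t ∧ (Y ∈ 𝔥 → ∀ ζ ∈ 𝔥, bchField (Y, ζ) ∈ 𝔥)}
  have hT : ∀ᶠ p in 𝓝 (0 : 𝔸 × 𝔸), p.1 ∈ T p.2 := Filter.Eventually.and ht
    ((continuous_fst.tendsto (0 : 𝔸 × 𝔸)).eventually (eventually_bchField_mem 𝔥))
  have hPT : ∀ᶠ p in 𝓝 (0 : 𝔸 × 𝔸), (P p.1 : 𝔸) ∈ T p.2 :=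
    (show Continuous fun p : 𝔸 × 𝔸 => ((P p.1 : 𝔸), p.2) by fun_prop).tendsto' 0 0 (by simp)
      |>.eventually hT
  have hsegment : ∀ᶠ q in 𝓝 (0 : 𝔸 × 𝔸), ∀ s ∈ Icc (0 : ℝ) 1,
      (bchMul (q.1, s • q.2) ∈ T q.2 ∧ (P (bchMul (q.1, s • q.2)) : 𝔸) ∈ T q.2) ∧
        ContDiffAt ℝ 1 localLog (exp q.1 * exp (s • q.2)) ∧
          exp (bchMul (q.1, s • q.2)) = exp q.1 * exp (s • q.2) := by
    refine isCompact_Icc.eventually_forall_of_forall_eventually fun s _ => ?_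
    have hsmul : Tendsto (fun p : (𝔸 × 𝔸) × ℝ => (p.1.1, p.2 • p.1.2)) (𝓝 (0, s)) (𝓝 0) :=
      Continuous.tendsto' (by fun_prop) _ _ (by simp)
    have hsnd : Tendsto (fun p : (𝔸 × 𝔸) × ℝ => p.1.2) (𝓝 (0, s)) (𝓝 0) :=
      Continuous.tendsto' (by fun_prop) _ _ rfl
    exact (((tendsto_bchMul.comp hsmul).prodMk_nhds hsnd).eventually (hT.and hPT)).and
      ((hsmul.eventually (tendsto_exp_mul_exp.eventually eventually_contDiffAt_localLog)).and
        (hsmul.eventually eventually_exp_bchMul))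
  filter_upwards [hsegment, (continuous_fst.tendsto (0 : 𝔸 × 𝔸)).eventually
    eventually_localLog_exp] with q hq hlog hX hζ
  have hv : LipschitzOnWith K (fun Y => bchField (Y, q.2)) (T q.2) :=
    LipschitzOnWith.of_dist_le_mul fun Y hY Z hZ => by
      simpa [dist_prod_same_right] using hK.dist_le_mul _ hY.1 _ hZ.1
  simpa using mem_of_hasDerivAt_of_lipschitzOnWith P hP hv (fun Y hY hYT => hYT.2 hY _ hζ)
    (γ := fun s => bchMul (q.1, s • q.2))
    (fun s hs => hasDerivAt_bchMul_smul (hq s hs).2.1 (hq s hs).2.2)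
    (fun s hs => (hq s hs).1.1) (fun s hs => (hq s hs).1.2) (by simpa [bchMul, hlog] using hX)

end BakerCampbellHausdorff

/-! ### Orbits of the group generated by the exponentials of a Lie algebra of operators -/

section ExponentialOrbits

open NormedSpace Set Filter

attribute [local instance] LieRing.ofAssociativeRing

section Group

variable {𝔸 : Type*} [NormedRing 𝔸] [NormedAlgebra ℝ 𝔸]

/-- The group generated by the exponentials of the elements of `𝔥`. -/
def expGroup (𝔥 : LieSubalgebra ℝ 𝔸) : Subgroup 𝔸ˣ :=
  Subgroup.closure {u | ∃ X ∈ 𝔥, (u : 𝔸) = exp X}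

lemma exists_contDiff_section {V : Type*} [NormedAddCommGroup V] [NormedSpace ℝ V]
    {L : V →ₗ[ℝ] 𝔸} {𝔥 : LieSubalgebra ℝ 𝔸} [FiniteDimensional ℝ 𝔥]
    (hL : 𝔥.toSubmodule ≤ LinearMap.range L) :
    ∃ κ : 𝔥 → V, ContDiff ℝ ∞ κ ∧ κ 0 = 0 ∧ ∀ X, L (κ X) = X := by
  obtain ⟨R, hR⟩ := L.rangeRestrict.exists_rightInverse_of_surjective L.range_rangeRestrict
  let κ : 𝔥 →ₗ[ℝ] V := R ∘ₗ Submodule.inclusion hL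
  exact ⟨κ, (LinearMap.toContinuousLinearMap κ).contDiff, map_zero κ,
    fun X => congrArg Subtype.val (DFunLike.congr_fun hR (Submodule.inclusion hL X))⟩

variable [CompleteSpace 𝔸]

lemma exp_mul_eq_mul_exp_of_hasDerivAt {X : 𝔸} {f : ℝ → 𝔸}
    (hf : ∀ t, HasDerivAt f (f t * X - X * f t) t) : exp X * f 1 = f 0 * exp X := by
  let F (t : ℝ) : 𝔸 := exp (t • X) * f t * exp (-(t • X))
  have hF (t : ℝ) : HasDerivAt F 0 t := by
    refine (((hasDerivAt_exp_smul_const X t).mul (hf t)).mul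
      (hasDerivAt_exp_neg_smul X t)).congr_deriv ?_
    have hcomm : exp (-(t • X)) * X = X * exp (-(t • X)) :=
      ((Commute.refl X).smul_right t).neg_right.exp_right.eq.symm
    simp only [hcomm, Pi.mul_apply, add_mul, mul_sub, sub_mul, mul_assoc, mul_neg]
    abel
  have hconst : exp X * f 1 * exp (-X) = f 0 := by
    simpa [F] using is_const_of_deriv_eq_zero (fun t => (hF t).differentiableAt)
      (fun t => (hF t).deriv) 1 0
  rw [← hconst, mul_assoc, exp_neg_mul_exp, mul_one]

/- `exp X = exp d * exp (log (exp (-d) * exp X))`, with `d` in a dense subset and close to `X`. -/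
lemma eventually_exists_exp_eq_mul (𝔥 : LieSubalgebra ℝ 𝔸) [FiniteDimensional ℝ 𝔥]
    {D : Set 𝔥} (hD : Dense D) :
    ∀ᶠ X in 𝓝 (0 : 𝔸), X ∈ 𝔥 → ∀ V ∈ 𝓝 (0 : 𝔸),
      ∃ d ∈ D, ∃ Y ∈ 𝔥, Y ∈ V ∧ exp X = exp (d : 𝔸) * exp Y := by
  have hneg : Tendsto (fun X : 𝔸 => (-X, X)) (𝓝 0) (𝓝 0) :=
    Continuous.tendsto' (by fun_prop) _ _ (by simp)
  filter_upwards [hneg.eventually eventually_continuousAt_bchMul,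
    hneg.eventually eventually_exp_bchMul.eventually_nhds,
    hneg.eventually (eventually_bchMul_mem 𝔥).eventually_nhds] with X hcont hexp hmem hX V hV
  have hsmall : ∀ᶠ q in 𝓝 (-X, X), bchMul q ∈ V :=
    hcont.eventually (by rwa [bchMul_neg_self])
  have hd : Tendsto (fun d : 𝔥 => (-(d : 𝔸), X)) (𝓝 ⟨X, hX⟩) (𝓝 (-X, X)) :=
    Continuous.tendsto' (by fun_prop) _ _ rfl
  obtain ⟨d, hdD, hdV, hdexp, hdmem⟩ :=
    hD.inter_nhds_nonempty (hd.eventually (hsmall.and (hexp.and hmem)))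
  refine ⟨d, hdD, bchMul (-(d : 𝔸), X), hdmem (neg_mem d.2) hX, hdV, ?_⟩
  rw [hdexp, ← mul_assoc, exp_mul_exp_neg, one_mul]

lemma exp_inv_smul_pow (Y : 𝔸) {n : ℕ} (hn : n ≠ 0) : exp ((n : ℝ)⁻¹ • Y) ^ n = exp Y := by
  let _ : NormedAlgebra ℚ 𝔸 := NormedAlgebra.restrictScalars ℚ ℝ 𝔸
  rw [← NormedSpace.exp_nsmul, ← Nat.cast_smul_eq_nsmul ℝ, smul_inv_smul₀ (Nat.cast_ne_zero.2 hn)]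

lemma mul_exp_mem_of_eventually {𝔥 : LieSubalgebra ℝ 𝔸} {S : Set 𝔸}
    (hS : ∀ᶠ Y in 𝓝 (0 : 𝔸), Y ∈ 𝔥 → ∀ g ∈ S, g * exp Y ∈ S) {g Y : 𝔸} (hg : g ∈ S)
    (hY : Y ∈ 𝔥) : g * exp Y ∈ S := by
  have hlim : Tendsto (fun n : ℕ => (n : ℝ)⁻¹ • Y) atTop (𝓝 0) := by
    simpa using (tendsto_inv_atTop_nhds_zero_nat (𝕜 := ℝ)).smul_const Y
  obtain ⟨n, hn, hn0⟩ := ((hlim.eventually hS).and (eventually_ne_atTop 0)).exists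
  have hpow (m : ℕ) : g * exp ((n : ℝ)⁻¹ • Y) ^ m ∈ S := by
    induction m with
    | zero => simpa using hg
    | succ m ih =>
      rw [pow_succ, ← mul_assoc]
      exact hn (𝔥.smul_mem _ hY) _ ih
  simpa only [exp_inv_smul_pow Y hn0] using hpow n

lemma expGroup_subset_of_eventually {𝔥 : LieSubalgebra ℝ 𝔸} {S : Set 𝔸} (h1 : (1 : 𝔸) ∈ S)
    (hS : ∀ᶠ Y in 𝓝 (0 : 𝔸), Y ∈ 𝔥 → ∀ g ∈ S, g * exp Y ∈ S) {u : 𝔸ˣ} (hu : u ∈ expGroup 𝔥) :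
    (u : 𝔸) ∈ S := by
  induction hu using Subgroup.closure_induction_right with
  | one => exact h1
  | mul_right x _ y hy ih =>
    obtain ⟨Y, hY, hyY⟩ := hy
    rw [Units.val_mul, hyY]
    exact mul_exp_mem_of_eventually hS ih hY
  | mul_inv_cancel x _ y hy ih =>
    obtain ⟨Y, hY, hyY⟩ := hy
    have hinv : ((y⁻¹ : 𝔸ˣ) : 𝔸) = exp (-Y) :=
      Units.inv_eq_of_mul_eq_one_right (by rw [hyY, exp_mul_exp_neg])
    rw [Units.val_mul, hinv]
    exact mul_exp_mem_of_eventually hS ih (neg_mem hY)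

/- The translating elements are the finite products of exponentials of elements of a countable dense
subset of `𝔥`. -/
lemma exists_countable_cover_expGroup (𝔥 : LieSubalgebra ℝ 𝔸) [FiniteDimensional ℝ 𝔥]
    {W : Set 𝔸} (hW : W ∈ 𝓝 0) :
    ∃ Γ : Set 𝔸, Γ.Countable ∧
      ∀ u ∈ expGroup 𝔥, ∃ g ∈ Γ, ∃ X ∈ 𝔥, X ∈ W ∧ (u : 𝔸) = g * exp X := by
  have : ProperSpace 𝔥 := FiniteDimensional.proper ℝ 𝔥
  obtain ⟨D, hDc, hD⟩ := TopologicalSpace.exists_countable_dense 𝔥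
  have := hDc.to_subtype
  let Γ : Set 𝔸 := range fun l : List D => (l.map fun d : D => exp ((d : 𝔥) : 𝔸)).prod
  have hgood : ∀ᶠ q in 𝓝 (0 : 𝔸) ×ˢ 𝓝 (0 : 𝔸), (q.1 ∈ 𝔥 → q.2 ∈ 𝔥 → bchMul q ∈ 𝔥) ∧
      exp (bchMul q) = exp q.1 * exp q.2 ∧ (bchMul q ∈ 𝔥 → ∀ V ∈ 𝓝 (0 : 𝔸),
        ∃ d ∈ D, ∃ Y ∈ 𝔥, Y ∈ V ∧ exp (bchMul q) = exp (d : 𝔸) * exp Y) := by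
    rw [← nhds_prod_eq]
    exact (eventually_bchMul_mem 𝔥).and (eventually_exp_bchMul.and
      (tendsto_bchMul.eventually (eventually_exists_exp_eq_mul 𝔥 hD)))
  obtain ⟨W₁, hW₁, W₂, hW₂, hbch⟩ := Filter.mem_prod_iff.1 hgood
  let S : Set 𝔸 := {g | ∃ a ∈ Γ, ∃ X ∈ 𝔥, X ∈ W ∩ W₁ ∧ g = a * exp X}
  have hS : ∀ᶠ Y in 𝓝 (0 : 𝔸), Y ∈ 𝔥 → ∀ g ∈ S, g * exp Y ∈ S := by
    filter_upwards [hW₂] with Y hYW₂ hY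
    rintro _ ⟨_, ⟨l, rfl⟩, X, hX, hXW, rfl⟩
    obtain ⟨hmem, hexp, hsplit⟩ := hbch (Set.mk_mem_prod hXW.2 hYW₂)
    obtain ⟨d, hdD, Z, hZ, hZW, hZexp⟩ := hsplit (hmem hX hY) (W ∩ W₁) (inter_mem hW hW₁)
    refine ⟨_, ⟨l ++ [⟨d, hdD⟩], rfl⟩, Z, hZ, hZW, ?_⟩
    simp only [mul_assoc, ← hexp, hZexp, List.map_append, List.prod_append, List.map_cons,
      List.map_nil, List.prod_singleton]
  have hone : (1 : 𝔸) ∈ S :=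
    ⟨1, ⟨[], by simp⟩, 0, zero_mem 𝔥, ⟨mem_of_mem_nhds hW, mem_of_mem_nhds hW₁⟩, by simp⟩
  refine ⟨Γ, countable_range _, fun u hu => ?_⟩
  obtain ⟨a, ha, X, hX, hXW, hu⟩ := expGroup_subset_of_eventually hone hS hu
  exact ⟨a, ha, X, hX, hXW.1, hu⟩

end Group

variable {𝔸 : Type*} [NormedRing 𝔸] [NormedAlgebra ℝ 𝔸]
  {F : Type*} [NormedAddCommGroup F] [NormedSpace ℝ F] [Module 𝔸 F] [IsScalarTower ℝ 𝔸 F]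
  [ContinuousSMul 𝔸 F]

/-- The evaluation `X ↦ X • z` of operators at a vector. -/
def evalAt (z : F) : 𝔸 →L[ℝ] F := (ContinuousLinearMap.toSpanSingleton 𝔸 z).restrictScalars ℝ

lemma evalAt_apply (z : F) (X : 𝔸) : evalAt z X = X • z := rfl

/-- The tangent space `𝔥 • z` at `z` of the orbit of `z` under `expGroup 𝔥`. -/
def orbitTangent (𝔥 : LieSubalgebra ℝ 𝔸) (z : F) : Submodule ℝ F :=
  𝔥.toSubmodule.map (evalAt z : 𝔸 →L[ℝ] F).toLinearMap

instance (𝔥 : LieSubalgebra ℝ 𝔸) [FiniteDimensional ℝ 𝔥] (z : F) :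
    FiniteDimensional ℝ (orbitTangent 𝔥 z) :=
  inferInstanceAs (FiniteDimensional ℝ (𝔥.toSubmodule.map (evalAt z : 𝔸 →L[ℝ] F).toLinearMap))

/-- The stabilizer of `z` in `𝔥`. -/
def stabilizerAt (𝔥 : LieSubalgebra ℝ 𝔸) (z : F) : Submodule ℝ 𝔸 :=
  𝔥.toSubmodule ⊓ (evalAt z : 𝔸 →L[ℝ] F).ker

instance (𝔥 : LieSubalgebra ℝ 𝔸) [FiniteDimensional ℝ 𝔥] (z : F) :
    FiniteDimensional ℝ (stabilizerAt 𝔥 z) :=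
  have : FiniteDimensional ℝ 𝔥.toSubmodule := ‹_›
  Submodule.finiteDimensional_of_le inf_le_left

lemma mem_stabilizerAt {𝔥 : LieSubalgebra ℝ 𝔸} {z : F} {X : 𝔸} :
    X ∈ stabilizerAt 𝔥 z ↔ X ∈ 𝔥 ∧ X • z = 0 := Iff.rfl

lemma exists_section_evalAt (𝔥 : LieSubalgebra ℝ 𝔸) (z : F) :
    ∃ τ : orbitTangent 𝔥 z →ₗ[ℝ] 𝔥, ∀ v, (τ v : 𝔸) • z = v := by
  obtain ⟨τ, hτ⟩ := ((evalAt z : 𝔸 →L[ℝ] F).toLinearMap.submoduleMap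
    𝔥.toSubmodule).exists_rightInverse_of_surjective
      (LinearMap.range_eq_top.2 (LinearMap.submoduleMap_surjective _ _))
  exact ⟨τ, fun v => congrArg Subtype.val (DFunLike.congr_fun hτ v)⟩

variable [CompleteSpace 𝔸]

lemma exp_smul_of_smul_eq_zero {X : 𝔸} {z : F} (h : X • z = 0) : exp X • z = z := by
  have hd (s : ℝ) : HasDerivAt (fun s : ℝ => exp (s • X) • z) 0 s :=
    ((evalAt z : 𝔸 →L[ℝ] F).hasFDerivAt.comp_hasDerivAt s
      (hasDerivAt_exp_smul_const (𝕂 := ℝ) X s)).congr_deriv <| by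
        rw [evalAt_apply, mul_smul, h, smul_zero]
  simpa using is_const_of_deriv_eq_zero (fun s => (hd s).differentiableAt)
    (fun s => (hd s).deriv) 1 0

/- `(v, Y) ↦ log (exp (τ v) * exp Y)` is a submersion at `0` onto `𝔥 = τ (𝔥 • z) ⊕ 𝔥_z`. -/
lemma map_bchMul_nhds_zero (𝔥 : LieSubalgebra ℝ 𝔸) [FiniteDimensional ℝ 𝔥] (z : F)
    {τ : orbitTangent 𝔥 z →ₗ[ℝ] 𝔥} (hτ : ∀ v, (τ v : 𝔸) • z = v) {P : 𝔸 →L[ℝ] 𝔥.toSubmodule}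
    (hP : ∀ X : 𝔥, P X = X) :
    map (fun p : orbitTangent 𝔥 z × stabilizerAt 𝔥 z => P (bchMul ((τ p.1 : 𝔸), (p.2 : 𝔸))))
      (𝓝 0) = 𝓝 0 := by
  have : FiniteDimensional ℝ 𝔥.toSubmodule := ‹_›
  have : CompleteSpace 𝔥.toSubmodule := FiniteDimensional.complete ℝ _
  have : CompleteSpace (orbitTangent 𝔥 z × stabilizerAt 𝔥 z) := FiniteDimensional.complete ℝ _
  let j : orbitTangent 𝔥 z × stabilizerAt 𝔥 z →L[ℝ] 𝔸 × 𝔸 := LinearMap.toContinuousLinearMap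
    ((𝔥.toSubmodule.subtype ∘ₗ τ).prodMap (stabilizerAt 𝔥 z).subtype)
  have hd : HasStrictFDerivAt (fun p => P (bchMul (j p)))
      (P.comp ((ContinuousLinearMap.fst ℝ 𝔸 𝔸 + ContinuousLinearMap.snd ℝ 𝔸 𝔸).comp j)) 0 := by
    refine P.hasStrictFDerivAt.comp 0 (HasStrictFDerivAt.comp 0 ?_ j.hasStrictFDerivAt)
    rw [map_zero]
    exact hasStrictFDerivAt_bchMul
  refine (hd.map_nhds_eq_of_surj (LinearMap.range_eq_top.2 fun X => ?_)).trans ?_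
  · let v : orbitTangent 𝔥 z := ⟨(X : 𝔸) • z, X, X.2, rfl⟩
    have hs : (X : 𝔸) - τ v ∈ stabilizerAt 𝔥 z :=
      mem_stabilizerAt.2 ⟨sub_mem X.2 (τ v).2, by rw [sub_smul, hτ, sub_self]⟩
    refine ⟨(v, ⟨_, hs⟩), ?_⟩
    change P ((τ v : 𝔸) + (X - τ v)) = X
    rw [add_sub_cancel, hP]
  · rw [map_zero, bchMul_zero, map_zero]

lemma eventually_exists_exp_section (𝔥 : LieSubalgebra ℝ 𝔸) [FiniteDimensional ℝ 𝔥] (z : F)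
    {τ : orbitTangent 𝔥 z →ₗ[ℝ] 𝔥} (hτ : ∀ v, (τ v : 𝔸) • z = v) {W : Set (orbitTangent 𝔥 z)}
    (hW : W ∈ 𝓝 0) :
    ∀ᶠ X in 𝓝 (0 : 𝔸), X ∈ 𝔥 → ∃ v ∈ W, exp X • z = exp (τ v : 𝔸) • z := by
  obtain ⟨P, hP⟩ := Submodule.ClosedComplemented.of_finiteDimensional 𝔥.toSubmodule
  have hcont : Continuous fun p : orbitTangent 𝔥 z × stabilizerAt 𝔥 z =>
      ((τ p.1 : 𝔸), (p.2 : 𝔸)) :=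
    (continuous_subtype_val.comp (τ.continuous_of_finiteDimensional.comp continuous_fst)).prodMk
      (continuous_subtype_val.comp continuous_snd)
  have hlim := hcont.tendsto' 0 0 (by simp)
  have hgood : ∀ᶠ p in 𝓝 (0 : orbitTangent 𝔥 z × stabilizerAt 𝔥 z), p.1 ∈ W ∧
      bchMul ((τ p.1 : 𝔸), (p.2 : 𝔸)) ∈ 𝔥 ∧
        exp (bchMul ((τ p.1 : 𝔸), (p.2 : 𝔸))) = exp (τ p.1 : 𝔸) * exp (p.2 : 𝔸) := by
    filter_upwards [(continuous_fst.tendsto' (0 : orbitTangent 𝔥 z × stabilizerAt 𝔥 z) 0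
      rfl).eventually hW, hlim.eventually (eventually_bchMul_mem 𝔥),
      hlim.eventually eventually_exp_bchMul] with p hpW hmem hexp
    exact ⟨hpW, hmem (τ p.1).2 (mem_stabilizerAt.1 p.2.2).1, hexp⟩
  have himage := image_mem_map hgood (m := fun p => P (bchMul ((τ p.1 : 𝔸), (p.2 : 𝔸))))
  rw [map_bchMul_nhds_zero 𝔥 z hτ hP, mem_nhds_subtype] at himage
  obtain ⟨u, hu, hsub⟩ := himage
  filter_upwards [hu] with X hXu hX
  obtain ⟨p, ⟨hpW, hmem, hexp⟩, hpX⟩ := hsub (a := (⟨X, hX⟩ : 𝔥.toSubmodule)) hXu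
  have hX' : bchMul ((τ p.1 : 𝔸), (p.2 : 𝔸)) = X :=
    congrArg Subtype.val ((hP ⟨_, hmem⟩).symm.trans hpX)
  refine ⟨p.1, hpW, ?_⟩
  rw [← hX', hexp, mul_smul, exp_smul_of_smul_eq_zero (mem_stabilizerAt.1 p.2.2).2]

lemma dimH_expGroup_orbit_le (𝔥 : LieSubalgebra ℝ 𝔸) [FiniteDimensional ℝ 𝔥] (z : F) :
    dimH {w : F | ∃ u ∈ expGroup 𝔥, (u : 𝔸) • z = w} ≤
      Module.finrank ℝ (orbitTangent 𝔥 z) := by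
  obtain ⟨τ, hτ⟩ := exists_section_evalAt 𝔥 z
  obtain ⟨Γ, hΓ, hcover⟩ := exists_countable_cover_expGroup 𝔥
    (eventually_exists_exp_section 𝔥 z hτ univ_mem)
  let plaque (g : 𝔸) (v : orbitTangent 𝔥 z) : F := evalAt z (g * exp (τ v : 𝔸))
  have hplaque (g : 𝔸) : ContDiff ℝ 1 (plaque g) :=
    (evalAt z).contDiff.comp (contDiff_const.mul (contDiff_exp.comp
      (LinearMap.toContinuousLinearMap (𝔥.toSubmodule.subtype ∘ₗ τ)).contDiff))
  calc dimH {w : F | ∃ u ∈ expGroup 𝔥, (u : 𝔸) • z = w}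
      ≤ dimH (⋃ g ∈ Γ, range (plaque g)) := by
        refine dimH_mono ?_
        rintro _ ⟨u, hu, rfl⟩
        obtain ⟨g, hg, X, hX, hXz, hu⟩ := hcover u hu
        obtain ⟨v, -, hv⟩ := hXz hX
        refine mem_iUnion₂.2 ⟨g, hg, v, ?_⟩
        simp only [plaque, evalAt_apply, hu, mul_smul, hv]
    _ = ⨆ g ∈ Γ, dimH (range (plaque g)) := dimH_bUnion hΓ _
    _ ≤ Module.finrank ℝ (orbitTangent 𝔥 z) := iSup₂_le fun g _ => (hplaque g).dimH_range_le

lemma exists_contDiffAt_leftInverse {T F : Type*} [NormedAddCommGroup T] [NormedSpace ℝ T]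
    [CompleteSpace T] [NormedAddCommGroup F] [NormedSpace ℝ F] {n : WithTop ℕ∞} (hn : n ≠ 0)
    {f : T → F} {a : T} {f' : T →L[ℝ] F} (hf : ContDiffAt ℝ n f a) (hf' : HasFDerivAt f f' a)
    {S : F →L[ℝ] T} (hS : S ∘L f' = ContinuousLinearMap.id ℝ T) :
    ∃ θ : F → T, ContDiffAt ℝ n θ (f a) ∧ θ (f a) = a ∧ ∀ᶠ v in 𝓝 a, θ (f v) = v := by
  have hSf : ContDiffAt ℝ n (S ∘ f) a := S.contDiff.contDiffAt.comp a hf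
  have hSf' : HasFDerivAt (S ∘ f) (ContinuousLinearEquiv.refl ℝ T : T →L[ℝ] T) a :=
    (S.hasFDerivAt.comp a hf').congr_fderiv hS
  exact ⟨hSf.localInverse hSf' hn ∘ S,
    (hSf.to_localInverse hSf' hn).comp (f a) S.contDiff.contDiffAt,
    hSf.localInverse_apply_image hSf' hn,
    (hSf.hasStrictFDerivAt' hSf' hn).eventually_left_inverse⟩

lemma exists_contDiffAt_rightInverse {T F : Type*} [NormedAddCommGroup T] [NormedSpace ℝ T]
    [NormedAddCommGroup F] [NormedSpace ℝ F] [FiniteDimensional ℝ F] {n : WithTop ℕ∞} (hn : n ≠ 0)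
    {f : T → F} {a : T} {f' : T →L[ℝ] F} (hf : ContDiffAt ℝ n f a) (hf' : HasFDerivAt f f' a)
    (hsurj : Function.Surjective f') :
    ∃ θ : F → T, ContDiffAt ℝ n θ (f a) ∧ θ (f a) = a ∧ ∀ᶠ y in 𝓝 (f a), f (θ y) = y := by
  have : CompleteSpace F := FiniteDimensional.complete ℝ F
  obtain ⟨R, hR⟩ :=
    f'.toLinearMap.exists_rightInverse_of_surjective (LinearMap.range_eq_top.2 hsurj)
  let RL : F →L[ℝ] T := LinearMap.toContinuousLinearMap R
  have hline : ContDiff ℝ n fun v => a + RL v := contDiff_const.add RL.contDiff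
  have hline0 : a + RL 0 = a := by rw [map_zero, add_zero]
  have hfR : ContDiffAt ℝ n (fun v => f (a + RL v)) 0 :=
    ContDiffAt.comp (g := f) 0 (by rwa [hline0]) hline.contDiffAt
  have hfR' : HasFDerivAt (fun v => f (a + RL v)) (ContinuousLinearEquiv.refl ℝ F : F →L[ℝ] F) 0 :=
    (HasFDerivAt.comp (g := f) 0 (by rwa [hline0]) (RL.hasFDerivAt.const_add a)).congr_fderiv
      (ContinuousLinearMap.ext fun v => LinearMap.congr_fun hR v)
  have hψ := hfR.to_localInverse hfR' hn
  have hψ0 := hfR.localInverse_apply_image hfR' hn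
  have hinv := (hfR.hasStrictFDerivAt' hfR' hn).eventually_right_inverse
  rw [hline0] at hψ hψ0 hinv
  exact ⟨fun y => a + RL (hfR.localInverse hfR' hn y), hline.contDiffAt.comp _ hψ,
    by simp only [hψ0, hline0], hinv⟩

lemma exists_exp_retraction (𝔥 : LieSubalgebra ℝ 𝔸) [FiniteDimensional ℝ 𝔥] (z : F) :
    ∃ ρ : F → 𝔥, ContDiffAt ℝ ∞ ρ z ∧ ρ z = 0 ∧ ∀ᶠ q in 𝓝 (0 : 𝔥 × 𝔥),
      exp (ρ (exp (q.1 : 𝔸) • exp (q.2 : 𝔸) • z) : 𝔸) • z =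
        exp (q.1 : 𝔸) • exp (q.2 : 𝔸) • z := by
  obtain ⟨τ, hτ⟩ := exists_section_evalAt 𝔥 z
  obtain ⟨S, hS⟩ := Submodule.ClosedComplemented.of_finiteDimensional (orbitTangent 𝔥 z)
  have : CompleteSpace (orbitTangent 𝔥 z) := FiniteDimensional.complete ℝ _
  let τL : orbitTangent 𝔥 z →L[ℝ] 𝔥 := LinearMap.toContinuousLinearMap τ
  let τ𝔸 : orbitTangent 𝔥 z →L[ℝ] 𝔸 := 𝔥.toSubmodule.subtypeL ∘L τL
  have hplaque : ContDiffAt ℝ ∞ (fun v => evalAt z (exp (τ𝔸 v))) 0 :=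
    ((evalAt z).contDiff.comp (contDiff_exp.comp τ𝔸.contDiff)).contDiffAt
  have hplaque' : HasFDerivAt (fun v => evalAt z (exp (τ𝔸 v)))
      (evalAt z ∘L (1 : 𝔸 →L[ℝ] 𝔸) ∘L τ𝔸) 0 := by
    refine (evalAt z).hasFDerivAt.comp 0 (HasFDerivAt.comp 0 ?_ τ𝔸.hasFDerivAt)
    rw [map_zero]
    exact hasFDerivAt_exp_zero
  obtain ⟨θ, hθ, hθz, hθτ⟩ := exists_contDiffAt_leftInverse (by simp) hplaque hplaque' (S := S)
    (ContinuousLinearMap.ext fun v => (congrArg S (hτ v)).trans (hS v))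
  have hz : evalAt z (exp (τ𝔸 0)) = z := by simp [evalAt_apply]
  rw [hz] at hθ hθz
  have hcoe : Tendsto (fun q : 𝔥 × 𝔥 => ((q.1 : 𝔸), (q.2 : 𝔸))) (𝓝 0) (𝓝 0) :=
    Continuous.tendsto' (by fun_prop) _ _ rfl
  refine ⟨fun w => τL (θ w), τL.contDiff.contDiffAt.comp z hθ, by simp only [hθz, map_zero], ?_⟩
  filter_upwards [hcoe.eventually eventually_exp_bchMul, hcoe.eventually (eventually_bchMul_mem 𝔥),
    hcoe.eventually (tendsto_bchMul.eventually (eventually_exists_exp_section 𝔥 z hτ hθτ))]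
    with q hexp hmem hsection
  obtain ⟨v, hv, hqv⟩ := hsection (hmem q.1.2 q.2.2)
  rw [hexp, mul_smul] at hqv
  change θ (exp (τ v : 𝔸) • z) = v at hv
  rw [hqv, hv]
  rfl

lemma analyticAt_exp_smul_exp_smul (𝔥 : LieSubalgebra ℝ 𝔸) (z : F) (q : 𝔥 × 𝔥) :
    AnalyticAt ℝ (fun q : 𝔥 × 𝔥 => exp (q.1 : 𝔸) • exp (q.2 : 𝔸) • z) q := by
  have hexp (l : 𝔥 × 𝔥 →L[ℝ] 𝔸) : AnalyticAt ℝ (fun q => exp (l q)) q :=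
    (exp_analytic (𝕂 := ℝ) (l q)).comp (l.analyticAt q)
  simp only [← mul_smul]
  exact ((evalAt z : 𝔸 →L[ℝ] F).analyticAt _).comp
    ((hexp (𝔥.toSubmodule.subtypeL ∘L ContinuousLinearMap.fst ℝ 𝔥 𝔥)).mul
      (hexp (𝔥.toSubmodule.subtypeL ∘L ContinuousLinearMap.snd ℝ 𝔥 𝔥)))

section IdentityTheorem

variable {G : Type*} [NormedAddCommGroup G] [NormedSpace ℝ G] {𝔥 : LieSubalgebra ℝ 𝔸}
  [FiniteDimensional ℝ 𝔥] {h : F → G} {z : F}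

lemma apply_exp_smul_exp_smul_eq_zero (hh : ∀ w, AnalyticAt ℝ h w)
    (hz : ∀ᶠ X : 𝔥 in 𝓝 0, h (exp (X : 𝔸) • z) = 0) (X Y : 𝔥) :
    h (exp (X : 𝔸) • exp (Y : 𝔸) • z) = 0 := by
  obtain ⟨ρ, hρ, hρz, hρexp⟩ := exists_exp_retraction 𝔥 z
  have hanalytic : AnalyticOnNhd ℝ
      (fun q : 𝔥 × 𝔥 => h (exp (q.1 : 𝔸) • exp (q.2 : 𝔸) • z)) univ :=
    fun q _ => (hh _).fun_comp (analyticAt_exp_smul_exp_smul 𝔥 z q)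
  have hlim : Tendsto (fun q : 𝔥 × 𝔥 => ρ (exp (q.1 : 𝔸) • exp (q.2 : 𝔸) • z)) (𝓝 0) (𝓝 0) := by
    have hlim₀ := (analyticAt_exp_smul_exp_smul 𝔥 z 0).continuousAt.tendsto
    simp only [Prod.fst_zero, Prod.snd_zero, ZeroMemClass.coe_zero, exp_zero, one_smul] at hlim₀
    exact hρz ▸ hρ.continuousAt.tendsto.comp hlim₀
  have hzero : (fun q : 𝔥 × 𝔥 => h (exp (q.1 : 𝔸) • exp (q.2 : 𝔸) • z)) =ᶠ[𝓝 0] fun _ => 0 := by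
    filter_upwards [hρexp, hlim.eventually hz] with q hq hqz
    rw [← hq, hqz]
  exact congrFun (hanalytic.eq_of_eventuallyEq analyticOnNhd_const hzero) (X, Y)

/- The set of points of the orbit near which `h` vanishes is invariant under the generators. -/
lemma apply_smul_eq_zero_of_eventually (hh : ∀ w, AnalyticAt ℝ h w)
    (hz : ∀ᶠ X : 𝔥 in 𝓝 0, h (exp (X : 𝔸) • z) = 0) {u : 𝔸ˣ} (hu : u ∈ expGroup 𝔥) :
    h ((u : 𝔸) • z) = 0 := by
  suffices hev : ∀ᶠ X : 𝔥 in 𝓝 0, h (exp (X : 𝔸) • (u : 𝔸) • z) = 0 by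
    simpa using hev.self_of_nhds
  induction hu using Subgroup.closure_induction_left with
  | one => simpa using hz
  | mul_left x hx y _ ih =>
    obtain ⟨Y, hY, hxY⟩ := hx
    refine Eventually.of_forall fun X => ?_
    rw [Units.val_mul, mul_smul, hxY]
    exact apply_exp_smul_exp_smul_eq_zero hh ih X ⟨Y, hY⟩
  | inv_mul_cancel x hx y _ ih =>
    obtain ⟨Y, hY, hxY⟩ := hx
    have hinv : ((x⁻¹ : 𝔸ˣ) : 𝔸) = exp (-Y) :=
      Units.inv_eq_of_mul_eq_one_right (by rw [hxY, exp_mul_exp_neg])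
    refine Eventually.of_forall fun X => ?_
    rw [Units.val_mul, mul_smul, hinv]
    exact apply_exp_smul_exp_smul_eq_zero hh ih X (-⟨Y, hY⟩)

end IdentityTheorem

end ExponentialOrbits

/-! ### The coadjoint representation in coordinates -/

section CoadjointRepresentation

attribute [local instance] LieRing.ofAssociativeRing

variable {𝔤₀ : Type*} [LieRing 𝔤₀] [LieAlgebra ℝ 𝔤₀] {ι : Type*}

lemma structConst_skew (e : Module.Basis ι ℝ 𝔤₀) (i j k : ι) :
    structConst e j i k = -structConst e i j k := by
  rw [structConst, structConst, ← lie_skew (e i) (e j), map_neg, Finsupp.neg_apply, neg_neg]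

section RealVectors

/-- The real form `𝔤₀ ⊆ 𝔤`, as the subspace of real vectors of `ι → ℂ`. -/
def realVectors (ι : Type*) : Submodule ℝ (ι → ℂ) :=
  LinearMap.range (Complex.ofRealCLM.toLinearMap.compLeft ι)

lemma mem_realVectors_iff_star {ξ : ι → ℂ} : ξ ∈ realVectors ι ↔ star ξ = ξ := by
  refine ⟨?_, fun h => ⟨fun i => (ξ i).re, funext fun i => Complex.conj_eq_iff_re.1 (congrFun h i)⟩⟩
  rintro ⟨x, rfl⟩
  ext i
  simp

end RealVectors

variable [Fintype ι] (e : Module.Basis ι ℝ 𝔤₀)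

lemma sum_structConst_mul (i j l m : ι) :
    ∑ k, structConst e j l k * structConst e i k m = e.repr ⁅e i, ⁅e j, e l⁆⁆ m := by
  conv_rhs => rw [← e.sum_repr ⁅e j, e l⁆]
  rw [lie_sum]
  simp [structConst]

lemma structConst_jacobi (i j l m : ι) :
    ∑ k, structConst e j l k * structConst e i k m -
      ∑ k, structConst e i l k * structConst e j k m =
      ∑ k, structConst e i j k * structConst e k l m := by
  have hskew : ∑ k, structConst e i j k * structConst e k l m =
      -∑ k, structConst e i j k * structConst e l k m := by
    simp only [structConst_skew e l, mul_neg, Finset.sum_neg_distrib]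
  rw [hskew, sum_structConst_mul, sum_structConst_mul, sum_structConst_mul, leibniz_lie (e i),
    ← lie_skew (e l), map_add, map_neg]
  simp

lemma poissonMatrix_transpose (z : ι → ℂ) : (poissonMatrix e z)ᵀ = -poissonMatrix e z := by
  ext i j
  simp [poissonMatrix, structConst_skew e i j, Finset.sum_neg_distrib]

lemma poissonMatrix_add (z w : ι → ℂ) :
    poissonMatrix e (z + w) = poissonMatrix e z + poissonMatrix e w := by
  ext i j
  simp [poissonMatrix, mul_add, Finset.sum_add_distrib]

lemma poissonMatrix_smul (a : ℂ) (z : ι → ℂ) :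
    poissonMatrix e (a • z) = a • poissonMatrix e z := by
  ext i j
  simp [poissonMatrix, Finset.mul_sum, mul_left_comm]

lemma poissonMatrix_star (z : ι → ℂ) :
    poissonMatrix e (star z) = (poissonMatrix e z).map star := by
  ext i j
  simp [poissonMatrix]

lemma coadAt_apply (z ξ : ι → ℂ) : coadAt e z ξ = ξ ᵥ* poissonMatrix e z := rfl

lemma coadAt_eq_neg_mulVec (z ξ : ι → ℂ) : coadAt e z ξ = -(poissonMatrix e z *ᵥ ξ) := by
  rw [coadAt_apply, ← Matrix.mulVec_transpose, poissonMatrix_transpose, Matrix.neg_mulVec]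

/-- The coadjoint representation `𝔤 → 𝔤𝔩(𝔤*)` as a complex linear map, in coordinates. -/
def coadMatrixₗ : (ι → ℂ) →ₗ[ℂ] Matrix ι ι ℂ where
  toFun := coadMatrix e
  map_add' ξ η := by ext j k; simp [coadMatrix, add_mul, Finset.sum_add_distrib]
  map_smul' a ξ := by ext j k; simp [coadMatrix, Finset.mul_sum, mul_assoc]

@[simp] lemma coadMatrix_zero : coadMatrix e 0 = 0 := map_zero (coadMatrixₗ e)

/-- The matrix of `ad*(e i)`. -/
def structMatrix (i : ι) : Matrix ι ι ℂ := Matrix.of fun j k => (structConst e i j k : ℂ)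

lemma coadMatrix_eq_sum (ξ : ι → ℂ) : coadMatrix e ξ = ∑ i, ξ i • structMatrix e i := by
  ext j k
  simp [coadMatrix, structMatrix, Matrix.sum_apply]

lemma structMatrix_lie (i j : ι) :
    ⁅structMatrix e i, structMatrix e j⁆ = -∑ k, (structConst e i j k : ℂ) • structMatrix e k := by
  ext l m
  have hjacobi : ∑ k, (structConst e j l k : ℂ) * structConst e i k m -
      ∑ k, (structConst e i l k : ℂ) * structConst e j k m =
      ∑ k, (structConst e i j k : ℂ) * structConst e k l m := by
    exact_mod_cast structConst_jacobi e i j l m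
  simp only [Ring.lie_def, structMatrix, Matrix.sub_apply, Matrix.mul_apply, Matrix.of_apply,
    Matrix.neg_apply, Matrix.sum_apply, Matrix.smul_apply, smul_eq_mul]
  rw [← hjacobi, neg_sub]

/- In coordinates `(coadMatrix e ξ)ᵀ *ᵥ η` is `⁅ξ, η⁆`, since `coadMatrix` is the dual of `ad`. -/
lemma coadMatrix_lie (ξ η : ι → ℂ) :
    ⁅coadMatrix e ξ, coadMatrix e η⁆ = -coadMatrix e ((coadMatrix e ξ)ᵀ *ᵥ η) := by
  classical
  have hcoord (k : ι) : ((coadMatrix e ξ)ᵀ *ᵥ η) k =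
      ∑ j, ∑ i, η j * ξ i * (structConst e i j k : ℂ) := by
    simp only [Matrix.mulVec, dotProduct, Matrix.transpose_apply, coadMatrix, Matrix.of_apply,
      mul_comm _ (η _), Finset.mul_sum, mul_assoc]
  calc ⁅coadMatrix e ξ, coadMatrix e η⁆
      = ∑ j, ∑ i, (η j * ξ i) • ⁅structMatrix e i, structMatrix e j⁆ := by
        simp only [coadMatrix_eq_sum, sum_lie, lie_sum, smul_lie, lie_smul, Finset.smul_sum,
          smul_smul]
    _ = -∑ j, ∑ i, ∑ k, (η j * ξ i * structConst e i j k) • structMatrix e k := by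
        simp only [structMatrix_lie, smul_neg, Finset.smul_sum, smul_smul, Finset.sum_neg_distrib]
    _ = -∑ k, ∑ j, ∑ i, (η j * ξ i * structConst e i j k) • structMatrix e k := by
        rw [Finset.sum_comm_cycle]
    _ = -coadMatrix e ((coadMatrix e ξ)ᵀ *ᵥ η) := by
        simp only [coadMatrix_eq_sum e (_ *ᵥ _), hcoord, Finset.sum_smul]

lemma coadMatrix_star (ξ : ι → ℂ) : coadMatrix e (star ξ) = (coadMatrix e ξ).map star := by
  ext i j
  simp [coadMatrix]

lemma coadMatrix_transpose_mulVec_mem_realVectors {ξ η : ι → ℂ} (hξ : ξ ∈ realVectors ι)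
    (hη : η ∈ realVectors ι) : (coadMatrix e ξ)ᵀ *ᵥ η ∈ realVectors ι := by
  rw [mem_realVectors_iff_star] at *
  have hX : (coadMatrix e ξ).map star = coadMatrix e ξ := by rw [← coadMatrix_star, hξ]
  ext j
  simp only [Matrix.mulVec, dotProduct, Pi.star_apply, star_sum, Matrix.transpose_apply, star_mul']
  exact Finset.sum_congr rfl fun k _ =>
    congrArg₂ (· * ·) (congrFun (congrFun hX k) j) (congrFun hη k)

variable [DecidableEq ι]

/-- The Lie algebra `ad*(𝔮)`, for a real subspace `𝔮` of `𝔤` closed under the bracket. -/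
def coadImage (𝔮 : Submodule ℝ (ι → ℂ))
    (h𝔮 : ∀ ξ ∈ 𝔮, ∀ η ∈ 𝔮, (coadMatrix e ξ)ᵀ *ᵥ η ∈ 𝔮) : LieSubalgebra ℝ (Matrix ι ι ℂ) where
  toSubmodule := 𝔮.map ((coadMatrixₗ e).restrictScalars ℝ)
  lie_mem' := by
    rintro _ _ ⟨ξ, hξ, rfl⟩ ⟨η, hη, rfl⟩
    change ⁅coadMatrix e ξ, coadMatrix e η⁆ ∈ 𝔮.map ((coadMatrixₗ e).restrictScalars ℝ)
    exact coadMatrix_lie e ξ η ▸ neg_mem ⟨_, h𝔮 ξ hξ η hη, rfl⟩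

end CoadjointRepresentation

/-! ### The coadjoint action -/

section CoadjointAction

open NormedSpace Set Filter
open scoped Matrix.Norms.Operator Matrix.Module

attribute [local instance] LieRing.ofAssociativeRing

variable {𝔤₀ : Type*} [LieRing 𝔤₀] [LieAlgebra ℝ 𝔤₀] {ι : Type*} [Fintype ι]
  [DecidableEq ι] (e : Module.Basis ι ℝ 𝔤₀)

local instance : IsBoundedSMul (Matrix ι ι ℂ) (ι → ℂ) :=
  .of_norm_smul_le Matrix.linfty_opNorm_mulVec

section Equivariance

variable {u : (Matrix ι ι ℂ)ˣ}

/-- `coadMatrix` as a continuous real linear map, for use in the calculus on `𝔤`. -/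
def coadMatrixL : (ι → ℂ) →L[ℝ] Matrix ι ι ℂ :=
  LinearMap.toContinuousLinearMap ((coadMatrixₗ e).restrictScalars ℝ)

/-- `coadAt` as a continuous real linear map, for use in the calculus on `𝔤`. -/
def coadAtL (z : ι → ℂ) : (ι → ℂ) →L[ℝ] (ι → ℂ) :=
  LinearMap.toContinuousLinearMap ((coadAt e z).restrictScalars ℝ)

@[simp] lemma coadExp_zero (z : ι → ℂ) : coadExp e 0 z = z := by simp [coadExp]

lemma coadMatrix_equivariant_exp (ζ ξ : ι → ℂ) :
    exp (coadMatrix e ζ) * coadMatrix e ((exp (coadMatrix e ζ))ᵀ *ᵥ ξ) =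
      coadMatrix e ξ * exp (coadMatrix e ζ) := by
  set X := coadMatrix e ζ with hX
  let η (t : ℝ) : ι → ℂ := exp (t • Xᵀ) *ᵥ ξ
  have hη (t : ℝ) : HasDerivAt η (Xᵀ *ᵥ η t) t :=
    ((evalAt ξ : Matrix ι ι ℂ →L[ℝ] _).hasFDerivAt.comp_hasDerivAt t
      (hasDerivAt_exp_smul_const' Xᵀ t)).congr_deriv (Matrix.mulVec_mulVec ξ Xᵀ _).symm
  have hcoad (t : ℝ) : HasDerivAt (fun t => coadMatrix e (η t))
      (coadMatrix e (η t) * X - X * coadMatrix e (η t)) t := by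
    rw [← neg_sub (X * _), ← Ring.lie_def, hX, coadMatrix_lie, neg_neg]
    exact (coadMatrixL e).hasFDerivAt.comp_hasDerivAt t (hη t)
  have hconj := exp_mul_eq_mul_exp_of_hasDerivAt hcoad
  simp only [η, one_smul, zero_smul, exp_zero, Matrix.one_mulVec] at hconj
  rw [← Matrix.exp_transpose]
  exact hconj

lemma coadMatrix_equivariant (hu : u ∈ coadjointGroup e) (ξ : ι → ℂ) :
    (u : Matrix ι ι ℂ) * coadMatrix e ((u : Matrix ι ι ℂ)ᵀ *ᵥ ξ) =
      coadMatrix e ξ * (u : Matrix ι ι ℂ) := by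
  induction hu using Subgroup.closure_induction generalizing ξ with
  | mem u hu =>
    obtain ⟨ζ, h⟩ := hu
    rw [h]
    exact coadMatrix_equivariant_exp e ζ ξ
  | one => simp
  | mul u v _ _ hu hv =>
    rw [Units.val_mul, Matrix.transpose_mul, ← Matrix.mulVec_mulVec, mul_assoc, hv, ← mul_assoc, hu,
      mul_assoc]
  | inv u _ hu =>
    have h := hu ((↑u⁻¹ : Matrix ι ι ℂ)ᵀ *ᵥ ξ)
    rw [Matrix.mulVec_mulVec, ← Matrix.transpose_mul, Units.inv_mul, Matrix.transpose_one,
      Matrix.one_mulVec] at h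
    rw [Units.inv_mul_eq_iff_eq_mul, ← mul_assoc, h, mul_assoc, Units.mul_inv, mul_one]

lemma coadAt_equivariant (hu : u ∈ coadjointGroup e) (z ξ : ι → ℂ) :
    coadAt e ((u : Matrix ι ι ℂ) *ᵥ z) ξ =
      (u : Matrix ι ι ℂ) *ᵥ coadAt e z ((u : Matrix ι ι ℂ)ᵀ *ᵥ ξ) := by
  rw [← coadMatrix_mulVec, ← coadMatrix_mulVec, Matrix.mulVec_mulVec, Matrix.mulVec_mulVec,
    coadMatrix_equivariant e hu]

lemma liePairing_equivariant (hu : u ∈ coadjointGroup e) (z ξ η : ι → ℂ) :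
    liePairing e ((u : Matrix ι ι ℂ) *ᵥ z) ξ η =
      liePairing e z ((u : Matrix ι ι ℂ)ᵀ *ᵥ ξ) ((u : Matrix ι ι ℂ)ᵀ *ᵥ η) := by
  rw [← coadAt_dotProduct, ← coadAt_dotProduct, coadAt_equivariant e hu, dotProduct_mulVec,
    Matrix.vecMul_transpose]

lemma poissonMatrix_equivariant (hu : u ∈ coadjointGroup e) (z : ι → ℂ) :
    poissonMatrix e ((u : Matrix ι ι ℂ) *ᵥ z) =
      (u : Matrix ι ι ℂ) * poissonMatrix e z * (u : Matrix ι ι ℂ)ᵀ := by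
  refine Matrix.ext_of_mulVec_single fun i => ?_
  have h := coadAt_equivariant e hu z (Pi.single i 1)
  rw [coadAt_eq_neg_mulVec, coadAt_eq_neg_mulVec, Matrix.mulVec_neg, neg_inj] at h
  rw [h, Matrix.mulVec_mulVec, Matrix.mulVec_mulVec, mul_assoc]

lemma rank_poissonMatrix_of_mem_coadjointOrbit {z₀ z : ι → ℂ} (hz : z ∈ coadjointOrbit e z₀) :
    (poissonMatrix e z).rank = (poissonMatrix e z₀).rank := by
  obtain ⟨u, hu, rfl⟩ := hz
  have hdet : IsUnit (u : Matrix ι ι ℂ).det := (Matrix.isUnit_iff_isUnit_det _).1 u.isUnit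
  rw [poissonMatrix_equivariant e hu, Matrix.rank_mul_eq_left_of_isUnit_det _ _
    (by rwa [Matrix.det_transpose]), Matrix.rank_mul_eq_right_of_isUnit_det _ _ hdet]

lemma coadExp_equivariant (hu : u ∈ coadjointGroup e) (z ξ : ι → ℂ) :
    coadExp e ξ ((u : Matrix ι ι ℂ) *ᵥ z) =
      (u : Matrix ι ι ℂ) *ᵥ coadExp e ((u : Matrix ι ι ℂ)ᵀ *ᵥ ξ) z := by
  have hconj : (u : Matrix ι ι ℂ) * coadMatrix e ((u : Matrix ι ι ℂ)ᵀ *ᵥ ξ) *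
      (↑u⁻¹ : Matrix ι ι ℂ) = coadMatrix e ξ := by
    rw [coadMatrix_equivariant e hu, mul_assoc, Units.mul_inv, mul_one]
  rw [coadExp, coadExp, ← hconj, Matrix.exp_units_conj, Matrix.mulVec_mulVec, Matrix.mulVec_mulVec,
    mul_assoc, Units.inv_mul, mul_one]

lemma realCoadjointGroup_le : realCoadjointGroup e ≤ coadjointGroup e :=
  Subgroup.closure_mono fun _ ⟨_, h⟩ => ⟨_, h⟩

end Equivariance

section Smoothness

variable (z : ι → ℂ)

lemma contDiff_coadExp {n : WithTop ℕ∞} : ContDiff ℝ n fun ξ => coadExp e ξ z :=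
  (evalAt z : Matrix ι ι ℂ →L[ℝ] _).contDiff.comp (contDiff_exp.comp (coadMatrixL e).contDiff)

lemma continuous_coadExp_coadExp :
    Continuous fun q : (ι → ℂ) × (ι → ℂ) => coadExp e q.2 (coadExp e q.1 z) := by
  have hexp : Continuous fun ξ => exp (coadMatrixL e ξ) :=
    (contDiff_exp (n := 0)).continuous.comp (coadMatrixL e).continuous
  exact (hexp.comp continuous_snd).matrix_mulVec
    ((contDiff_coadExp e z (n := 0)).continuous.comp continuous_fst)

lemma tendsto_coadExp : Tendsto (fun ξ => coadExp e ξ z) (𝓝 0) (𝓝 z) :=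
  (contDiff_coadExp e z (n := 0)).continuous.tendsto' _ _ (coadExp_zero e z)

lemma hasStrictFDerivAt_coadExp :
    HasStrictFDerivAt (fun ξ => coadExp e ξ z) (coadAtL e z) 0 := by
  have hexp : HasStrictFDerivAt (exp : Matrix ι ι ℂ → Matrix ι ι ℂ)
      (1 : Matrix ι ι ℂ →L[ℝ] Matrix ι ι ℂ) (coadMatrixL e 0) := by
    rw [map_zero]
    exact hasStrictFDerivAt_exp_zero
  refine ((evalAt z : Matrix ι ι ℂ →L[ℝ] (ι → ℂ)).hasStrictFDerivAt.comp (0 : ι → ℂ)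
    (hexp.comp 0 (coadMatrixL e).hasStrictFDerivAt)).congr_fderiv ?_
  exact ContinuousLinearMap.ext fun ξ => coadMatrix_mulVec e ξ z

variable {e z} in
lemma coadExp_of_coadAt_eq_zero {ξ : ι → ℂ} (h : coadAt e z ξ = 0) : coadExp e ξ z = z :=
  exp_smul_of_smul_eq_zero (X := coadMatrix e ξ) ((coadMatrix_mulVec e ξ z).trans h)

end Smoothness

section Orbits

instance (𝔮 : Submodule ℝ (ι → ℂ)) (h𝔮) : FiniteDimensional ℝ (coadImage e 𝔮 h𝔮) :=
  inferInstanceAs (FiniteDimensional ℝ (𝔮.map ((coadMatrixₗ e).restrictScalars ℝ)))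

/-- `ad*(𝔤)`. -/
def complexCoadImage : LieSubalgebra ℝ (Matrix ι ι ℂ) :=
  coadImage e ⊤ fun _ _ _ _ => Submodule.mem_top

/-- `ad*(𝔤₀)`. -/
def realCoadImage : LieSubalgebra ℝ (Matrix ι ι ℂ) :=
  coadImage e (realVectors ι) fun _ hξ _ hη => coadMatrix_transpose_mulVec_mem_realVectors e hξ hη

instance : FiniteDimensional ℝ (complexCoadImage e) :=
  inferInstanceAs (FiniteDimensional ℝ (coadImage e ⊤ _))

instance : FiniteDimensional ℝ (realCoadImage e) :=
  inferInstanceAs (FiniteDimensional ℝ (coadImage e (realVectors ι) _))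

lemma coadMatrix_mem_complexCoadImage (ξ : ι → ℂ) : coadMatrix e ξ ∈ complexCoadImage e :=
  ⟨ξ, Submodule.mem_top, rfl⟩

lemma expGroup_complexCoadImage : expGroup (complexCoadImage e) = coadjointGroup e := by
  refine congrArg Subgroup.closure (Set.ext fun u => ⟨?_, ?_⟩)
  · rintro ⟨_, ⟨ξ, -, rfl⟩, h⟩
    exact ⟨ξ, h⟩
  · rintro ⟨ξ, h⟩
    exact ⟨_, coadMatrix_mem_complexCoadImage e ξ, h⟩

lemma expGroup_realCoadImage : expGroup (realCoadImage e) = realCoadjointGroup e := by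
  refine congrArg Subgroup.closure (Set.ext fun u => ⟨?_, ?_⟩)
  · rintro ⟨_, ⟨_, ⟨ξ, rfl⟩, rfl⟩, h⟩
    exact ⟨ξ, h⟩
  · rintro ⟨ξ, h⟩
    exact ⟨_, ⟨_, ⟨ξ, rfl⟩, rfl⟩, h⟩

lemma exists_section_coadMatrix : ∃ κ : complexCoadImage e → ι → ℂ,
    ContDiff ℝ ∞ κ ∧ κ 0 = 0 ∧ ∀ X, coadMatrix e (κ X) = X :=
  exists_contDiff_section (L := (coadMatrixₗ e).restrictScalars ℝ) LinearMap.map_le_range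

lemma exists_coadExp_retraction (z : ι → ℂ) :
    ∃ ρ : (ι → ℂ) → (ι → ℂ), ContDiffAt ℝ ∞ ρ z ∧ ρ z = 0 ∧
      ∀ᶠ q in 𝓝 (0 : (ι → ℂ) × (ι → ℂ)),
        coadExp e (ρ (coadExp e q.1 (coadExp e q.2 z))) z =
          coadExp e q.1 (coadExp e q.2 z) := by
  obtain ⟨κ, hκ, hκ0, hcoad⟩ := exists_section_coadMatrix e
  obtain ⟨ρ, hρ, hρz, hρexp⟩ := exists_exp_retraction (complexCoadImage e) z
  have hlim : Tendsto (fun q : (ι → ℂ) × (ι → ℂ) =>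
      ((⟨_, coadMatrix_mem_complexCoadImage e q.1⟩, ⟨_, coadMatrix_mem_complexCoadImage e q.2⟩) :
        complexCoadImage e × complexCoadImage e)) (𝓝 0) (𝓝 0) := by
    refine Continuous.tendsto' (.prodMk (.subtype_mk ?_ _) (.subtype_mk ?_ _)) _ _
      (Prod.ext (Subtype.ext (coadMatrix_zero e)) (Subtype.ext (coadMatrix_zero e)))
    · exact (coadMatrixL e).continuous.comp continuous_fst
    · exact (coadMatrixL e).continuous.comp continuous_snd
  refine ⟨κ ∘ ρ, hκ.contDiffAt.comp z hρ, by simp [hρz, hκ0], ?_⟩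
  filter_upwards [hlim.eventually hρexp] with q hq
  exact (congrArg (fun X => exp X *ᵥ z) (hcoad _)).trans hq

variable {e} in
lemma eventually_coadExp_coadExp {z : ι → ℂ} {P : (ι → ℂ) → Prop}
    (h : ∀ᶠ ξ in 𝓝 0, P (coadExp e ξ z)) :
    ∀ᶠ η in 𝓝 0, ∀ᶠ ξ in 𝓝 0, P (coadExp e ξ (coadExp e η z)) := by
  obtain ⟨ρ, hρ, hρz, hretract⟩ := exists_coadExp_retraction e z
  have hlim : Tendsto (fun q : (ι → ℂ) × (ι → ℂ) => coadExp e q.2 (coadExp e q.1 z))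
      (𝓝 (0, 0)) (𝓝 z) := (continuous_coadExp_coadExp e z).tendsto' _ _ (by simp)
  have hρlim := hρ.continuousAt.tendsto.comp hlim
  rw [hρz] at hρlim
  have hswap := (continuous_swap.tendsto' ((0 : ι → ℂ), (0 : ι → ℂ)) 0 rfl).eventually hretract
  refine ((hρlim.eventually h).and hswap).curry_nhds.mono fun η hη => hη.mono ?_
  rintro ξ ⟨hP, hret⟩
  exact hret ▸ hP

lemma frequently_coadExp_ne_zero {h : (ι → ℂ) → ℂ} (hh : ∀ w, AnalyticAt ℝ h w)
    {z₀ z₁ z₂ : ι → ℂ} (hz₁ : z₁ ∈ coadjointOrbit e z₀) (hz₂ : z₂ ∈ coadjointOrbit e z₀)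
    (hne : h z₁ ≠ 0) : ∃ᶠ ξ in 𝓝 0, h (coadExp e ξ z₂) ≠ 0 := by
  obtain ⟨κ, hκ, hκ0, hcoad⟩ := exists_section_coadMatrix e
  obtain ⟨u₁, hu₁, rfl⟩ := hz₁
  obtain ⟨u₂, hu₂, rfl⟩ := hz₂
  intro hzero
  have hu : u₁ * u₂⁻¹ ∈ expGroup (complexCoadImage e) :=
    expGroup_complexCoadImage e ▸ mul_mem hu₁ (inv_mem hu₂)
  have hvanish := apply_smul_eq_zero_of_eventually (z := (u₂ : Matrix ι ι ℂ) • z₀) hh (by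
    filter_upwards [(hκ.continuous.tendsto' 0 0 hκ0).eventually hzero] with X hX
    rw [not_not, coadExp, hcoad] at hX
    exact hX) hu
  rw [← mul_smul, ← Units.val_mul, inv_mul_cancel_right] at hvanish
  exact hne hvanish

/-- The tangent space `ad*(𝔤₀) z` at `z` of the orbit of the real form. -/
def realOrbitTangent (z : ι → ℂ) : Submodule ℝ (ι → ℂ) :=
  (realVectors ι).map ((coadAt e z).restrictScalars ℝ)

lemma orbitTangent_realCoadImage (z : ι → ℂ) :
    orbitTangent (realCoadImage e) z = realOrbitTangent e z := by
  refine (Submodule.map_comp _ _ _).symm.trans (congrArg (Submodule.map · _) ?_)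
  exact LinearMap.ext fun ξ => coadMatrix_mulVec e ξ z

lemma dimH_realOrbit_le (z : ι → ℂ) :
    dimH {w : ι → ℂ | ∃ u ∈ realCoadjointGroup e, (u : Matrix ι ι ℂ) *ᵥ z = w} ≤
      Module.finrank ℝ (realOrbitTangent e z) := by
  rw [← expGroup_realCoadImage, ← orbitTangent_realCoadImage]
  exact dimH_expGroup_orbit_le (realCoadImage e) z

end Orbits

end CoadjointAction

/-! ### Brackets of functions on the dual space -/

section AmbientBracket

attribute [local instance] LieRing.ofAssociativeRing

variable {𝔤₀ : Type*} [LieRing 𝔤₀] [LieAlgebra ℝ 𝔤₀] {ι : Type*} [Fintype ι]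
  (e : Module.Basis ι ℝ 𝔤₀)

lemma liePairing_smul_point (a : ℂ) (z ξ η : ι → ℂ) :
    liePairing e (a • z) ξ η = a * liePairing e z ξ η := by
  rw [liePairing, poissonMatrix_smul, smul_mulVec, dotProduct_smul, liePairing, smul_eq_mul]

lemma liePairing_eq_sum (z ξ η : ι → ℂ) :
    liePairing e z ξ η =
      ∑ i, ∑ j, ∑ k, ξ i * ((structConst e i j k : ℂ) * z k) * η j := by
  simp only [liePairing, dotProduct, mulVec, poissonMatrix, of_apply, Finset.mul_sum,
    Finset.sum_mul, mul_assoc]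

lemma liePairing_coadAt (z ξ η ζ : ι → ℂ) :
    liePairing e (coadAt e z ξ) η ζ = (coadMatrix e η *ᵥ coadMatrix e ξ *ᵥ z) ⬝ᵥ ζ := by
  rw [← coadAt_dotProduct, ← coadMatrix_mulVec, ← coadMatrix_mulVec]

lemma liePairing_jacobi (z ξ η ζ : ι → ℂ) :
    liePairing e (coadAt e z ξ) η ζ + liePairing e (coadAt e z η) ζ ξ +
      liePairing e (coadAt e z ζ) ξ η = 0 := by
  have hlie : liePairing e (coadAt e z ξ) η ζ - liePairing e (coadAt e z η) ξ ζ =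
      liePairing e (coadAt e z ζ) η ξ := by
    rw [liePairing_coadAt, liePairing_coadAt, ← sub_dotProduct, mulVec_mulVec, mulVec_mulVec,
      ← sub_mulVec, ← Ring.lie_def, coadMatrix_lie, neg_mulVec, coadMatrix_mulVec, neg_dotProduct,
      coadAt_dotProduct, ← liePairing_skew, ← coadAt_dotProduct, dotProduct_mulVec,
      vecMul_transpose, liePairing_coadAt, coadMatrix_mulVec e ζ]
  rw [liePairing_skew e _ ζ ξ, liePairing_skew e (coadAt e z ζ) ξ η]
  linear_combination hlie

variable {e} in
lemma hasDerivAt_liePairing {z ξ η : ℝ → ι → ℂ} {z' ξ' η' : ι → ℂ} {t : ℝ}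
    (hz : HasDerivAt z z' t) (hξ : HasDerivAt ξ ξ' t) (hη : HasDerivAt η η' t) :
    HasDerivAt (fun t => liePairing e (z t) (ξ t) (η t))
      (liePairing e z' (ξ t) (η t) + liePairing e (z t) ξ' (η t) + liePairing e (z t) (ξ t) η')
      t := by
  simp only [liePairing_eq_sum, ← Finset.sum_add_distrib]
  rw [hasDerivAt_pi] at hz hξ hη
  refine HasDerivAt.fun_sum fun i _ => HasDerivAt.fun_sum fun j _ => HasDerivAt.fun_sum fun k _ =>
    (((hξ i).mul ((hz k).const_mul (structConst e i j k : ℂ))).mul (hη j)).congr_deriv ?_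
  simp only [Pi.mul_apply]
  ring

lemma contDiff_liePairing {n : WithTop ℕ∞} :
    ContDiff ℝ n fun q : (ι → ℂ) × (ι → ℂ) × (ι → ℂ) => liePairing e q.1 q.2.1 q.2.2 := by
  simp only [liePairing_eq_sum]
  refine ContDiff.sum fun i _ => ContDiff.sum fun j _ => ContDiff.sum fun k _ => ?_
  fun_prop

variable [DecidableEq ι]

/-- `holComponent` as a real-linear map, sending a real covector to its `(1,0)`-part. -/
def holComponentₗ : ((ι → ℂ) →ₗ[ℝ] ℝ) →ₗ[ℝ] (ι → ℂ) where
  toFun := holComponent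
  map_add' φ ψ := by
    ext i
    simp only [holComponent, LinearMap.add_apply, Complex.ofReal_add, Pi.add_apply]
    ring
  map_smul' a φ := by
    ext i
    simp only [holComponent, LinearMap.smul_apply, smul_eq_mul, Complex.ofReal_mul, Pi.smul_apply,
      RingHom.id_apply, Complex.real_smul]
    ring

/-- `holComponent` as a continuous linear map: applied to `df` it gives the holomorphic gradient
`∂f/∂z` of a real function `f`. -/
def holGradient : ((ι → ℂ) →L[ℝ] ℝ) →L[ℝ] (ι → ℂ) :=
  LinearMap.toContinuousLinearMap (holComponentₗ ∘ₗ ContinuousLinearMap.coeLM ℝ)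

lemma holGradient_apply (φ : (ι → ℂ) →L[ℝ] ℝ) : holGradient φ = holComponent φ.toLinearMap := rfl

lemma two_re_holComponent_dotProduct (φ : (ι → ℂ) →ₗ[ℝ] ℝ) (v : ι → ℂ) :
    2 * (holComponent φ ⬝ᵥ v).re = φ v := by
  have hv : v = ∑ i, ((v i).re • (Pi.single i 1 : ι → ℂ) +
      (v i).im • (Pi.single i Complex.I : ι → ℂ)) := by
    ext j
    simp [Finset.sum_apply, Pi.single_apply, Finset.sum_add_distrib, Complex.re_add_im]
  conv_rhs => rw [hv, map_sum]
  rw [dotProduct, Complex.re_sum, Finset.mul_sum]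
  refine Finset.sum_congr rfl fun i _ => ?_
  rw [map_add, map_smul, map_smul]
  simp [holComponent]
  ring

/-- The bracket `{f, g} = Re (a c)(df, dg)` of real functions on `𝔤*`. -/
def ambientBracket (a : ℂ) (f g : (ι → ℂ) → ℝ) (w : ι → ℂ) : ℝ :=
  (a * liePairing e w (holGradient (fderiv ℝ f w)) (holGradient (fderiv ℝ g w))).re

/-- The Hamiltonian vector field of a real function `f` on `𝔤*` with respect to `Re (a c)`.  The
factor `1/2` comes from `φ v = 2 Re ⟨φ^{1,0}, v⟩`. -/
def ambientField (a : ℂ) (f : (ι → ℂ) → ℝ) (w : ι → ℂ) : ι → ℂ :=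
  (a / 2) • coadAt e w (holGradient (fderiv ℝ f w))

lemma re_liePairing_holGradient (a : ℂ) (f : (ι → ℂ) → ℝ) (w : ι → ℂ) (φ : (ι → ℂ) →L[ℝ] ℝ) :
    (a * liePairing e w (holGradient (fderiv ℝ f w)) (holGradient φ)).re =
      φ (ambientField e a f w) := by
  rw [← ContinuousLinearMap.coe_coe φ, ← two_re_holComponent_dotProduct, ambientField,
    dotProduct_smul, dotProduct_comm, coadAt_dotProduct, ← holGradient_apply, smul_eq_mul,
    ← Complex.re_ofReal_mul, Complex.ofReal_ofNat]
  congr 1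
  ring

lemma ambientBracket_eq_fderiv (a : ℂ) (f g : (ι → ℂ) → ℝ) (w : ι → ℂ) :
    ambientBracket e a f g w = fderiv ℝ g w (ambientField e a f w) :=
  re_liePairing_holGradient e a f w _

section Jacobi

variable (a : ℂ) {f g h : (ι → ℂ) → ℝ} {z : ι → ℂ}

lemma contDiffAt_ambientBracket (hf : ContDiffAt ℝ ∞ f z) (hg : ContDiffAt ℝ ∞ g z) :
    ContDiffAt ℝ ∞ (ambientBracket e a f g) z := by
  have hgrad : ∀ {f : (ι → ℂ) → ℝ}, ContDiffAt ℝ ∞ f z →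
      ContDiffAt ℝ ∞ (fun w => holGradient (fderiv ℝ f w)) z := fun hf =>
    (holGradient (ι := ι)).contDiff.contDiffAt.comp z (hf.fderiv_right (m := ∞) le_rfl)
  have hpair := (contDiff_liePairing e (n := ∞)).contDiffAt.comp z
    (contDiffAt_id.prodMk ((hgrad hf).prodMk (hgrad hg)))
  exact Complex.reCLM.contDiff.contDiffAt.comp z (contDiffAt_const.mul hpair)

lemma hasDerivAt_holGradient_fderiv (hf : ContDiffAt ℝ ∞ f z) (v : ι → ℂ) :
    HasDerivAt (fun t : ℝ => holGradient (fderiv ℝ f (z + t • v)))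
      (holGradient (fderiv ℝ (fderiv ℝ f) z v)) 0 := by
  have hf' : HasFDerivAt (fderiv ℝ f) (fderiv ℝ (fderiv ℝ f) z) z :=
    ((hf.fderiv_right (m := ∞) le_rfl).differentiableAt (by simp)).hasFDerivAt
  exact holGradient.hasFDerivAt.comp_hasDerivAt 0 (hf'.hasLineDerivAt v)

lemma fderiv_ambientBracket (hf : ContDiffAt ℝ ∞ f z) (hg : ContDiffAt ℝ ∞ g z) (v : ι → ℂ) :
    fderiv ℝ (ambientBracket e a f g) z v =
      (a * liePairing e v (holGradient (fderiv ℝ f z)) (holGradient (fderiv ℝ g z))).re -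
      fderiv ℝ (fderiv ℝ f) z v (ambientField e a g z) +
      fderiv ℝ (fderiv ℝ g) z v (ambientField e a f z) := by
  have hline : HasDerivAt (fun t : ℝ => z + t • v) v 0 := by
    simpa using ((hasDerivAt_id (0 : ℝ)).smul_const v).const_add z
  have hpair := hasDerivAt_liePairing (e := e) hline (hasDerivAt_holGradient_fderiv hf v)
    (hasDerivAt_holGradient_fderiv hg v)
  have hbracket : HasDerivAt (fun t : ℝ => ambientBracket e a f g (z + t • v))
      (fderiv ℝ (ambientBracket e a f g) z v) 0 :=
    ((contDiffAt_ambientBracket e a hf hg).differentiableAt (by simp)).hasFDerivAt.hasLineDerivAt v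
  rw [hbracket.unique (Complex.reCLM.hasFDerivAt.comp_hasDerivAt (0 : ℝ) (hpair.const_mul a))]
  simp only [zero_smul, add_zero, mul_add, map_add, Complex.reCLM_apply]
  rw [re_liePairing_holGradient, liePairing_skew e z (holGradient (fderiv ℝ (fderiv ℝ f) z v)),
    mul_neg, Complex.neg_re, re_liePairing_holGradient]
  ring

/-- The terms with second derivatives of `f`, `g`, `h` cancel in pairs, which leaves the Jacobi
identity of the Lie bracket applied to their gradients. -/
lemma ambientBracket_jacobi (hf : ContDiffAt ℝ ∞ f z) (hg : ContDiffAt ℝ ∞ g z)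
    (hh : ContDiffAt ℝ ∞ h z) :
    ambientBracket e a f (ambientBracket e a g h) z +
      ambientBracket e a g (ambientBracket e a h f) z +
      ambientBracket e a h (ambientBracket e a f g) z = 0 := by
  have hsymm : ∀ {f : (ι → ℂ) → ℝ}, ContDiffAt ℝ ∞ f z → ∀ v w,
      fderiv ℝ (fderiv ℝ f) z v w = fderiv ℝ (fderiv ℝ f) z w v := fun hf v w =>
    (hf.isSymmSndFDerivAt (by simpa using WithTop.coe_le_coe.2 (le_top : (2 : ℕ∞) ≤ ⊤))).eq v w
  have hfield : ∀ (f : (ι → ℂ) → ℝ) (η ζ : ι → ℂ),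
      (a * liePairing e (ambientField e a f z) η ζ).re =
        (a * (a / 2) * liePairing e (coadAt e z (holGradient (fderiv ℝ f z))) η ζ).re := by
    intro f η ζ
    rw [ambientField, liePairing_smul_point, mul_assoc]
  have hjacobi := congrArg (fun x => (a * (a / 2) * x).re) (liePairing_jacobi e z
    (holGradient (fderiv ℝ f z)) (holGradient (fderiv ℝ g z)) (holGradient (fderiv ℝ h z)))
  simp only [mul_add, Complex.add_re, mul_zero, Complex.zero_re] at hjacobi
  rw [ambientBracket_eq_fderiv, ambientBracket_eq_fderiv e a g, ambientBracket_eq_fderiv e a h,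
    fderiv_ambientBracket e a hg hh, fderiv_ambientBracket e a hh hf,
    fderiv_ambientBracket e a hf hg, hfield, hfield, hfield,
    hsymm hf (ambientField e a g z), hsymm hg (ambientField e a f z),
    hsymm hh (ambientField e a f z)]
  linear_combination hjacobi

end Jacobi

end AmbientBracket

/-! ### The quotient map -/

section QuotientMap

open Set Filter

variable {𝔤₀ : Type*} [LieRing 𝔤₀] [LieAlgebra ℝ 𝔤₀] {ι : Type*} [Fintype ι] [DecidableEq ι]
  {E : Type*} [NormedAddCommGroup E] [NormedSpace ℝ E] {N : Type*} [TopologicalSpace N]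
  [ChartedSpace E N] {e : Module.Basis ι ℝ 𝔤₀} {U : Set (ι → ℂ)} {p : U → N}

lemma expAt_coe {z : U} {ξ : ι → ℂ} (h : coadExp e ξ z ∈ U) :
    (expAt e z ξ : ι → ℂ) = coadExp e ξ z := by
  rw [expAt, dif_pos h]

lemma expAt_eq {z w : U} {ξ : ι → ℂ} (h : coadExp e ξ z = w) : expAt e z ξ = w :=
  Subtype.ext ((expAt_coe (h ▸ w.2)).trans h)

@[simp] lemma expAt_zero (z : U) : expAt e z 0 = z := expAt_eq (coadExp_zero e z)

lemma eventually_expAt_coe (hU : IsOpen[orbitTopology e] U) (z : U) :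
    ∀ᶠ ξ in 𝓝 0, (expAt e z ξ : ι → ℂ) = coadExp e ξ z :=
  (hU z z.2).mono fun _ => expAt_coe

lemma eventually_expAt_expAt (hU : IsOpen[orbitTopology e] U) {z : U} {P : U → Prop}
    (h : ∀ᶠ ξ in 𝓝 0, P (expAt e z ξ)) :
    ∀ᶠ η in 𝓝 0, ∀ᶠ ξ in 𝓝 0, P (expAt e (expAt e z η) ξ) := by
  have hexp : ∀ᶠ ξ in 𝓝 0, ∃ w : U, coadExp e ξ z = w ∧ P w :=
    (h.and (eventually_expAt_coe hU z)).mono fun ξ hξ => ⟨_, hξ.2.symm, hξ.1⟩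
  filter_upwards [eventually_coadExp_coadExp (P := fun v => ∃ w : U, v = w ∧ P w) hexp,
    eventually_expAt_coe hU z] with η hη hzη
  refine hη.mono fun ξ hξ => ?_
  obtain ⟨w, hw, hPw⟩ := hξ
  rwa [expAt_eq ((congrArg _ hzη).trans hw)]

/-- The quotient map near `z`, in exponential coordinates on the orbit and a chart of the
quotient. -/
def expCoord (e : Module.Basis ι ℝ 𝔤₀) (p : U → N) (z : U) (ξ : ι → ℂ) : E :=
  extChartAt 𝓘(ℝ, E) (p z) (p (expAt e z ξ))

/-- `orbitDifferential` as a continuous linear map into the model space `E`, with which the tangent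
spaces of the quotient are identified. -/
def orbitDifferentialL (e : Module.Basis ι ℝ 𝔤₀) (p : U → N) (z : U) : (ι → ℂ) →L[ℝ] E :=
  mfderiv 𝓘(ℝ, ι → ℂ) 𝓘(ℝ, E) (fun ξ => p (expAt e z ξ)) 0

/-- The differential of a function on the quotient, as a covector of the model space. -/
def manifoldDifferential (k : N → ℝ) (x : N) : E →L[ℝ] ℝ := mfderiv 𝓘(ℝ, E) 𝓘(ℝ, ℝ) k x

lemma expCoord_zero (z : U) : expCoord (E := E) e p z 0 = extChartAt 𝓘(ℝ, E) (p z) (p z) := by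
  rw [expCoord, expAt_zero]

section Submersion

variable (hp : IsQuotientByRealForm E e p)
include hp

lemma tendsto_comp_expAt (z : U) : Tendsto (fun ξ => p (expAt e z ξ)) (𝓝 0) (𝓝 (p z)) := by
  simpa only [ContinuousAt, expAt_zero] using (hp.smooth z).continuousAt

lemma hasFDerivAt_expCoord (z : U) :
    HasFDerivAt (expCoord (E := E) e p z) (orbitDifferentialL e p z) 0 := by
  have h := ((hp.smooth z).mdifferentiableAt (by simp)).hasMFDerivAt.2
  simp only [writtenInExtChartAt, mfld_simps] at h
  rw [expAt_zero] at h
  exact hasFDerivWithinAt_univ.1 h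

lemma surjective_orbitDifferentialL (z : U) :
    Function.Surjective (orbitDifferentialL (E := E) e p z) := hp.submersion z

lemma hasFDerivAt_comp_expAt (z : U) {k : N → ℝ}
    (hk : MDifferentiableAt 𝓘(ℝ, E) 𝓘(ℝ, ℝ) k (p z)) :
    HasFDerivAt (fun ξ => k (p (expAt e z ξ)))
      ((manifoldDifferential (E := E) k (p z)).comp (orbitDifferentialL e p z)) 0 := by
  have hp' := ((hp.smooth z).mdifferentiableAt (by simp)).hasMFDerivAt
  have hk' : HasMFDerivAt 𝓘(ℝ, E) 𝓘(ℝ, ℝ) k (p (expAt e z 0))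
      (manifoldDifferential (E := E) k (p z)) := by
    rw [expAt_zero]
    exact hk.hasMFDerivAt
  exact (hk'.comp 0 hp').hasFDerivAt

lemma orbitDifferentialL_eq_zero {z : U} {ξ : ι → ℂ}
    (h : ∀ᶠ t : ℝ in 𝓝 0, p (expAt e z (t • ξ)) = p z) :
    orbitDifferentialL (E := E) e p z ξ = 0 := by
  have hderiv := (hasFDerivAt_expCoord hp z).hasLineDerivAt ξ
  refine HasDerivAt.unique hderiv ((hasDerivAt_const (0 : ℝ)
    (extChartAt 𝓘(ℝ, E) (p z) (p z))).congr_of_eventuallyEq ?_)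
  filter_upwards [h] with t ht
  rw [zero_add, expCoord, ht]

lemma orbitDifferentialL_of_coadAt_eq_zero {z : U} {ξ : ι → ℂ} (h : coadAt e z ξ = 0) :
    orbitDifferentialL (E := E) e p z ξ = 0 := by
  refine orbitDifferentialL_eq_zero hp (Eventually.of_forall fun t => ?_)
  rw [expAt_eq (w := z) (coadExp_of_coadAt_eq_zero ?_)]
  rw [← Complex.coe_smul, map_smul, h, smul_zero]

lemma orbitDifferentialL_of_mem_realVectors (hU : IsOpen[orbitTopology e] U) (z : U) {ξ : ι → ℂ}
    (hξ : ξ ∈ realVectors ι) : orbitDifferentialL (E := E) e p z ξ = 0 := by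
  have hlim : Tendsto (fun t : ℝ => t • ξ) (𝓝 0) (𝓝 0) :=
    (continuous_id.smul continuous_const).tendsto' _ _ (zero_smul ℝ ξ)
  refine orbitDifferentialL_eq_zero hp ?_
  filter_upwards [hlim.eventually (eventually_expAt_coe hU z)] with t ht
  obtain ⟨x, hx⟩ := (realVectors ι).smul_mem t hξ
  refine ((hp.fiber z _).2 ⟨(isUnit_exp (coadMatrix e (t • ξ))).unit,
    Subgroup.subset_closure ⟨x, ?_⟩, ?_⟩).symm
  · rw [IsUnit.unit_spec, ← hx]
    rfl
  · rw [ht]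
    rfl

lemma orbitDifferentialL_equivariant (hU : IsOpen[orbitTopology e] U) {z w : U}
    {u : (Matrix ι ι ℂ)ˣ} (hu : u ∈ realCoadjointGroup e)
    (huw : (u : Matrix ι ι ℂ) *ᵥ (z : ι → ℂ) = w) (ξ : ι → ℂ) :
    orbitDifferentialL (E := E) e p w ξ =
      orbitDifferentialL (E := E) e p z ((u : Matrix ι ι ℂ)ᵀ *ᵥ ξ) := by
  let T : (ι → ℂ) →L[ℝ] (ι → ℂ) :=
    LinearMap.toContinuousLinearMap (((u : Matrix ι ι ℂ)ᵀ.mulVecLin).restrictScalars ℝ)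
  have hT : Tendsto T (𝓝 0) (𝓝 0) := T.continuous.tendsto' _ _ (map_zero T)
  have hpz : p w = p z := ((hp.fiber z w).2 ⟨u, hu, huw⟩).symm
  have hcoord : expCoord (E := E) e p w =ᶠ[𝓝 0] expCoord e p z ∘ T := by
    filter_upwards [eventually_expAt_coe hU w, hT.eventually (eventually_expAt_coe hU z)]
      with ξ hw hz
    have hfiber : p (expAt e w ξ) = p (expAt e z (T ξ)) := by
      refine ((hp.fiber _ _).2 ⟨u, hu, ?_⟩).symm
      rw [hw, hz, ← huw, coadExp_equivariant e (realCoadjointGroup_le e hu)]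
      rfl
    simp only [expCoord, Function.comp_apply, hfiber, hpz]
  have hcomp : HasFDerivAt (expCoord (E := E) e p z ∘ T) (orbitDifferentialL e p z ∘L T) 0 := by
    refine HasFDerivAt.comp 0 ?_ T.hasFDerivAt
    rw [map_zero]
    exact hasFDerivAt_expCoord hp z
  exact DFunLike.congr_fun
    ((hasFDerivAt_expCoord hp w).unique (hcomp.congr_of_eventuallyEq hcoord)) ξ

lemma contDiffAt_expCoord (z : U) : ContDiffAt ℝ ∞ (expCoord (E := E) e p z) 0 := by
  rw [← contMDiffAt_iff_contDiffAt]
  refine ContMDiffAt.comp 0 ?_ (hp.smooth z)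
  rw [expAt_zero]
  exact contMDiffAt_extChartAt

lemma hasStrictFDerivAt_expCoord (z : U) :
    HasStrictFDerivAt (expCoord (E := E) e p z) (orbitDifferentialL e p z) 0 :=
  (contDiffAt_expCoord hp z).hasStrictFDerivAt' (hasFDerivAt_expCoord hp z) (by simp)

lemma exists_contMDiffAt_section [FiniteDimensional ℝ E] (z : U) :
    ∃ s : N → (ι → ℂ), ContMDiffAt 𝓘(ℝ, E) 𝓘(ℝ, ι → ℂ) ∞ s (p z) ∧ s (p z) = 0 ∧
      ∀ᶠ x in 𝓝 (p z), p (expAt e z (s x)) = x := by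
  obtain ⟨θ, hθ, hθz, hinv⟩ := exists_contDiffAt_rightInverse (by simp) (contDiffAt_expCoord hp z)
    (hasFDerivAt_expCoord hp z) (surjective_orbitDifferentialL hp z)
  rw [expCoord_zero] at hθ hθz hinv
  have hs : ContMDiffAt 𝓘(ℝ, E) 𝓘(ℝ, ι → ℂ) ∞ (θ ∘ extChartAt 𝓘(ℝ, E) (p z)) (p z) :=
    hθ.contMDiffAt.comp (p z) contMDiffAt_extChartAt
  refine ⟨_, hs, hθz, ?_⟩
  have hlim := hs.continuousAt.tendsto
  rw [Function.comp_apply, hθz] at hlim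
  filter_upwards [hlim.eventually ((tendsto_comp_expAt hp z).eventually
      (extChartAt_source_mem_nhds (I := 𝓘(ℝ, E)) (p z))),
    (continuousAt_extChartAt (I := 𝓘(ℝ, E)) (p z)).eventually hinv,
    extChartAt_source_mem_nhds (I := 𝓘(ℝ, E)) (p z)] with x hsx hchart hx
  exact (extChartAt 𝓘(ℝ, E) (p z)).injOn hsx hx hchart

end Submersion

end QuotientMap

/-! ### The push-forward of the Poisson pencil -/

section PushForward

open Set Filter

lemma exists_comp_eq_of_ker_le {𝕜 V W X : Type*} [Field 𝕜] [AddCommGroup V] [Module 𝕜 V]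
    [AddCommGroup W] [Module 𝕜 W] [AddCommGroup X] [Module 𝕜 X] {f : V →ₗ[𝕜] W} {g : V →ₗ[𝕜] X}
    (h : LinearMap.ker f ≤ LinearMap.ker g) : ∃ L : W →ₗ[𝕜] X, ∀ v, L (f v) = g v := by
  obtain ⟨L, hL⟩ := LinearMap.exists_extend
    ((LinearMap.ker f).liftQ g h ∘ₗ f.quotKerEquivRange.symm.toLinearMap)
  refine ⟨L, fun v => (LinearMap.congr_fun hL ⟨f v, v, rfl⟩).trans ?_⟩
  have hv : f.quotKerEquivRange.symm ⟨f v, v, rfl⟩ = (LinearMap.ker f).mkQ v :=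
    f.quotKerEquivRange.symm_apply_eq.2 rfl
  rw [LinearMap.comp_apply, LinearEquiv.coe_coe, hv, Submodule.mkQ_apply, Submodule.liftQ_apply]

variable {𝔤₀ : Type*} [LieRing 𝔤₀] [LieAlgebra ℝ 𝔤₀] {ι : Type*} [Fintype ι] [DecidableEq ι]
  {E : Type*} [NormedAddCommGroup E] [NormedSpace ℝ E] {N : Type*} [TopologicalSpace N]
  [ChartedSpace E N] {e : Module.Basis ι ℝ 𝔤₀} {U : Set (ι → ℂ)} {p : U → N}

/-- `a ∈ 𝔤` represents the covector `α` of the quotient at `p z`: the pull-back of `α` to the orbit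
is the restriction of the real covector of `𝔤*` with `(1,0)`-part `a`. -/
def Represents (e : Module.Basis ι ℝ 𝔤₀) (p : U → N) (z : U) (α : E →ₗ[ℝ] ℝ) (a : ι → ℂ) : Prop :=
  ∀ ξ, 2 * (a ⬝ᵥ coadAt e z ξ).re = α (orbitDifferentialL e p z ξ)

lemma represents_holComponent {z : U} {α : E →ₗ[ℝ] ℝ} {φ : (ι → ℂ) →ₗ[ℝ] ℝ}
    (h : ∀ ξ, φ (coadAt e z ξ) = α (orbitDifferentialL e p z ξ)) :
    Represents e p z α (holComponent φ) :=
  fun ξ => (two_re_holComponent_dotProduct φ _).trans (h ξ)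

lemma Represents.liePairing_left {z : U} {α : E →ₗ[ℝ] ℝ} {a a' : ι → ℂ}
    (h : Represents e p z α a) (h' : Represents e p z α a') (b : ι → ℂ) :
    liePairing e z a b = liePairing e z a' b := by
  have hre (ξ) : (a ⬝ᵥ coadAt e z ξ).re = (a' ⬝ᵥ coadAt e z ξ).re :=
    mul_left_cancel₀ two_ne_zero ((h ξ).trans (h' ξ).symm)
  have hdot (ξ) : a ⬝ᵥ coadAt e z ξ = a' ⬝ᵥ coadAt e z ξ := by
    refine Complex.ext (hre ξ) ?_
    simpa [dotProduct_smul] using hre (Complex.I • ξ)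
  rw [liePairing_skew, ← coadAt_dotProduct, dotProduct_comm, hdot, dotProduct_comm,
    coadAt_dotProduct, ← liePairing_skew]

lemma Represents.liePairing_congr {z : U} {α β : E →ₗ[ℝ] ℝ} {a a' b b' : ι → ℂ}
    (ha : Represents e p z α a) (ha' : Represents e p z α a')
    (hb : Represents e p z β b) (hb' : Represents e p z β b') :
    liePairing e z a b = liePairing e z a' b' := by
  rw [ha.liePairing_left ha', liePairing_skew, hb.liePairing_left hb', ← liePairing_skew]

section Quotient

variable (hp : IsQuotientByRealForm E e p)
include hp

lemma Represents.of_equivariant (hU : IsOpen[orbitTopology e] U) {z w : U} {u : (Matrix ι ι ℂ)ˣ}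
    (hu : u ∈ realCoadjointGroup e) (huw : (u : Matrix ι ι ℂ) *ᵥ (z : ι → ℂ) = w)
    {α : E →ₗ[ℝ] ℝ} {a : ι → ℂ} (h : Represents e p w α a) :
    Represents e p z α ((u : Matrix ι ι ℂ)ᵀ *ᵥ a) := by
  intro ξ
  have hinv : (u : Matrix ι ι ℂ)ᵀ *ᵥ ((u⁻¹ : (Matrix ι ι ℂ)ˣ) : Matrix ι ι ℂ)ᵀ *ᵥ ξ = ξ := by
    rw [mulVec_mulVec, ← transpose_mul, Units.inv_mul, transpose_one, one_mulVec]
  have hw := h (((u⁻¹ : (Matrix ι ι ℂ)ˣ) : Matrix ι ι ℂ)ᵀ *ᵥ ξ)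
  rwa [orbitDifferentialL_equivariant hp hU hu huw, ← huw,
    coadAt_equivariant e (realCoadjointGroup_le e hu), hinv, dotProduct_mulVec,
    ← mulVec_transpose] at hw

lemma exists_represents (z : U) :
    ∃ j : (E →ₗ[ℝ] ℝ) →ₗ[ℝ] (ι → ℂ), ∀ α, Represents e p z α (j α) := by
  obtain ⟨L, hL⟩ := exists_comp_eq_of_ker_le (f := (coadAt e z).restrictScalars ℝ)
    (g := (orbitDifferentialL (E := E) e p z).toLinearMap)
    fun _ => orbitDifferentialL_of_coadAt_eq_zero hp
  exact ⟨holComponentₗ ∘ₗ LinearMap.lcomp ℝ ℝ L,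
    fun α => represents_holComponent fun ξ => congrArg α (hL ξ)⟩

/-- A linear choice of representatives of the covectors at `p z`. -/
def covectorLift (z : U) : (E →ₗ[ℝ] ℝ) →ₗ[ℝ] (ι → ℂ) := (exists_represents hp z).choose

lemma represents_covectorLift (z : U) (α : E →ₗ[ℝ] ℝ) :
    Represents e p z α (covectorLift hp z α) := (exists_represents hp z).choose_spec α

/-- The value of `Re (a c)` at `z` on representatives of covectors of the quotient. -/
def pushBilin (a : ℂ) (z : U) : LinearMap.BilinForm ℝ (E →ₗ[ℝ] ℝ) :=
  LinearMap.mk₂ ℝ (fun α β => (a * liePairing e z (covectorLift hp z α) (covectorLift hp z β)).re)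
    (fun α α' β => by simp [liePairing, mul_add])
    (fun r α β => by simp [liePairing]; ring)
    (fun α β β' => by simp [liePairing, mulVec_add, mul_add])
    (fun r α β => by simp [liePairing, mulVec_smul]; ring)

/-- The push-forward along `p` of `Re (a c)`, evaluated at an arbitrarily chosen point of each
fibre of `p`; by equivariance the choice does not matter, see `pushBivector_apply`. -/
def pushBivector (a : ℂ) : BivectorField E N := fun x =>
  pushBilin (E := E) hp a (Function.surjInv hp.surjective x)

lemma pushBivector_apply (hU : IsOpen[orbitTopology e] U) (a : ℂ) (z : U) {α β : E →ₗ[ℝ] ℝ}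
    {ξ η : ι → ℂ} (hα : Represents e p z α ξ) (hβ : Represents e p z β η) :
    (pushBivector hp a (p z) : LinearMap.BilinForm ℝ (E →ₗ[ℝ] ℝ)) α β =
      (a * liePairing e z ξ η).re := by
  set w := Function.surjInv hp.surjective (p z)
  have hpw : p w = p z := Function.surjInv_eq hp.surjective (p z)
  obtain ⟨u, hu, huw⟩ := (hp.fiber z w).1 hpw.symm
  have hlift (γ : E →ₗ[ℝ] ℝ) := (represents_covectorLift hp w γ).of_equivariant hp hU hu huw
  change (a * liePairing e w (covectorLift hp w α) (covectorLift hp w β)).re = _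
  rw [← (hlift α).liePairing_congr hα (hlift β) hβ, ← huw,
    liePairing_equivariant e (realCoadjointGroup_le e hu)]

lemma pushBivector_isAlt (a : ℂ) (x : N) : (pushBivector hp a x).IsAlt := fun α => by
  change (a * liePairing e _ _ _).re = 0
  rw [self_eq_neg.1 (liePairing_skew e _ _ _), mul_zero, Complex.zero_re]

lemma smul_pushBivector_add_smul_pushBivector (s t : ℝ) (x : N) :
    s • pushBivector hp 1 x + t • pushBivector hp (-Complex.I) x =
      pushBivector hp (s - t * Complex.I) x := by
  refine LinearMap.ext₂ fun α β => ?_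
  change s * (1 * liePairing e _ _ _).re + t * (-Complex.I * liePairing e _ _ _).re =
    ((s - t * Complex.I) * liePairing e _ _ _).re
  simp [sub_mul]

end Quotient

/-- `f` is, on the plaque of the orbit through `z`, a smooth lift of the germ at `p z` of the
function `k` on the quotient. Outside of this plaque its values are arbitrary. -/
structure IsLocalLift (e : Module.Basis ι ℝ 𝔤₀) (p : U → N) (z : U) (f : (ι → ℂ) → ℝ)
    (k : N → ℝ) : Prop where
  contDiffAt : ContDiffAt ℝ ∞ f z
  eventually_eq : ∀ᶠ ξ in 𝓝 0, f (expAt e z ξ) = k (p (expAt e z ξ))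

section LocalLift

variable (hp : IsQuotientByRealForm E e p) (hU : IsOpen[orbitTopology e] U) {z : U} {k l : N → ℝ}
  {f g : (ι → ℂ) → ℝ}
include hp hU

lemma exists_isLocalLift (hk : ContMDiffAt 𝓘(ℝ, E) 𝓘(ℝ, ℝ) ∞ k (p z)) :
    ∃ f, IsLocalLift e p z f k := by
  obtain ⟨ρ, hρ, hρz, hretract⟩ := exists_coadExp_retraction e (z : ι → ℂ)
  have hcomp : ContDiffAt ℝ ∞ (fun ξ => k (p (expAt e z ξ))) (ρ z) := by
    rw [hρz, ← contMDiffAt_iff_contDiffAt]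
    exact ContMDiffAt.comp 0 (by rwa [expAt_zero]) (hp.smooth z)
  refine ⟨_, hcomp.comp _ hρ, ?_⟩
  have hretract₁ : ∀ᶠ ξ in 𝓝 0, coadExp e (ρ (coadExp e ξ z)) z = coadExp e ξ z := by
    have hlim : Tendsto (fun ξ : ι → ℂ => (ξ, (0 : ι → ℂ))) (𝓝 0) (𝓝 0) :=
      (continuous_id.prodMk continuous_const).tendsto' _ _ rfl
    simpa only [coadExp_zero] using hlim.eventually hretract
  filter_upwards [hretract₁, eventually_expAt_coe hU z] with ξ hξ hzξ
  simp only [Function.comp_apply, hzξ, expAt_eq (hξ.trans hzξ.symm)]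

lemma represents_of_eventually_eq (hk : MDifferentiableAt 𝓘(ℝ, E) 𝓘(ℝ, ℝ) k (p z))
    (hf : DifferentiableAt ℝ f z) (h : ∀ᶠ ξ in 𝓝 0, f (expAt e z ξ) = k (p (expAt e z ξ))) :
    Represents e p z (manifoldDifferential (E := E) k (p z)).toLinearMap
      (holGradient (fderiv ℝ f z)) := by
  rw [holGradient_apply]
  refine represents_holComponent fun ξ => ?_
  have hf' : HasFDerivAt f (fderiv ℝ f z) (coadExp e 0 z) := by
    rw [coadExp_zero]
    exact hf.hasFDerivAt
  have hlift := (hf'.comp 0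
    (hasStrictFDerivAt_coadExp e (z : ι → ℂ)).hasFDerivAt).congr_of_eventuallyEq
    (((eventually_expAt_coe hU z).and h).mono fun η hη => hη.2.symm.trans (congrArg f hη.1))
  exact DFunLike.congr_fun (hlift.unique (hasFDerivAt_comp_expAt hp z hk)) ξ

lemma IsLocalLift.eventually_represents (h : IsLocalLift e p z f k) {V : Set N} (hV : IsOpen V)
    (hz : p z ∈ V) (hk : ContMDiffOn 𝓘(ℝ, E) 𝓘(ℝ, ℝ) ∞ k V) :
    ∀ᶠ ξ in 𝓝 0, Represents e p (expAt e z ξ)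
      (manifoldDifferential (E := E) k (p (expAt e z ξ))).toLinearMap
      (holGradient (fderiv ℝ f (expAt e z ξ))) := by
  have hdiff : ∀ᶠ ξ in 𝓝 0, DifferentiableAt ℝ f (expAt e z ξ) := by
    have hnear : ∀ᶠ w in 𝓝 (z : ι → ℂ), DifferentiableAt ℝ f w :=
      ((h.contDiffAt.of_le (m := 1) (by simp)).eventually (by simp)).mono
        fun w hw => hw.differentiableAt one_ne_zero
    filter_upwards [(tendsto_coadExp e (z : ι → ℂ)).eventually hnear, eventually_expAt_coe hU z]
      with ξ hξ hzξ
    rwa [hzξ]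
  filter_upwards [hdiff, eventually_expAt_expAt hU (P := fun w => f w = k (p w)) h.eventually_eq,
    (tendsto_comp_expAt hp z).eventually (hV.mem_nhds hz)] with ξ hfξ heq hVξ
  exact represents_of_eventually_eq hp hU
    ((hk.contMDiffAt (hV.mem_nhds hVξ)).mdifferentiableAt (by simp)) hfξ heq

lemma IsLocalLift.contMDiffAt [FiniteDimensional ℝ E] (h : IsLocalLift e p z f k) :
    ContMDiffAt 𝓘(ℝ, E) 𝓘(ℝ, ℝ) ∞ k (p z) := by
  obtain ⟨s, hs, hsz, hps⟩ := exists_contMDiffAt_section hp z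
  have hlim := hs.continuousAt.tendsto
  rw [hsz] at hlim
  have hexp : ContDiffAt ℝ ∞ (fun ξ => f (coadExp e ξ z)) (s (p z)) := by
    refine ContDiffAt.comp (g := f) _ ?_ (contDiff_coadExp e (z : ι → ℂ)).contDiffAt
    rw [hsz, coadExp_zero]
    exact h.contDiffAt
  refine (hexp.contMDiffAt.comp (p z) hs).congr_of_eventuallyEq ?_
  filter_upwards [hps, hlim.eventually h.eventually_eq, hlim.eventually (eventually_expAt_coe hU z)]
    with x hx hfx hzx
  rw [Function.comp_apply, ← hzx, hfx, hx]

lemma IsLocalLift.bracket_pushBivector (hf : IsLocalLift e p z f k) (hg : IsLocalLift e p z g l)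
    {V : Set N} (hV : IsOpen V) (hz : p z ∈ V) (hk : ContMDiffOn 𝓘(ℝ, E) 𝓘(ℝ, ℝ) ∞ k V)
    (hl : ContMDiffOn 𝓘(ℝ, E) 𝓘(ℝ, ℝ) ∞ l V) (a : ℂ) :
    IsLocalLift e p z (ambientBracket e a f g) (bracket (pushBivector hp a) k l) where
  contDiffAt := contDiffAt_ambientBracket e a hf.contDiffAt hg.contDiffAt
  eventually_eq := by
    filter_upwards [hf.eventually_represents hp hU hV hz hk,
      hg.eventually_represents hp hU hV hz hl] with ξ hfξ hgξ
    exact (pushBivector_apply hp hU a _ hfξ hgξ).symm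

end LocalLift

variable [FiniteDimensional ℝ E] (hp : IsQuotientByRealForm E e p)
  (hU : IsOpen[orbitTopology e] U)
include hp hU

lemma isSmoothBivector_pushBivector (a : ℂ) : IsSmoothBivector (pushBivector hp a) where
  alt := pushBivector_isAlt hp a
  smooth V k l hV hk hl x hx := by
    obtain ⟨z, rfl⟩ := hp.surjective x
    obtain ⟨f, hf⟩ := exists_isLocalLift hp hU (hk.contMDiffAt (hV.mem_nhds hx))
    obtain ⟨g, hg⟩ := exists_isLocalLift hp hU (hl.contMDiffAt (hV.mem_nhds hx))
    exact ((hf.bracket_pushBivector hp hU hg hV hx hk hl a).contMDiffAt hp hU).contMDiffWithinAt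

lemma isPoisson_pushBivector (a : ℂ) : IsPoisson (pushBivector hp a) where
  toIsSmoothBivector := isSmoothBivector_pushBivector hp hU a
  jacobi V k l m hV hk hl hm x hx := by
    obtain ⟨z, rfl⟩ := hp.surjective x
    have hsmooth := (isSmoothBivector_pushBivector hp hU a).smooth
    obtain ⟨f, hf⟩ := exists_isLocalLift hp hU (hk.contMDiffAt (hV.mem_nhds hx))
    obtain ⟨g, hg⟩ := exists_isLocalLift hp hU (hl.contMDiffAt (hV.mem_nhds hx))
    obtain ⟨h, hh⟩ := exists_isLocalLift hp hU (hm.contMDiffAt (hV.mem_nhds hx))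
    have hlm := hsmooth V l m hV hl hm
    have hmk := hsmooth V m k hV hm hk
    have hkl := hsmooth V k l hV hk hl
    have hgh := hg.bracket_pushBivector hp hU hh hV hx hl hm a
    have hhf := hh.bracket_pushBivector hp hU hf hV hx hm hk a
    have hfg := hf.bracket_pushBivector hp hU hg hV hx hk hl a
    have hfgh := (hf.bracket_pushBivector hp hU hgh hV hx hk hlm a).eventually_eq.self_of_nhds
    have hghf := (hg.bracket_pushBivector hp hU hhf hV hx hl hmk a).eventually_eq.self_of_nhds
    have hhfg := (hh.bracket_pushBivector hp hU hfg hV hx hm hkl a).eventually_eq.self_of_nhds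
    rw [expAt_zero] at hfgh hghf hhfg
    rw [← hfgh, ← hghf, ← hhfg]
    exact ambientBracket_jacobi e a hf.contDiffAt hg.contDiffAt hh.contDiffAt

lemma isReduction_pushBivector :
    IsReduction e p (pushBivector hp 1) (pushBivector hp (-Complex.I)) where
  smooth₁ := isSmoothBivector_pushBivector hp hU 1
  smooth₂ := isSmoothBivector_pushBivector hp hU _
  push z α β φ ψ hφ hψ := by
    have hα : Represents (E := E) e p z α (holComponent φ) := represents_holComponent hφ
    have hβ : Represents (E := E) e p z β (holComponent ψ) := represents_holComponent hψ
    refine ⟨(pushBivector_apply hp hU 1 z hα hβ).trans ?_,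
      (pushBivector_apply hp hU _ z hα hβ).trans ?_⟩ <;> simp [linearPoisson]

end PushForward

/-! ### Tangent spaces of the leaves -/

section Dimension

open Set Filter

lemma finrank_map_add_finrank_ker_inf {𝕜 V W : Type*} [DivisionRing 𝕜] [AddCommGroup V]
    [Module 𝕜 V] [AddCommGroup W] [Module 𝕜 W] [FiniteDimensional 𝕜 V] (f : V →ₗ[𝕜] W)
    (q : Submodule 𝕜 V) :
    Module.finrank 𝕜 (q.map f) + Module.finrank 𝕜 (LinearMap.ker f ⊓ q : Submodule 𝕜 V) =
      Module.finrank 𝕜 q := by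
  rw [← LinearMap.range_domRestrict, inf_comm, ← Submodule.map_comap_subtype,
    ← LinearMap.ker_comp, Submodule.finrank_map_subtype_eq]
  exact LinearMap.finrank_range_add_finrank_ker (f.domRestrict q)

/-- Near `a`, the fibre of the submersion `f` contains a manifold with tangent space `ker f'`, whose
image under `g` contains one with tangent space `g' (ker f')`. -/
lemma finrank_map_ker_le_dimH {V F W : Type*} [NormedAddCommGroup V] [NormedSpace ℝ V]
    [CompleteSpace V] [NormedAddCommGroup F] [NormedSpace ℝ F] [CompleteSpace F]
    [NormedAddCommGroup W] [NormedSpace ℝ W] [FiniteDimensional ℝ W] {f : V → F} {g : V → W}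
    {f' : V →L[ℝ] F} {g' : V →L[ℝ] W} {a : V} (hf : HasStrictFDerivAt f f' a)
    (hg : HasStrictFDerivAt g g' a) (hf' : Function.Surjective f') {s : Set V} (hs : s ∈ 𝓝 a) :
    (Module.finrank ℝ ((LinearMap.ker f'.toLinearMap).map g'.toLinearMap) : ENNReal) ≤
      dimH (g '' (s ∩ {x | f x = f a})) := by
  let T := (LinearMap.ker f'.toLinearMap).map g'.toLinearMap
  have : CompleteSpace T := FiniteDimensional.complete ℝ T
  obtain ⟨S, hS⟩ := Submodule.ClosedComplemented.of_finiteDimensional T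
  have hΦ : HasStrictFDerivAt (fun x => (f x, S (g x))) (f'.prod (S ∘L g')) a :=
    hf.prodMk (S.hasStrictFDerivAt.comp a hg)
  have hsurj : (f'.prod (S ∘L g')).range = ⊤ := by
    refine LinearMap.range_eq_top.2 fun ⟨y, t⟩ => ?_
    obtain ⟨v, hv⟩ := hf' y
    obtain ⟨w, hw : f' w = 0, hgw : g' w = (t - S (g' v) : T)⟩ := (t - S (g' v)).2
    refine ⟨v + w, Prod.ext ?_ ?_⟩
    · change f' (v + w) = y
      rw [map_add, hv, hw, add_zero]
    · change S (g' (v + w)) = t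
      rw [map_add, map_add, hgw, hS, add_sub_cancel]
  have hslice : {t : T | (f a, t) ∈ (fun x => (f x, S (g x))) '' s} ∈ 𝓝 (S (g a)) := by
    refine (Continuous.prodMk_right (f a)).continuousAt.preimage_mem_nhds ?_
    rw [← hΦ.map_nhds_eq_of_surj hsurj]
    exact image_mem_map hs
  rw [← Real.dimH_of_mem_nhds hslice]
  refine (dimH_mono ?_).trans (S.lipschitz.dimH_image_le _)
  rintro t ⟨x, hx, hxt⟩
  exact ⟨g x, ⟨x, ⟨hx, congrArg Prod.fst hxt⟩, rfl⟩, congrArg Prod.snd hxt⟩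

end Dimension

section Conjugation

variable {ι : Type*}

/-- Multiplication by `I` as a real linear automorphism. -/
def mulI (ι : Type*) : (ι → ℂ) ≃ₗ[ℝ] (ι → ℂ) :=
  (LinearEquiv.smulOfNeZero ℂ (ι → ℂ) Complex.I Complex.I_ne_zero).restrictScalars ℝ

lemma exists_realVectors_add_mulI {K : Submodule ℂ (ι → ℂ)} (hK : ∀ x ∈ K, star x ∈ K)
    {ξ : ι → ℂ} (hξ : ξ ∈ K) :
    ∃ x ∈ K.restrictScalars ℝ ⊓ realVectors ι, ∃ y ∈ K.restrictScalars ℝ ⊓ realVectors ι,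
      x + mulI ι y = ξ := by
  refine ⟨realPart ξ, ⟨?_, mem_realVectors_iff_star.2 (realPart ξ).2⟩, imaginaryPart ξ,
    ⟨?_, mem_realVectors_iff_star.2 (imaginaryPart ξ).2⟩, realPart_add_I_smul_imaginaryPart ξ⟩
  · rw [realPart_apply_coe]
    exact (K.restrictScalars ℝ).smul_mem _ (K.add_mem hξ (hK ξ hξ))
  · rw [imaginaryPart_apply_coe]
    exact K.smul_mem _ ((K.restrictScalars ℝ).smul_mem _ (K.sub_mem hξ (hK ξ hξ)))

lemma finrank_inf_realVectors [Finite ι] {K : Submodule ℂ (ι → ℂ)} (hK : ∀ x ∈ K, star x ∈ K) :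
    Module.finrank ℝ (K.restrictScalars ℝ ⊓ realVectors ι : Submodule ℝ (ι → ℂ)) =
      Module.finrank ℂ K := by
  set KR := K.restrictScalars ℝ ⊓ realVectors ι
  have hsup : KR ⊔ KR.map (mulI ι).toLinearMap = K.restrictScalars ℝ := by
    refine le_antisymm (sup_le inf_le_left ?_) fun ξ hξ => ?_
    · rintro _ ⟨x, hx, rfl⟩
      exact K.smul_mem _ hx.1
    · obtain ⟨x, hx, y, hy, rfl⟩ := exists_realVectors_add_mulI hK hξ
      exact Submodule.add_mem_sup hx (Submodule.mem_map_of_mem hy)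
  have hinf : KR ⊓ KR.map (mulI ι).toLinearMap = ⊥ := by
    rw [eq_bot_iff]
    rintro _ ⟨hx, y, hy, rfl⟩
    have hstar : star (Complex.I • y) = Complex.I • y := mem_realVectors_iff_star.1 hx.2
    rw [star_smul, mem_realVectors_iff_star.1 hy.2, RCLike.star_def, Complex.conj_I,
      neg_smul] at hstar
    exact self_eq_neg.1 hstar.symm
  have hfinrank := Submodule.finrank_sup_add_finrank_inf_eq KR (KR.map (mulI ι).toLinearMap)
  rw [hsup, hinf, finrank_bot, LinearEquiv.finrank_map_eq] at hfinrank
  have hcomplex : Module.finrank ℝ (K.restrictScalars ℝ) = 2 * Module.finrank ℂ K :=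
    finrank_real_of_complex K
  lia

lemma finrank_realVectors [Fintype ι] : Module.finrank ℝ (realVectors ι) = Fintype.card ι := by
  have h := finrank_inf_realVectors (K := (⊤ : Submodule ℂ (ι → ℂ))) fun _ _ => Submodule.mem_top
  rwa [Submodule.restrictScalars_top, top_inf_eq, finrank_top, Module.finrank_pi] at h

end Conjugation

section Kernel

variable {𝔤₀ : Type*} [LieRing 𝔤₀] [LieAlgebra ℝ 𝔤₀] {ι : Type*} [Fintype ι]
  (e : Module.Basis ι ℝ 𝔤₀)

lemma poissonMatrix_star_mulVec (z ξ : ι → ℂ) :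
    poissonMatrix e (star z) *ᵥ star ξ = star (poissonMatrix e z *ᵥ ξ) := by
  rw [poissonMatrix_star]
  funext i
  simp [mulVec, dotProduct]

lemma poissonMatrix_smul_add_smul (a b : ℂ) (z w : ι → ℂ) :
    poissonMatrix e (a • z + b • w) = a • poissonMatrix e z + b • poissonMatrix e w := by
  rw [poissonMatrix_add, poissonMatrix_smul, poissonMatrix_smul]

lemma coadAt_eq_zero_iff {z ξ : ι → ℂ} : coadAt e z ξ = 0 ↔ poissonMatrix e z *ᵥ ξ = 0 := by
  rw [coadAt_eq_neg_mulVec, neg_eq_zero]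

lemma finrank_range_coadAt (z : ι → ℂ) :
    Module.finrank ℂ (LinearMap.range (coadAt e z)) = (poissonMatrix e z).rank := by
  rw [← rank_transpose, rank, mulVecLin_transpose]
  rfl

lemma finrank_range_coadAt_real (z : ι → ℂ) :
    Module.finrank ℝ (LinearMap.range ((coadAt e z).restrictScalars ℝ)) =
      2 * (poissonMatrix e z).rank := by
  rw [← finrank_range_coadAt]
  exact finrank_real_of_complex (LinearMap.range (coadAt e z))

lemma rank_poissonMatrix_star (z : ι → ℂ) :
    (poissonMatrix e (star z)).rank = (poissonMatrix e z).rank := by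
  have h : poissonMatrix e (star z) = (-1 : ℂ) • (poissonMatrix e z)ᴴ := by
    rw [poissonMatrix_star, conjTranspose, poissonMatrix_transpose]
    ext i j
    simp
  open scoped ComplexOrder in
  rw [h, rank_smul_of_mem_nonZeroDivisors _ (mem_nonZeroDivisors_of_ne_zero (by norm_num)),
    rank_conjTranspose]

lemma rank_le_genericRank (z : ι → ℂ) : (poissonMatrix e z).rank ≤ genericRank e :=
  le_csSup ⟨Fintype.card ι, by rintro _ ⟨w, rfl⟩; exact rank_le_card_width _⟩ ⟨z, rfl⟩

lemma finrank_realOrbitTangent_add (z : ι → ℂ) :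
    Module.finrank ℝ (realOrbitTangent e z) + commonKernelDim e z = Fintype.card ι := by
  let K := LinearMap.ker (poissonMatrix e z).mulVecLin ⊓
    LinearMap.ker (poissonMatrix e (star z)).mulVecLin
  have hker : LinearMap.ker ((coadAt e z).restrictScalars ℝ) ⊓ realVectors ι =
      K.restrictScalars ℝ ⊓ realVectors ι := by
    ext x
    simp only [K, Submodule.mem_inf, Submodule.restrictScalars_mem, LinearMap.mem_ker,
      LinearMap.restrictScalars_apply, mulVecLin_apply, coadAt_eq_zero_iff, and_congr_left_iff]
    intro hx
    refine (and_iff_left_of_imp fun h => ?_).symm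
    rw [← mem_realVectors_iff_star.1 hx, poissonMatrix_star_mulVec, h, star_zero]
  have hK : ∀ x ∈ K, star x ∈ K := by
    rintro x ⟨hx, hx'⟩
    rw [SetLike.mem_coe, LinearMap.mem_ker, mulVecLin_apply] at hx hx'
    constructor <;> rw [SetLike.mem_coe, LinearMap.mem_ker, mulVecLin_apply]
    · rw [← star_star z, poissonMatrix_star_mulVec, hx', star_zero]
    · rw [poissonMatrix_star_mulVec, hx, star_zero]
  rw [← finrank_realVectors, commonKernelDim, ← finrank_inf_realVectors hK, ← hker]
  exact finrank_map_add_finrank_ker_inf ((coadAt e z).restrictScalars ℝ) (realVectors ι)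

end Kernel

section Leaves

open Set Filter

variable {𝔤₀ : Type*} [LieRing 𝔤₀] [LieAlgebra ℝ 𝔤₀] {ι : Type*} [Fintype ι] [DecidableEq ι]
  {E : Type*} [NormedAddCommGroup E] [NormedSpace ℝ E]
  {N : Type*} [TopologicalSpace N] [ChartedSpace E N] {e : Module.Basis ι ℝ 𝔤₀}
  {U : Set (ι → ℂ)} {p : U → N} (hp : IsQuotientByRealForm E e p)
include hp

lemma finrank_add_finrank_leafTangent (z : U) :
    Module.finrank ℝ E + Module.finrank ℝ (leafTangent E e p z) =
      2 * (poissonMatrix e z).rank := by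
  let D : (ι → ℂ) →ₗ[ℝ] E := (orbitDifferentialL (E := E) e p z).toLinearMap
  have hker : LinearMap.ker ((coadAt e z).restrictScalars ℝ) ≤ LinearMap.ker D :=
    fun _ => orbitDifferentialL_of_coadAt_eq_zero hp
  have hleaf : Module.finrank ℝ (leafTangent E e p z) + Module.finrank ℝ (LinearMap.ker
      ((coadAt e z).restrictScalars ℝ)) = Module.finrank ℝ (LinearMap.ker D) := by
    have h := finrank_map_add_finrank_ker_inf ((coadAt e z).restrictScalars ℝ) (LinearMap.ker D)
    rwa [inf_of_le_left hker] at h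
  have hD := D.finrank_range_add_finrank_ker
  rw [LinearMap.range_eq_top.2 (surjective_orbitDifferentialL hp z), finrank_top] at hD
  have horbit := ((coadAt e (z : ι → ℂ)).restrictScalars ℝ).finrank_range_add_finrank_ker
  rw [finrank_range_coadAt_real] at horbit
  lia

variable [FiniteDimensional ℝ E] (hU : IsOpen[orbitTopology e] U)
include hU

/-- The fibre of `p` is contained in a `G₀`-orbit, whose Hausdorff dimension is at most that of its
tangent spaces: it is a countable union of plaques. -/
lemma finrank_leafTangent_le (z : U) :
    Module.finrank ℝ (leafTangent E e p z) ≤ Module.finrank ℝ (realOrbitTangent e z) := by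
  have : CompleteSpace E := FiniteDimensional.complete ℝ E
  have hnhds := (hU z z.2).and ((tendsto_comp_expAt hp z).eventually
    (extChartAt_source_mem_nhds (I := 𝓘(ℝ, E)) (p z)))
  have hdim := finrank_map_ker_le_dimH (hasStrictFDerivAt_expCoord hp z)
    (hasStrictFDerivAt_coadExp e (z : ι → ℂ)) (surjective_orbitDifferentialL hp z) hnhds
  refine Nat.cast_le.1 (hdim.trans ((dimH_mono ?_).trans (dimH_realOrbit_le e (z : ι → ℂ))))
  rintro _ ⟨ξ, ⟨⟨hξU, hξ⟩, hcoord⟩, rfl⟩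
  have hfiber : p z = p (expAt e z ξ) := ((extChartAt 𝓘(ℝ, E) (p z)).injOn hξ
    (mem_extChartAt_source (I := 𝓘(ℝ, E)) (p z))
    (hcoord.trans (expCoord_zero z))).symm
  obtain ⟨u, hu, huz⟩ := (hp.fiber _ _).1 hfiber
  exact ⟨u, hu, huz.trans (expAt_coe hξU)⟩

lemma leafTangent_eq_realOrbitTangent (z : U) :
    leafTangent E e p z = realOrbitTangent e z := by
  refine (Submodule.eq_of_le_of_finrank_le ?_ (finrank_leafTangent_le hp hU z)).symm
  rintro _ ⟨ξ, hξ, rfl⟩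
  exact ⟨ξ, orbitDifferentialL_of_mem_realVectors hp hU z hξ, rfl⟩

lemma finrank_add_card (z : U) :
    Module.finrank ℝ E + Fintype.card ι =
      2 * (poissonMatrix e z).rank + commonKernelDim e z := by
  have hleaf := finrank_add_finrank_leafTangent hp z
  rw [leafTangent_eq_realOrbitTangent hp hU] at hleaf
  have hreal := finrank_realOrbitTangent_add e (z : ι → ℂ)
  lia

lemma commonKernelDim_eq {z₀ : ι → ℂ} (hUM : U ⊆ coadjointOrbit e z₀) (z w : U) :
    commonKernelDim e z = commonKernelDim e w := by
  have hz := finrank_add_card hp hU z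
  have hw := finrank_add_card hp hU w
  rw [rank_poissonMatrix_of_mem_coadjointOrbit e (hUM z.2)] at hz
  rw [rank_poissonMatrix_of_mem_coadjointOrbit e (hUM w.2)] at hw
  lia

end Leaves

/-! ### The CR structure of the leaves -/

section Pencil

open Filter

/-- Were `A y` not in the range of `B`, the range of `(B + t A, A y) : V × ℂ → W` would be larger
than that of `B` at `t = 0`, hence for all small `t`; but for `t ≠ 0` it is that of `B + t A`. -/
lemma mem_range_of_finrank_range_add_smul_le {V W : Type*} [NormedAddCommGroup V] [NormedSpace ℂ V]
    [FiniteDimensional ℂ V] [NormedAddCommGroup W] [NormedSpace ℂ W] [FiniteDimensional ℂ W]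
    (A B : V →ₗ[ℂ] W)
    (h : ∀ t : ℂ, Module.finrank ℂ (LinearMap.range (B + t • A)) ≤
      Module.finrank ℂ (LinearMap.range B)) {y : V} (hy : B y = 0) :
    A y ∈ LinearMap.range B := by
  by_contra hA
  let C : ℂ → V × ℂ →ₗ[ℂ] W := fun t => (B + t • A).coprod (LinearMap.toSpanSingleton ℂ W (A y))
  have hC : Continuous fun t => (C t).toContinuousLinearMap := by
    refine continuous_clm_apply.2 fun x => ?_
    simp only [C, LinearMap.coe_toContinuousLinearMap', LinearMap.coprod_apply,
      LinearMap.add_apply, LinearMap.smul_apply]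
    fun_prop
  have hC₀ : LinearMap.range B < LinearMap.range (C 0) := by
    refine lt_of_le_of_ne ?_ fun heq => hA (heq ▸ ⟨(0, 1), by simp [C]⟩)
    rintro _ ⟨x, rfl⟩
    exact ⟨(x, 0), by simp [C]⟩
  have hCt : ∀ t ≠ 0, LinearMap.range (C t) ≤ LinearMap.range (B + t • A) := by
    rintro t ht _ ⟨⟨x, s⟩, rfl⟩
    refine ⟨x + (s * t⁻¹) • y, ?_⟩
    simp [C, hy, smul_smul, mul_comm t, ht, add_assoc]
  have hnear : ∀ᶠ t in 𝓝 (0 : ℂ), Module.finrank ℂ (LinearMap.range B) <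
      Module.finrank ℂ (LinearMap.range (C t)) := by
    have hopen := (isOpen_setOfPred_nat_le_rank (𝕜 := ℂ) (E := V × ℂ) (F := W)
      (Module.finrank ℂ (LinearMap.range B) + 1)).preimage hC
    have hrank : ∀ t, (C t).rank = Module.finrank ℂ (LinearMap.range (C t)) := fun t =>
      (Module.finrank_eq_rank ℂ _).symm
    refine eventually_of_mem (hopen.mem_nhds ?_) fun t ht => ?_
    · rw [Set.mem_preimage, Set.mem_ofPred_eq, LinearMap.coe_toContinuousLinearMap, hrank]
      exact_mod_cast Submodule.finrank_lt_finrank_of_lt hC₀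
    · rw [Set.mem_preimage, Set.mem_ofPred_eq, LinearMap.coe_toContinuousLinearMap, hrank] at ht
      exact_mod_cast ht
  obtain ⟨t, ht, ht₀⟩ := ((hnear.filter_mono nhdsWithin_le_nhds).and
    (self_mem_nhdsWithin (a := (0 : ℂ)) (s := {0}ᶜ))).exists
  exact (ht.trans_le ((Submodule.finrank_mono (hCt t ht₀)).trans (h t))).false

end Pencil

section Leaves

variable {𝔤₀ : Type*} [LieRing 𝔤₀] [LieAlgebra ℝ 𝔤₀] {ι : Type*} [Fintype ι]

section Kernel

variable (e : Module.Basis ι ℝ 𝔤₀)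

lemma realOrbitTangent_sup_map_mulI (z : ι → ℂ) :
    realOrbitTangent e z ⊔ (realOrbitTangent e z).map (mulI ι).toLinearMap =
      LinearMap.range ((coadAt e z).restrictScalars ℝ) := by
  refine le_antisymm (sup_le ?_ ?_) ?_
  · rintro _ ⟨ξ, -, rfl⟩
    exact ⟨ξ, rfl⟩
  · rintro _ ⟨_, ⟨ξ, -, rfl⟩, rfl⟩
    exact ⟨Complex.I • ξ, (coadAt e z).map_smul _ _⟩
  · rintro _ ⟨ξ, rfl⟩
    obtain ⟨x, hx, y, hy, rfl⟩ := exists_realVectors_add_mulI (K := ⊤)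
      (fun _ _ => Submodule.mem_top) (Submodule.mem_top (x := ξ))
    rw [map_add]
    exact Submodule.add_mem_sup ⟨x, hx.2, rfl⟩
      ⟨coadAt e z y, ⟨y, hy.2, rfl⟩, ((coadAt e z).map_smul _ _).symm⟩

variable {e}

lemma mulVec_mem_range_of_mulVec_eq_zero {w : ι → ℂ}
    (hw : (poissonMatrix e w).rank = genericRank e) (z : ι → ℂ) {y : ι → ℂ}
    (hy : poissonMatrix e w *ᵥ y = 0) :
    poissonMatrix e z *ᵥ y ∈ LinearMap.range (poissonMatrix e w).mulVecLin := by
  refine mem_range_of_finrank_range_add_smul_le (poissonMatrix e z).mulVecLin _ (fun t => ?_) hy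
  have h := rank_le_genericRank e ((1 : ℂ) • w + t • z)
  have hsmul : (t • poissonMatrix e z).mulVecLin = t • (poissonMatrix e z).mulVecLin :=
    LinearMap.ext fun x => smul_mulVec t _ x
  rwa [poissonMatrix_smul_add_smul, one_smul, ← hw, rank, mulVecLin_add, hsmul] at h

lemma liePairing_eq_zero_of_mulVec_eq_zero {w : ι → ℂ}
    (hw : (poissonMatrix e w).rank = genericRank e) (z : ι → ℂ) {x y : ι → ℂ}
    (hx : poissonMatrix e w *ᵥ x = 0) (hy : poissonMatrix e w *ᵥ y = 0) :
    liePairing e z x y = 0 := by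
  obtain ⟨v, hv⟩ := mulVec_mem_range_of_mulVec_eq_zero hw z hy
  rw [mulVecLin_apply] at hv
  rw [liePairing, ← hv, dotProduct_mulVec, ← coadAt_apply, coadAt_eq_neg_mulVec, hx, neg_zero,
    zero_dotProduct]

end Kernel

variable [DecidableEq ι] {E : Type*} [NormedAddCommGroup E] [NormedSpace ℝ E]
  [FiniteDimensional ℝ E] {N : Type*} [TopologicalSpace N] [ChartedSpace E N]
  {e : Module.Basis ι ℝ 𝔤₀} {U : Set (ι → ℂ)} {p : U → N} (hp : IsQuotientByRealForm E e p)
  (hU : IsOpen[orbitTopology e] U)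
include hp hU

lemma leafCRTangent_eq (z : U) :
    leafCRTangent E e p z =
      realOrbitTangent e z ⊓ (realOrbitTangent e z).map (mulI ι).toLinearMap := by
  rw [leafCRTangent, leafTangent_eq_realOrbitTangent hp hU]
  rfl

lemma finrank_leafCRTangent_add (z : U) :
    Module.finrank ℝ (leafCRTangent E e p z) + 2 * Module.finrank ℝ E =
      2 * (poissonMatrix e z).rank := by
  have hsum := Submodule.finrank_sup_add_finrank_inf_eq (realOrbitTangent e (z : ι → ℂ))
    ((realOrbitTangent e (z : ι → ℂ)).map (mulI ι).toLinearMap)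
  rw [realOrbitTangent_sup_map_mulI, finrank_range_coadAt_real, LinearEquiv.finrank_map_eq,
    ← leafCRTangent_eq hp hU] at hsum
  have hleaf := finrank_add_finrank_leafTangent hp z
  rw [leafTangent_eq_realOrbitTangent hp hU] at hleaf
  lia

/-- If `v = ad*(x) z = I ad*(y) z` with `x, y` real, then `x - I y` is in the kernel of `c(z)`, and
its conjugate `x + I y` in that of `c(z̄)`. -/
lemma exists_coadAt_eq_of_mem_leafCRTangent {z : U} {v : ι → ℂ}
    (hv : v ∈ leafCRTangent E e p z) :
    ∃ ξ, poissonMatrix e (star (z : ι → ℂ)) *ᵥ ξ = 0 ∧ coadAt e z ξ = v := by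
  rw [leafCRTangent_eq hp hU] at hv
  obtain ⟨⟨x, hx, rfl⟩, _, ⟨y, hy, rfl⟩, hxy⟩ := hv
  replace hxy : Complex.I • coadAt e z y = coadAt e z x := hxy
  have hker : poissonMatrix e (z : ι → ℂ) *ᵥ (x - Complex.I • y) = 0 := by
    rw [← coadAt_eq_zero_iff, map_sub, map_smul, hxy, sub_self]
  have hstar : star (x - Complex.I • y) = x + Complex.I • y := by
    rw [star_sub, star_smul, mem_realVectors_iff_star.1 hx, mem_realVectors_iff_star.1 hy,
      RCLike.star_def, Complex.conj_I, neg_smul, sub_neg_eq_add]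
  refine ⟨(1 / 2 : ℂ) • (x + Complex.I • y), ?_, ?_⟩
  · rw [mulVec_smul, ← hstar, poissonMatrix_star_mulVec, hker, star_zero, smul_zero]
  · rw [map_smul, map_add, map_smul, hxy, ← two_smul ℂ, smul_smul, one_div_mul_cancel two_ne_zero,
      one_smul]
    rfl

lemma isCRIsotropicFoliation {z₀ : ι → ℂ} (hUM : U ⊆ coadjointOrbit e z₀)
    (hz₀ : (poissonMatrix e z₀).rank = genericRank e) : IsCRIsotropicFoliation E e p where
  cr z w _ := by
    have hz := finrank_leafCRTangent_add hp hU z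
    have hw := finrank_leafCRTangent_add hp hU w
    rw [rank_poissonMatrix_of_mem_coadjointOrbit e (hUM z.2)] at hz
    rw [rank_poissonMatrix_of_mem_coadjointOrbit e (hUM w.2)] at hw
    lia
  isotropic z v hv w hw := by
    obtain ⟨ξ, hξ, rfl⟩ := exists_coadAt_eq_of_mem_leafCRTangent hp hU hv
    obtain ⟨η, hη, rfl⟩ := exists_coadAt_eq_of_mem_leafCRTangent hp hU hw
    rw [symplecticForm_apply]
    refine liePairing_eq_zero_of_mulVec_eq_zero (w := star (z : ι → ℂ)) ?_ z hξ hη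
    rw [rank_poissonMatrix_star, rank_poissonMatrix_of_mem_coadjointOrbit e (hUM z.2), hz₀]

end Leaves

/-! ### The rank of the reduced pencil -/

section Correspondence

open Module

variable {K V W : Type*} [Field K] [AddCommGroup V] [Module K V] [AddCommGroup W] [Module K W]

section Finrank

variable [FiniteDimensional K V]

lemma finrank_add_finrank_of_range_sup_eq [FiniteDimensional K W] (J : V →ₗ[K] W)
    {Q R S : Submodule K W} (hS : S ≤ R) (hR : R ≤ Q) (hQ : LinearMap.range J ⊔ S = Q) :
    finrank K V + finrank K R = finrank K (R.comap J) + finrank K Q := by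
  have hV := LinearMap.finrank_range_add_finrank_ker (R.mkQ ∘ₗ J)
  rw [LinearMap.range_comp, LinearMap.ker_comp, Submodule.ker_mkQ] at hV
  have hQR := finrank_map_add_finrank_ker_inf R.mkQ Q
  have hSR : S.map R.mkQ = ⊥ := LinearMap.le_ker_iff_map.1 (by rwa [Submodule.ker_mkQ])
  rw [Submodule.ker_mkQ, inf_eq_left.2 hR, ← hQ, Submodule.map_sup, hSR, sup_bot_eq, hQ] at hQR
  lia

variable [FiniteDimensional K W]

lemma finrank_map_fst_add_finrank_comap_inr (Z : Submodule K (V × W)) :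
    finrank K (Z.map (LinearMap.fst K V W)) + finrank K (Z.comap (LinearMap.inr K V W)) =
      finrank K Z := by
  rw [← finrank_map_add_finrank_ker_inf (LinearMap.fst K V W) Z, LinearMap.ker_fst,
    ← Submodule.map_comap_eq]
  exact congrArg _ (Submodule.equivMapOfInjective _ LinearMap.inr_injective _).finrank_eq

lemma finrank_map_snd_add_finrank_comap_inl (Z : Submodule K (V × W)) :
    finrank K (Z.map (LinearMap.snd K V W)) + finrank K (Z.comap (LinearMap.inl K V W)) =
      finrank K Z := by
  rw [← finrank_map_add_finrank_ker_inf (LinearMap.snd K V W) Z, LinearMap.ker_snd,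
    ← Submodule.map_comap_eq]
  exact congrArg _ (Submodule.equivMapOfInjective _ LinearMap.inl_injective _).finrank_eq

end Finrank

/-- The pairs `(a, b)` with `A a + B b = 0`. For the Poisson bivectors `A = c(z)` and `B = c(z̄)`,
this is the complexified cotangent space of the quotient, up to `ker A × ker B`. -/
def pencilSpace (A B : V →ₗ[K] W) : Submodule K (V × V) :=
  LinearMap.ker (A.coprod B)

lemma mem_pencilSpace {A B : V →ₗ[K] W} {q : V × V} :
    q ∈ pencilSpace A B ↔ A q.1 + B q.2 = 0 := Iff.rfl

/-- The triples `(y, a, b)` with `A a + B b = 0`, `A y = l A a` and `B y = m B b`: a correspondence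
between the kernel of `m A + l B` and the radical of a form on `pencilSpace A B`. -/
def pencilCorrespondence (A B : V →ₗ[K] W) (l m : K) : Submodule K (V × V × V) :=
  (pencilSpace A B).comap (LinearMap.snd K V (V × V)) ⊓
    (LinearMap.eqLocus (A ∘ₗ LinearMap.fst K V (V × V))
      (l • A ∘ₗ LinearMap.fst K V V ∘ₗ LinearMap.snd K V (V × V)) ⊓
    LinearMap.eqLocus (B ∘ₗ LinearMap.fst K V (V × V))
      (m • B ∘ₗ LinearMap.snd K V V ∘ₗ LinearMap.snd K V (V × V)))

/-- The image of `pencilCorrespondence` in `pencilSpace A B`; for skew forms `A`, `B`, it is the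
radical of the form `l A(a, a') + m B(b, b')`, see `mem_pencilRadical_iff_of_skew`. -/
def pencilRadical (A B : V →ₗ[K] W) (l m : K) : Submodule K (V × V) :=
  (pencilCorrespondence A B l m).map (LinearMap.snd K V (V × V))

variable {A B : V →ₗ[K] W} {l m : K}

lemma mem_pencilCorrespondence {y : V} {q : V × V} :
    (y, q) ∈ pencilCorrespondence A B l m ↔
      A q.1 + B q.2 = 0 ∧ A y = l • A q.1 ∧ B y = m • B q.2 := Iff.rfl

lemma mem_pencilCorrespondence_swap {y : V} {q : V × V} :
    (y, q.swap) ∈ pencilCorrespondence B A m l ↔ (y, q) ∈ pencilCorrespondence A B l m := by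
  rw [mem_pencilCorrespondence, mem_pencilCorrespondence, Prod.fst_swap, Prod.snd_swap,
    add_comm (B q.2), and_comm (a := B y = _)]

lemma mem_pencilRadical {q : V × V} :
    q ∈ pencilRadical A B l m ↔ q ∈ pencilSpace A B ∧ ∃ y, A y = l • A q.1 ∧ B y = m • B q.2 := by
  refine ⟨?_, fun ⟨hq, y, hy⟩ => ⟨(y, q), ⟨hq, hy⟩, rfl⟩⟩
  rintro ⟨⟨y, q⟩, ⟨hq, hy⟩, rfl⟩
  exact ⟨hq, y, hy⟩

variable (A B l m) in
lemma pencilRadical_le : pencilRadical A B l m ≤ pencilSpace A B :=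
  fun _ h => (mem_pencilRadical.1 h).1

variable (A B l m) in
lemma ker_prod_ker_le_pencilRadical :
    (LinearMap.ker A).prod (LinearMap.ker B) ≤ pencilRadical A B l m := by
  rintro q ⟨hA : A q.1 = 0, hB : B q.2 = 0⟩
  exact mem_pencilRadical.2 ⟨by simp [mem_pencilSpace, hA, hB], 0, by simp [hA], by simp [hB]⟩

variable (A B l m) in
lemma comap_inl_pencilCorrespondence :
    (pencilCorrespondence A B l m).comap (LinearMap.inl K V (V × V)) =
      LinearMap.ker A ⊓ LinearMap.ker B := by
  ext y
  simp [mem_pencilCorrespondence]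

lemma comap_inr_pencilCorrespondence (hlm : l ≠ 0 ∨ m ≠ 0) :
    (pencilCorrespondence A B l m).comap (LinearMap.inr K V (V × V)) =
      (LinearMap.ker A).prod (LinearMap.ker B) := by
  ext ⟨a, b⟩
  rw [Submodule.mem_comap, LinearMap.inr_apply, mem_pencilCorrespondence, Submodule.mem_prod,
    LinearMap.mem_ker, LinearMap.mem_ker, map_zero, map_zero, eq_comm (a := 0), smul_eq_zero,
    eq_comm (a := 0), smul_eq_zero]
  constructor
  · rintro ⟨h, ha, hb⟩
    rcases hlm with hl | hm
    · have ha := ha.resolve_left hl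
      exact ⟨ha, by rwa [ha, zero_add] at h⟩
    · have hb := hb.resolve_left hm
      exact ⟨by rwa [hb, add_zero] at h, hb⟩
  · rintro ⟨ha, hb⟩
    exact ⟨by rw [ha, hb, add_zero], .inr ha, .inr hb⟩

lemma exists_mem_pencilCorrespondence (hl : l ≠ 0)
    (hB : ∀ y ∈ LinearMap.ker B, A y ∈ LinearMap.range B) {y : V} (hy : (m • A + l • B) y = 0) :
    ∃ q, (y, q) ∈ pencilCorrespondence A B l m := by
  rw [LinearMap.add_apply, LinearMap.smul_apply, LinearMap.smul_apply] at hy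
  obtain ⟨x, hx⟩ : A y ∈ LinearMap.range B := by
    rcases eq_or_ne m 0 with rfl | hm
    · rw [zero_smul, zero_add, smul_eq_zero_iff_right hl] at hy
      exact hB y hy
    · refine ⟨-(m⁻¹ • l • y), ?_⟩
      rw [map_neg, map_smul, map_smul, ← neg_eq_of_add_eq_zero_right hy, smul_neg, neg_neg,
        inv_smul_smul₀ hm]
  refine ⟨(l⁻¹ • y, -(l⁻¹ • x)), mem_pencilCorrespondence.2 ⟨?_, ?_, ?_⟩⟩
  · rw [map_smul, map_neg, map_smul, hx, add_neg_cancel]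
  · rw [map_smul, smul_inv_smul₀ hl]
  · rw [map_neg, map_smul, hx, smul_neg, smul_comm, ← smul_neg, neg_eq_of_add_eq_zero_right hy,
      inv_smul_smul₀ hl]

lemma map_fst_pencilCorrespondence (hlm : l ≠ 0 ∨ m ≠ 0)
    (hA : ∀ y ∈ LinearMap.ker A, B y ∈ LinearMap.range A)
    (hB : ∀ y ∈ LinearMap.ker B, A y ∈ LinearMap.range B) :
    (pencilCorrespondence A B l m).map (LinearMap.fst K V (V × V)) =
      LinearMap.ker (m • A + l • B) := by
  refine le_antisymm ?_ fun y hy => ?_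
  · rintro _ ⟨⟨y, q⟩, h, rfl⟩
    obtain ⟨hq, hAy, hBy⟩ := mem_pencilCorrespondence.1 h
    rw [LinearMap.mem_ker, LinearMap.add_apply, LinearMap.smul_apply, LinearMap.smul_apply,
      LinearMap.fst_apply, hAy, hBy, smul_comm m l, ← smul_add, ← smul_add, hq, smul_zero,
      smul_zero]
  · obtain ⟨q, hq⟩ : ∃ q, (y, q) ∈ pencilCorrespondence A B l m := by
      rcases hlm with hl | hm
      · exact exists_mem_pencilCorrespondence hl hB hy
      · obtain ⟨q, hq⟩ := exists_mem_pencilCorrespondence (m := l) hm hA (by rwa [add_comm])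
        exact ⟨q.swap, mem_pencilCorrespondence_swap.2 hq⟩
    exact ⟨(y, q), hq, rfl⟩

lemma finrank_pencilRadical [FiniteDimensional K V] (hlm : l ≠ 0 ∨ m ≠ 0)
    (hA : ∀ y ∈ LinearMap.ker A, B y ∈ LinearMap.range A)
    (hB : ∀ y ∈ LinearMap.ker B, A y ∈ LinearMap.range B) :
    finrank K (pencilRadical A B l m) + finrank K (LinearMap.range A) +
        finrank K (LinearMap.range B) + finrank K (LinearMap.range (m • A + l • B)) +
        finrank K (LinearMap.ker A ⊓ LinearMap.ker B : Submodule K V) =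
      3 * finrank K V := by
  have hsnd := finrank_map_snd_add_finrank_comap_inl (pencilCorrespondence A B l m)
  rw [comap_inl_pencilCorrespondence, ← pencilRadical] at hsnd
  have hfst := finrank_map_fst_add_finrank_comap_inr (pencilCorrespondence A B l m)
  rw [comap_inr_pencilCorrespondence hlm, map_fst_pencilCorrespondence hlm hA hB,
    ← finrank_map_fst_add_finrank_comap_inr, Submodule.prod_map_fst,
    Submodule.prod_comap_inr] at hfst
  have hrankA := A.finrank_range_add_finrank_ker
  have hrankB := B.finrank_range_add_finrank_ker
  have hrank := (m • A + l • B).finrank_range_add_finrank_ker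
  lia

end Correspondence

section SkewForms

open Module

variable {K V : Type*} [Field K] [AddCommGroup V] [Module K V] [FiniteDimensional K V]
  {A B : LinearMap.BilinForm K V} (hA : ∀ x y, A x y = -A y x) (hB : ∀ x y, B x y = -B y x)
include hA hB

lemma mem_pencilRadical_iff_of_skew {l m : K} {q : V × V} (hq : q ∈ pencilSpace A B) :
    q ∈ pencilRadical A B l m ↔
      ∀ r ∈ pencilSpace A B, l * A q.1 r.1 + m * B q.2 r.2 = 0 := by
  rw [mem_pencilRadical, and_iff_right hq]
  constructor
  · rintro ⟨y, hAy, hBy⟩ r hr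
    have h : (A r.1 + B r.2) y = 0 := by rw [mem_pencilSpace.1 hr, LinearMap.zero_apply]
    rw [LinearMap.add_apply, hA, hB, hAy, hBy, LinearMap.smul_apply, LinearMap.smul_apply,
      smul_eq_mul, smul_eq_mul] at h
    linear_combination -h
  · intro h
    -- The functional `(a, b) ↦ l A(q₁, a) + m B(q₂, b)` vanishes on the kernel of `A + B`, so that
    -- it factors through `A + B : V × V → V*`, and a functional on `V*` is the evaluation at `-y`.
    have hann : (l • A q.1).coprod (m • B q.2) ∈ (pencilSpace A B).dualAnnihilator :=
      (Submodule.mem_dualAnnihilator _).2 h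
    rw [pencilSpace, ← LinearMap.range_dualMap_eq_dualAnnihilator_ker] at hann
    obtain ⟨ψ, hψ⟩ := hann
    obtain ⟨y, rfl⟩ := (evalEquiv K V).surjective ψ
    have hy (a b) : A a y + B b y = l * A q.1 a + m * B q.2 b := LinearMap.congr_fun hψ (a, b)
    refine ⟨-y, LinearMap.ext fun a => ?_, LinearMap.ext fun b => ?_⟩
    · have ha := hy a 0
      rw [map_zero, map_zero, LinearMap.zero_apply, mul_zero, add_zero, add_zero] at ha
      rw [map_neg, LinearMap.neg_apply, ← hA, ha]
      rfl
    · have hb := hy 0 b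
      rw [map_zero, map_zero, LinearMap.zero_apply, mul_zero, zero_add, zero_add] at hb
      rw [map_neg, LinearMap.neg_apply, ← hB, hb]
      rfl

lemma finrank_pencilSpace_of_skew :
    finrank K (pencilSpace A B) =
      finrank K V + finrank K (LinearMap.ker A ⊓ LinearMap.ker B : Submodule K V) := by
  have hcoann : (LinearMap.range (A.coprod B)).dualCoannihilator =
      LinearMap.ker A ⊓ LinearMap.ker B := by
    ext y
    have hAy : A y = 0 ↔ ∀ a, A a y = 0 := by
      simp only [LinearMap.ext_iff, hA y, LinearMap.zero_apply, neg_eq_zero]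
    have hBy : B y = 0 ↔ ∀ b, B b y = 0 := by
      simp only [LinearMap.ext_iff, hB y, LinearMap.zero_apply, neg_eq_zero]
    rw [Submodule.mem_dualCoannihilator, Submodule.mem_inf, LinearMap.mem_ker, LinearMap.mem_ker,
      hAy, hBy]
    refine ⟨fun h => ⟨fun a => ?_, fun b => ?_⟩, ?_⟩
    · simpa using h _ ⟨(a, 0), rfl⟩
    · simpa using h _ ⟨(0, b), rfl⟩
    · rintro ⟨ha, hb⟩ _ ⟨q, rfl⟩
      rw [LinearMap.coprod_apply, LinearMap.add_apply, ha, hb, add_zero]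
  have hrange := Subspace.finrank_add_finrank_dualCoannihilator_eq (LinearMap.range (A.coprod B))
  rw [hcoann] at hrange
  have hker := (A.coprod B).finrank_range_add_finrank_ker
  rw [finrank_prod, ← pencilSpace] at hker
  lia

end SkewForms

section Complexification

open Module TensorProduct

variable {V X : Type*} [AddCommGroup V] [Module ℝ V] [AddCommGroup X] [Module ℂ X]
  [StarAddMonoid X] [StarModule ℂ X]

/-- The form `l₁ b₁ + l₂ b₂` on the complexification, for real forms `b₁, b₂` and complex
coefficients: an element of the complexified pencil, whose rank at a point is `pencilRank`. -/
def complexPencil (b₁ b₂ : LinearMap.BilinForm ℝ V) (l₁ l₂ : ℂ) :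
    LinearMap.BilinForm ℂ (ℂ ⊗[ℝ] V) :=
  l₁ • b₁.baseChange ℂ + l₂ • b₂.baseChange ℂ

/-- The complex linear extension of `v ↦ (j v, star (j v))`; it sends a real covector to its
`(1,0)`- and `(0,1)`-parts if `j` is the `(1,0)`-part. -/
def conjExtension (j : V →ₗ[ℝ] X) : ℂ ⊗[ℝ] V →ₗ[ℂ] X × X :=
  LinearMap.liftBaseChange ℂ
    { toFun := fun v => (j v, star (j v))
      map_add' := fun v w => by rw [map_add, star_add, Prod.mk_add_mk]
      map_smul' := fun t v => by
        rw [map_smul, ← Complex.coe_smul, star_smul, RCLike.star_def, Complex.conj_ofReal]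
        rfl }

@[simp] lemma conjExtension_tmul (j : V →ₗ[ℝ] X) (a : ℂ) (v : V) :
    conjExtension j (a ⊗ₜ v) = a • (j v, star (j v)) :=
  LinearMap.liftBaseChange_tmul ℂ _ a v

lemma pencil_coefficients_ne_zero {l₁ l₂ : ℂ} (h : (l₁, l₂) ≠ (0, 0)) :
    ((l₁ + Complex.I * l₂) / 2, (l₁ - Complex.I * l₂) / 2) ≠ (0, 0) := by
  contrapose! h
  obtain ⟨hm, hl⟩ := Prod.mk.inj h
  have hl₂ : Complex.I * l₂ = 0 := by linear_combination hm - hl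
  exact Prod.ext (by linear_combination hm + hl)
    ((mul_eq_zero.1 hl₂).resolve_left Complex.I_ne_zero)

variable {A B : LinearMap.BilinForm ℂ X} (hAB : ∀ x y, B (star x) (star y) = star (A x y))
include hAB

omit [StarModule ℂ X] in
lemma mk_star_mem_pencilSpace {a b : X} (h : (a, b) ∈ pencilSpace A B) :
    (star b, star a) ∈ pencilSpace A B := by
  refine mem_pencilSpace.2 (LinearMap.ext fun x => ?_)
  have hx : A a (star x) + B b (star x) = 0 :=
    LinearMap.congr_fun (mem_pencilSpace.1 h) (star x)
  rw [LinearMap.add_apply, LinearMap.zero_apply, ← star_star x, hAB, ← star_star (A _ _), ← hAB,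
    star_star, star_star, ← star_add, add_comm, hx, star_zero]

lemma pencilSpace_le {P : Submodule ℂ (X × X)}
    (hP : ∀ a, (a, star a) ∈ pencilSpace A B → (a, star a) ∈ P) : pencilSpace A B ≤ P := by
  rintro ⟨a, b⟩ hab
  have hconj := mk_star_mem_pencilSpace hAB hab
  have hadd : (a + star b, star (a + star b)) ∈ P := hP _ <| by
    rw [star_add, star_star, add_comm (star a)]
    exact Submodule.add_mem _ hab hconj
  have hsub : (Complex.I • (a - star b), star (Complex.I • (a - star b))) ∈ P := hP _ <| by
    rw [star_smul, star_sub, star_star, RCLike.star_def, Complex.conj_I, neg_smul, ← smul_neg,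
      neg_sub]
    exact Submodule.smul_mem _ Complex.I (Submodule.sub_mem _ hab hconj)
  have hab' : (a, b) = (1 / 2 : ℂ) • ((a + star b, star (a + star b)) -
      Complex.I • (Complex.I • (a - star b), star (Complex.I • (a - star b)))) := by
    simp only [star_smul, star_sub, star_add, star_star, RCLike.star_def, Complex.conj_I,
      Prod.smul_mk, Prod.mk_sub_mk, smul_smul, mul_neg, Complex.I_mul_I, neg_neg]
    exact Prod.ext (by module) (by module)
  rw [hab']
  exact P.smul_mem _ (P.sub_mem hadd (P.smul_mem _ hsub))

omit [StarModule ℂ X] in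
lemma skew_of_star_comm (hA : ∀ x y, A x y = -A y x) (x y : X) : B x y = -B y x := by
  rw [← star_star x, ← star_star y, hAB, hA, star_neg, ← hAB]

section ConjExtension

variable {b₁ b₂ : LinearMap.BilinForm ℝ V} {j : V →ₗ[ℝ] X}

omit hAB in
lemma conjExtension_mem_pencilSpace (hj : ∀ v, (j v, star (j v)) ∈ pencilSpace A B)
    (v : ℂ ⊗[ℝ] V) : conjExtension j v ∈ pencilSpace A B := by
  induction v using TensorProduct.induction_on with
  | zero => exact (map_zero (conjExtension j)).symm ▸ Submodule.zero_mem _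
  | add v w hv hw => exact (map_add (conjExtension j) v w).symm ▸ Submodule.add_mem _ hv hw
  | tmul a v => exact conjExtension_tmul j a v ▸ Submodule.smul_mem _ _ (hj v)

lemma complexPencil_apply (h₁ : ∀ v w, b₁ v w = (A (j v) (j w)).re)
    (h₂ : ∀ v w, b₂ v w = (A (j v) (j w)).im) (l₁ l₂ : ℂ) (v w : ℂ ⊗[ℝ] V) :
    complexPencil b₁ b₂ l₁ l₂ v w =
      (l₁ - Complex.I * l₂) / 2 * A (conjExtension j v).1 (conjExtension j w).1 +
        (l₁ + Complex.I * l₂) / 2 * B (conjExtension j v).2 (conjExtension j w).2 := by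
  let J₁ := LinearMap.fst ℂ X X ∘ₗ conjExtension j
  let J₂ := LinearMap.snd ℂ X X ∘ₗ conjExtension j
  suffices complexPencil b₁ b₂ l₁ l₂ = ((l₁ - Complex.I * l₂) / 2) • A.compl₁₂ J₁ J₁ +
      ((l₁ + Complex.I * l₂) / 2) • B.compl₁₂ J₂ J₂ from LinearMap.congr_fun₂ this v w
  ext v w
  simp only [complexPencil, J₁, J₂, AlgebraTensorModule.curry_apply,
    LinearMap.restrictScalars_add, LinearMap.restrictScalars_smul, curry_apply,
    LinearMap.add_apply, LinearMap.smul_apply, LinearMap.coe_restrictScalars,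
    LinearMap.BilinForm.baseChange_tmul, h₁, h₂, mul_one, Complex.real_smul, smul_eq_mul,
    LinearMap.compl₁₂_apply, LinearMap.coe_comp, LinearMap.coe_fst, LinearMap.coe_snd,
    Function.comp_apply, conjExtension_tmul, one_smul, hAB, RCLike.star_def]
  have hre := Complex.re_eq_add_conj (A (j v) (j w))
  have him := Complex.im_eq_sub_conj (A (j v) (j w))
  rw [← div_div, div_eq_mul_inv _ Complex.I, Complex.inv_I] at him
  linear_combination l₁ * hre + l₂ * him

lemma range_conjExtension_sup_eq (hj : ∀ v, (j v, star (j v)) ∈ pencilSpace A B)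
    (hj' : ∀ a, (a, star a) ∈ pencilSpace A B → ∃ v, a - j v ∈ LinearMap.ker A) :
    LinearMap.range (conjExtension j) ⊔ (LinearMap.ker A).prod (LinearMap.ker B) =
      pencilSpace A B := by
  have hker := (ker_prod_ker_le_pencilRadical A B 0 0).trans (pencilRadical_le A B 0 0)
  refine le_antisymm (sup_le ?_ hker) (pencilSpace_le hAB fun a ha => ?_)
  · rintro _ ⟨v, rfl⟩
    exact conjExtension_mem_pencilSpace hj v
  · obtain ⟨v, hv⟩ := hj' a ha
    have hv' : B (star (a - j v)) = 0 := by
      have h := mem_pencilSpace.1 (Submodule.sub_mem _ ha (hj v))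
      rwa [Prod.mk_sub_mk, ← star_sub, LinearMap.mem_ker.1 hv, zero_add] at h
    refine Submodule.mem_sup.2
      ⟨_, ⟨1 ⊗ₜ v, rfl⟩, (a - j v, star (a - j v)), ⟨hv, hv'⟩, ?_⟩
    rw [conjExtension_tmul, one_smul, star_sub, Prod.mk_add_mk, add_sub_cancel, add_sub_cancel]

variable [FiniteDimensional ℂ X] (hA : ∀ x y, A x y = -A y x)
include hA

lemma ker_complexPencil (h₁ : ∀ v w, b₁ v w = (A (j v) (j w)).re)
    (h₂ : ∀ v w, b₂ v w = (A (j v) (j w)).im) (hj : ∀ v, (j v, star (j v)) ∈ pencilSpace A B)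
    (hj' : ∀ a, (a, star a) ∈ pencilSpace A B → ∃ v, a - j v ∈ LinearMap.ker A) (l₁ l₂ : ℂ) :
    LinearMap.ker (complexPencil b₁ b₂ l₁ l₂) = (pencilRadical A B
      ((l₁ - Complex.I * l₂) / 2) ((l₁ + Complex.I * l₂) / 2)).comap (conjExtension j) := by
  have hB := skew_of_star_comm hAB hA
  ext v
  rw [Submodule.mem_comap, mem_pencilRadical_iff_of_skew hA hB (conjExtension_mem_pencilSpace hj v),
    LinearMap.mem_ker]
  constructor
  · intro hv r hr
    rw [← range_conjExtension_sup_eq hAB hj hj'] at hr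
    obtain ⟨_, ⟨w, rfl⟩, s, ⟨hs₁ : A s.1 = 0, hs₂ : B s.2 = 0⟩, rfl⟩ := Submodule.mem_sup.1 hr
    have hAs (x) : A x s.1 = 0 := by rw [hA, hs₁, LinearMap.zero_apply, neg_zero]
    have hBs (x) : B x s.2 = 0 := by rw [hB, hs₂, LinearMap.zero_apply, neg_zero]
    rw [Prod.fst_add, Prod.snd_add, map_add, map_add, hAs, hBs, add_zero, add_zero,
      ← complexPencil_apply hAB h₁ h₂, hv, LinearMap.zero_apply]
  · intro hv
    refine LinearMap.ext fun w => ?_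
    rw [complexPencil_apply hAB h₁ h₂, LinearMap.zero_apply]
    exact hv _ (conjExtension_mem_pencilSpace hj w)

lemma finrank_range_complexPencil_add [FiniteDimensional ℝ V]
    (hrank : finrank ℂ (LinearMap.range B) = finrank ℂ (LinearMap.range A))
    (hkerA : ∀ y ∈ LinearMap.ker A, B y ∈ LinearMap.range A)
    (hkerB : ∀ y ∈ LinearMap.ker B, A y ∈ LinearMap.range B)
    (h₁ : ∀ v w, b₁ v w = (A (j v) (j w)).re)
    (h₂ : ∀ v w, b₂ v w = (A (j v) (j w)).im) (hj : ∀ v, (j v, star (j v)) ∈ pencilSpace A B)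
    (hj' : ∀ a, (a, star a) ∈ pencilSpace A B → ∃ v, a - j v ∈ LinearMap.ker A)
    {l₁ l₂ : ℂ} (hl : (l₁, l₂) ≠ (0, 0)) :
    finrank ℂ (LinearMap.range (complexPencil b₁ b₂ l₁ l₂)) + 2 * finrank ℂ X =
      2 * finrank ℂ (LinearMap.range A) +
        2 * finrank ℂ (LinearMap.ker A ⊓ LinearMap.ker B : Submodule ℂ X) +
        finrank ℂ (LinearMap.range
          (((l₁ + Complex.I * l₂) / 2) • A + ((l₁ - Complex.I * l₂) / 2) • B)) := by
  have hB := skew_of_star_comm hAB hA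
  have hlm : (l₁ - Complex.I * l₂) / 2 ≠ 0 ∨ (l₁ + Complex.I * l₂) / 2 ≠ 0 := by
    rw [or_comm, ← not_and_or]
    exact fun h => pencil_coefficients_ne_zero hl (Prod.ext h.1 h.2)
  have hform := (complexPencil b₁ b₂ l₁ l₂).finrank_range_add_finrank_ker
  rw [ker_complexPencil hAB hA h₁ h₂ hj hj'] at hform
  have hpull := finrank_add_finrank_of_range_sup_eq (conjExtension j)
    (ker_prod_ker_le_pencilRadical A B ((l₁ - Complex.I * l₂) / 2) ((l₁ + Complex.I * l₂) / 2))
    (pencilRadical_le A B _ _) (range_conjExtension_sup_eq hAB hj hj')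
  have hspace := finrank_pencilSpace_of_skew hA hB
  have hrad := finrank_pencilRadical hlm hkerA hkerB
  lia

end ConjExtension

end Complexification

section PoissonForm

open Module

variable {𝔤₀ : Type*} [LieRing 𝔤₀] [LieAlgebra ℝ 𝔤₀] {ι : Type*} [Fintype ι]

lemma liePairing_star (e : Module.Basis ι ℝ 𝔤₀) (z ξ η : ι → ℂ) :
    liePairing e (star z) (star ξ) (star η) = star (liePairing e z ξ η) := by
  rw [liePairing, poissonMatrix_star_mulVec, star_dotProduct_star, dotProduct_comm, liePairing]

variable [DecidableEq ι]

/-- The form `(ξ, η) ↦ ⟨z, [ξ, η]⟩` on `𝔤`. -/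
def poissonForm (e : Module.Basis ι ℝ 𝔤₀) (z : ι → ℂ) : LinearMap.BilinForm ℂ (ι → ℂ) :=
  (dotProductEquiv ℂ ι).toLinearMap ∘ₗ coadAt e z

variable (e : Module.Basis ι ℝ 𝔤₀)

@[simp] lemma poissonForm_apply (z ξ η : ι → ℂ) : poissonForm e z ξ η = liePairing e z ξ η :=
  coadAt_dotProduct e z ξ η

lemma poissonForm_smul_add_smul (a b : ℂ) (z w : ι → ℂ) :
    poissonForm e (a • z + b • w) = a • poissonForm e z + b • poissonForm e w := by
  refine LinearMap.ext₂ fun ξ η => ?_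
  simp [liePairing, poissonMatrix_smul_add_smul, add_mulVec, smul_mulVec]

lemma ker_poissonForm (z : ι → ℂ) :
    LinearMap.ker (poissonForm e z) = LinearMap.ker (poissonMatrix e z).mulVecLin := by
  ext ξ
  rw [poissonForm, LinearEquiv.ker_comp, LinearMap.mem_ker, LinearMap.mem_ker, coadAt_eq_zero_iff,
    mulVecLin_apply]

lemma finrank_range_poissonForm (z : ι → ℂ) :
    finrank ℂ (LinearMap.range (poissonForm e z)) = (poissonMatrix e z).rank := by
  rw [poissonForm, LinearMap.range_comp, LinearEquiv.finrank_map_eq, finrank_range_coadAt]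

variable {e}

lemma poissonForm_mem_range {w : ι → ℂ} (hw : (poissonMatrix e w).rank = genericRank e)
    (z : ι → ℂ) : ∀ ξ ∈ LinearMap.ker (poissonForm e w),
      poissonForm e z ξ ∈ LinearMap.range (poissonForm e w) := by
  intro ξ hξ
  rw [ker_poissonForm] at hξ
  obtain ⟨η, hη⟩ := mulVec_mem_range_of_mulVec_eq_zero hw z hξ
  refine ⟨η, ?_⟩
  rw [poissonForm, poissonForm, LinearMap.comp_apply, LinearMap.comp_apply, coadAt_eq_neg_mulVec,
    coadAt_eq_neg_mulVec, ← mulVecLin_apply (poissonMatrix e w), hη]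

lemma mem_pencilSpace_poissonForm_iff {z a : ι → ℂ} :
    (a, star a) ∈ pencilSpace (poissonForm e z) (poissonForm e (star z)) ↔
      ∀ ξ ∈ realVectors ι, (liePairing e z a ξ).re = 0 := by
  have hre {ξ : ι → ℂ} (hξ : ξ ∈ realVectors ι) :
      (poissonForm e z a + poissonForm e (star z) (star a)) ξ =
        ((2 * (liePairing e z a ξ).re : ℝ) : ℂ) := by
    have hstar := liePairing_star e z a ξ
    rw [mem_realVectors_iff_star.1 hξ] at hstar
    rw [LinearMap.add_apply, poissonForm_apply, poissonForm_apply, hstar]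
    exact Complex.add_conj _
  rw [mem_pencilSpace]
  refine ⟨fun h ξ hξ => ?_, fun h => LinearMap.pi_ext' fun i => LinearMap.ext_ring ?_⟩
  · simpa using (hre hξ).symm.trans (LinearMap.congr_fun h ξ)
  · have hi : (Pi.single i 1 : ι → ℂ) ∈ realVectors ι := by
      rw [mem_realVectors_iff_star, Pi.star_single, star_one]
    simpa [h _ hi] using hre hi

end PoissonForm

section PencilRank

open Module

variable {𝔤₀ : Type*} [LieRing 𝔤₀] [LieAlgebra ℝ 𝔤₀] {ι : Type*} [Fintype ι] [DecidableEq ι]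
  {E : Type*} [NormedAddCommGroup E] [NormedSpace ℝ E]
  {N : Type*} [TopologicalSpace N] [ChartedSpace E N] {e : Module.Basis ι ℝ 𝔤₀}
  {U : Set (ι → ℂ)} {p : U → N} (hp : IsQuotientByRealForm E e p)
  (hU : IsOpen[orbitTopology e] U)
include hp hU

lemma Represents.mem_pencilSpace {z : U} {α : E →ₗ[ℝ] ℝ} {a : ι → ℂ}
    (h : Represents e p z α a) :
    (a, star a) ∈ pencilSpace (poissonForm e z) (poissonForm e (star (z : ι → ℂ))) := by
  refine mem_pencilSpace_poissonForm_iff.2 fun ξ hξ => ?_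
  have hα := h ξ
  rw [orbitDifferentialL_of_mem_realVectors hp hU z hξ, map_zero, dotProduct_comm,
    coadAt_dotProduct] at hα
  rw [liePairing_skew, Complex.neg_re, (mul_eq_zero_iff_left two_ne_zero).1 hα, neg_zero]

variable [FiniteDimensional ℝ E]

lemma exists_represents_of_mem_pencilSpace {z : U} {a : ι → ℂ}
    (h : (a, star a) ∈ pencilSpace (poissonForm e z) (poissonForm e (star (z : ι → ℂ)))) :
    ∃ α : E →ₗ[ℝ] ℝ, Represents e p z α a := by
  let f : (ι → ℂ) →ₗ[ℝ] ℝ := (2 : ℝ) • Complex.reLm ∘ₗ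
    (dotProductBilin ℂ ℂ a ∘ₗ coadAt e (z : ι → ℂ)).restrictScalars ℝ
  obtain ⟨α, hα⟩ := exists_comp_eq_of_ker_le (g := f)
    (f := (orbitDifferentialL (E := E) e p z).toLinearMap) fun ξ hξ => by
    have hleaf : coadAt e (z : ι → ℂ) ξ ∈ leafTangent E e p z := ⟨ξ, hξ, rfl⟩
    rw [leafTangent_eq_realOrbitTangent hp hU] at hleaf
    obtain ⟨x, hx, hxξ : coadAt e (z : ι → ℂ) x = coadAt e (z : ι → ℂ) ξ⟩ := hleaf
    change 2 * (a ⬝ᵥ coadAt e (z : ι → ℂ) ξ).re = 0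
    rw [← hxξ, dotProduct_comm, coadAt_dotProduct, liePairing_skew, Complex.neg_re,
      mem_pencilSpace_poissonForm_iff.1 h x hx, neg_zero, mul_zero]
  exact ⟨α, fun ξ => (hα ξ).symm⟩

lemma exists_sub_covectorLift_mem_ker {z : U} {a : ι → ℂ}
    (h : (a, star a) ∈ pencilSpace (poissonForm e z) (poissonForm e (star (z : ι → ℂ)))) :
    ∃ α, a - covectorLift hp z α ∈ LinearMap.ker (poissonForm e z) := by
  obtain ⟨α, hα⟩ := exists_represents_of_mem_pencilSpace hp hU h
  refine ⟨α, ?_⟩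
  rw [LinearMap.sub_mem_ker_iff]
  refine LinearMap.ext fun b => ?_
  rw [poissonForm_apply, poissonForm_apply, hα.liePairing_left (represents_covectorLift hp z α)]

lemma pencilRank_pushBivector (z : U)
    (hz : (poissonMatrix e (z : ι → ℂ)).rank = genericRank e) {l₁ l₂ : ℂ}
    (hl : (l₁, l₂) ≠ (0, 0)) :
    pencilRank (pushBivector hp 1) (pushBivector hp (-Complex.I)) l₁ l₂ (p z) +
        2 * Fintype.card ι =
      2 * genericRank e + 2 * commonKernelDim e z +
        (poissonMatrix e (((l₁ + Complex.I * l₂) / 2) • (z : ι → ℂ) +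
          ((l₁ - Complex.I * l₂) / 2) • star (z : ι → ℂ))).rank := by
  have hzs : (poissonMatrix e (star (z : ι → ℂ))).rank = genericRank e :=
    (rank_poissonMatrix_star e _).trans hz
  have hlift (α : E →ₗ[ℝ] ℝ) : Represents e p z α (covectorLift hp z α) :=
    represents_covectorLift hp z α
  have hre (α β : E →ₗ[ℝ] ℝ) := (pushBivector_apply hp hU 1 z (hlift α) (hlift β)).trans
    (by rw [one_mul, ← poissonForm_apply])
  have him (α β : E →ₗ[ℝ] ℝ) := (pushBivector_apply hp hU (-Complex.I) z (hlift α) (hlift β)).trans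
    (show _ = (poissonForm e z (covectorLift hp z α) (covectorLift hp z β)).im by
      rw [poissonForm_apply]; simp)
  have : FiniteDimensional ℝ (Module.Dual ℝ (TangentSpace 𝓘(ℝ, E) (p z))) :=
    inferInstanceAs (FiniteDimensional ℝ (Module.Dual ℝ E))
  have hpencil := finrank_range_complexPencil_add (V := Module.Dual ℝ (TangentSpace 𝓘(ℝ, E) (p z)))
    (fun ξ η => by simp only [poissonForm_apply, liePairing_star])
    (fun ξ η => by simp only [poissonForm_apply, liePairing_skew e _ ξ η])
    (by rw [finrank_range_poissonForm, finrank_range_poissonForm, hz, hzs])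
    (poissonForm_mem_range hz _) (poissonForm_mem_range hzs _) hre him
    (fun α => (hlift α).mem_pencilSpace hp hU)
    (fun a => exists_sub_covectorLift_mem_ker hp hU) hl
  rw [← poissonForm_smul_add_smul, finrank_range_poissonForm, finrank_range_poissonForm, hz,
    ker_poissonForm, ker_poissonForm, finrank_pi] at hpencil
  exact hpencil

end PencilRank

section Elimination

open Polynomial

variable {R K : Type*} [CommRing R] [Field K]

/-- Elimination of one variable: at a point `φ` of `Spec R`, if the members of `I` have no common
zero on the fibre of the projective line over `φ`, then `I` contains a constant not vanishing at
`φ`. The hypothesis on `g` excludes the zero at infinity. -/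
lemma exists_C_mem_of_forall_exists_eval₂_ne_zero [IsAlgClosed K] {I : Ideal R[X]} {φ : R →+* K}
    {g : R[X]} (hg : g ∈ I) (hlead : φ g.leadingCoeff ≠ 0)
    (hI : ∀ t, ∃ f ∈ I, f.eval₂ φ t ≠ 0) : ∃ ρ : R, C ρ ∈ I ∧ φ ρ ≠ 0 := by
  rcases eq_or_ne g.natDegree 0 with hdeg | hdeg
  · refine ⟨g.leadingCoeff, ?_, hlead⟩
    rwa [leadingCoeff, hdeg, ← eq_C_of_natDegree_eq_zero hdeg]
  classical
  -- Prime avoidance yields a single member of `I` without common zeros with `g`.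
  obtain ⟨f, hf, hfg⟩ : ∃ f ∈ I, ∀ t ∈ (g.map φ).roots, f.eval₂ φ t ≠ 0 := by
    have havoid : ¬ (I : Set R[X]) ⊆ ⋃ t ∈ ((g.map φ).roots.toFinset : Set K),
        (RingHom.ker (eval₂RingHom φ t) : Set R[X]) := by
      rw [Ideal.subset_union_prime 0 0 fun t _ _ _ => RingHom.ker_isPrime _]
      rintro ⟨t, -, hle⟩
      obtain ⟨f, hf, hft⟩ := hI t
      exact hft (hle hf)
    obtain ⟨f, hf, hfT⟩ := Set.not_subset.1 havoid
    refine ⟨f, hf, fun t ht hft => hfT ?_⟩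
    exact Set.mem_biUnion (by simpa using ht) hft
  obtain ⟨a, b, -, -, hab⟩ :=
    exists_mul_add_mul_eq_C_resultant g f le_rfl le_rfl (Or.inl hdeg)
  refine ⟨resultant g f, ?_, ?_⟩
  · rw [← hab]
    exact I.add_mem (I.mul_mem_right a hg) (I.mul_mem_right b hf)
  · rw [← resultant_map_map, ← natDegree_map_of_leadingCoeff_ne_zero φ hlead,
      resultant_eq_prod_eval _ _ _ natDegree_map_le (IsAlgClosed.splits _)]
    refine mul_ne_zero (pow_ne_zero _ ?_) (Multiset.prod_ne_zero ?_)
    · rwa [leadingCoeff_map_of_leadingCoeff_ne_zero φ hlead]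
    · rw [Multiset.mem_map]
      rintro ⟨t, ht, h0⟩
      exact hfg t ht (by rwa [eval_map] at h0)

end Elimination

section Minors

open Module

variable {K : Type*} [Field K] {m n : Type*} [Fintype n]

lemma exists_linearIndependent_col_submatrix [Finite m] (M : Matrix m n K) {r : ℕ}
    (hr : r ≤ M.rank) :
    ∃ g : Fin r → n, LinearIndependent K (M.submatrix id g).col := by
  rw [rank_eq_finrank_span_cols] at hr
  obtain ⟨f, hf, -, hli⟩ := Submodule.exists_fun_fin_finrank_span_eq K (Set.range M.col)
  choose g hg using hf
  refine ⟨g ∘ Fin.castLE hr, ?_⟩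
  have hcol : (M.submatrix id (g ∘ Fin.castLE hr)).col = f ∘ Fin.castLE hr :=
    funext fun i => hg _
  rw [hcol]
  exact hli.comp _ (Fin.castLE_injective hr)

lemma exists_det_submatrix_ne_zero [Finite m] (M : Matrix m n K) {r : ℕ} (hr : r ≤ M.rank) :
    ∃ (f : Fin r → m) (g : Fin r → n), (M.submatrix f g).det ≠ 0 := by
  cases nonempty_fintype m
  obtain ⟨g, hg⟩ := exists_linearIndependent_col_submatrix M hr
  have hrank : r ≤ (M.submatrix id g)ᵀ.rank := by
    rw [← row_transpose] at hg
    rw [hg.rank_matrix, Fintype.card_fin]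
  obtain ⟨f, hf⟩ := exists_linearIndependent_col_submatrix _ hrank
  refine ⟨f, g, ?_⟩
  have hunit := linearIndependent_cols_iff_isUnit.1 hf
  exact (isUnit_det_transpose _ ((isUnit_iff_isUnit_det _).1 hunit)).ne_zero

lemma le_rank_of_det_submatrix_ne_zero {M : Matrix m n K} {r : ℕ} {f : Fin r → m} {g : Fin r → n}
    (h : (M.submatrix f g).det ≠ 0) : r ≤ M.rank := by
  rw [← Fintype.card_fin r, ← rank_of_det_ne_zero h]
  exact rank_submatrix_le _ _ _

end Minors

section PencilElimination

open Polynomial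

variable {R K : Type*} [CommRing R] [Field K] {m n : Type*}

/-- The minor of the pencil `A + t B`, a polynomial in `t`, with rows `f` and columns `g`. -/
def pencilMinor {r : ℕ} (A B : Matrix m n R) (f : Fin r → m) (g : Fin r → n) : R[X] :=
  det ((X : R[X]) • (B.submatrix f g).map C + (A.submatrix f g).map C)

lemma eval₂_pencilMinor {r : ℕ} (A B : Matrix m n R) (f : Fin r → m) (g : Fin r → n)
    (φ : R →+* K) (t : K) :
    (pencilMinor A B f g).eval₂ φ t = ((A.map φ + t • B.map φ).submatrix f g).det := by
  rw [pencilMinor, ← coe_eval₂RingHom, RingHom.map_det]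
  congr 1
  ext i j
  simp only [coe_eval₂RingHom, RingHom.mapMatrix_apply, map_apply, Matrix.add_apply,
    Matrix.smul_apply, submatrix_apply, smul_eq_mul, eval₂_add, eval₂_mul, eval₂_X, eval₂_C]
  rw [add_comm]

lemma leadingCoeff_pencilMinor {r : ℕ} {A B : Matrix m n R} {f : Fin r → m} {g : Fin r → n}
    (h : (B.submatrix f g).det ≠ 0) :
    (pencilMinor A B f g).leadingCoeff = (B.submatrix f g).det := by
  have hcoeff : (pencilMinor A B f g).coeff r = (B.submatrix f g).det := by
    simpa [pencilMinor] using coeff_det_X_add_C_card (B.submatrix f g) (A.submatrix f g)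
  have hdeg : (pencilMinor A B f g).natDegree ≤ r := by
    simpa [pencilMinor] using natDegree_det_X_add_C_le (B.submatrix f g) (A.submatrix f g)
  rw [leadingCoeff, hdeg.antisymm (le_natDegree_of_ne_zero (hcoeff ▸ h)), hcoeff]

lemma exists_ne_zero_forall_le_rank_pencil [IsAlgClosed K] [Finite m] [Fintype n]
    {A B : Matrix m n R} {φ : R →+* K} {r : ℕ} (hB : r ≤ (B.map φ).rank)
    (hAB : ∀ t : K, r ≤ (A.map φ + t • B.map φ).rank) :
    ∃ ρ : R, φ ρ ≠ 0 ∧ ∀ ψ : R →+* K, ψ ρ ≠ 0 → ∀ t : K, r ≤ (A.map ψ + t • B.map ψ).rank := by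
  let minors : Set R[X] := Set.range fun q : (Fin r → m) × (Fin r → n) => pencilMinor A B q.1 q.2
  have hmem (f : Fin r → m) (g : Fin r → n) : pencilMinor A B f g ∈ Ideal.span minors :=
    Ideal.subset_span ⟨(f, g), rfl⟩
  obtain ⟨f, g, hfg⟩ := exists_det_submatrix_ne_zero _ hB
  have hφ : φ (B.submatrix f g).det ≠ 0 := by rwa [RingHom.map_det]
  have hdet : (B.submatrix f g).det ≠ 0 := fun h => hφ (by rw [h, map_zero])
  obtain ⟨ρ, hρ, hρφ⟩ := exists_C_mem_of_forall_exists_eval₂_ne_zero (hmem f g)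
    (by rwa [leadingCoeff_pencilMinor hdet]) fun t => by
      obtain ⟨f', g', h⟩ := exists_det_submatrix_ne_zero _ (hAB t)
      exact ⟨_, hmem f' g', by rwa [eval₂_pencilMinor]⟩
  refine ⟨ρ, hρφ, fun ψ hψ t => ?_⟩
  by_contra hlt
  have hker : Ideal.span minors ≤ RingHom.ker (eval₂RingHom ψ t) := by
    rw [Ideal.span_le]
    rintro _ ⟨q, rfl⟩
    rw [SetLike.mem_coe, RingHom.mem_ker, coe_eval₂RingHom, eval₂_pencilMinor]
    by_contra hne
    exact hlt (le_rank_of_det_submatrix_ne_zero hne)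
  have hρ0 : (C ρ).eval₂ ψ t = 0 := hker hρ
  exact hψ (by rwa [eval₂_C] at hρ0)

end PencilElimination

section AnalyticFunctions

variable {𝔤₀ : Type*} [LieRing 𝔤₀] [LieAlgebra ℝ 𝔤₀] {ι : Type*} [Fintype ι]

/-- The ring of complex-valued real analytic functions on `𝔤*`. -/
def analyticSubring (ι : Type*) [Fintype ι] : Subring ((ι → ℂ) → ℂ) where
  carrier := {h | ∀ w, AnalyticAt ℝ h w}
  mul_mem' ha hb w := (ha w).mul (hb w)
  one_mem' _ := analyticAt_const
  add_mem' ha hb w := (ha w).add (hb w)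
  zero_mem' _ := analyticAt_const
  neg_mem' ha w := (ha w).neg

/-- Evaluation of real analytic functions at a point of `𝔤*`. -/
def analyticEval (z : ι → ℂ) : analyticSubring ι →+* ℂ :=
  (Pi.evalRingHom (fun _ : ι → ℂ => ℂ) z).comp (analyticSubring ι).subtype

lemma analyticAt_poissonMatrix_apply (e : Module.Basis ι ℝ 𝔤₀) (i j : ι) (w : ι → ℂ) :
    AnalyticAt ℝ (fun z => poissonMatrix e z i j) w := by
  simp only [poissonMatrix, of_apply]
  exact Finset.univ.analyticAt_fun_sum fun k _ =>
    analyticAt_const.mul ((ContinuousLinearMap.proj (R := ℝ) (φ := fun _ : ι => ℂ) k).analyticAt w)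

/-- The function `z ↦ c(z)` as a matrix of real analytic functions. -/
def poissonAnalytic (e : Module.Basis ι ℝ 𝔤₀) : Matrix ι ι (analyticSubring ι) :=
  of fun i j => ⟨fun z => poissonMatrix e z i j, analyticAt_poissonMatrix_apply e i j⟩

/-- The function `z ↦ c(z̄)` as a matrix of real analytic functions. -/
def poissonStarAnalytic (e : Module.Basis ι ℝ 𝔤₀) : Matrix ι ι (analyticSubring ι) :=
  of fun i j => ⟨fun z => poissonMatrix e (star z) i j, fun w =>
    (analyticAt_poissonMatrix_apply e i j (star w)).comp
      ((starL' ℝ : (ι → ℂ) ≃L[ℝ] (ι → ℂ)).analyticAt w)⟩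

lemma exists_analytic_forall_le_rank (e : Module.Basis ι ℝ 𝔤₀) {r : ℕ} {z₁ : ι → ℂ}
    (hB : r ≤ (poissonMatrix e (star z₁)).rank)
    (hAB : ∀ t : ℂ, r ≤ (poissonMatrix e z₁ + t • poissonMatrix e (star z₁)).rank) :
    ∃ h : (ι → ℂ) → ℂ, (∀ w, AnalyticAt ℝ h w) ∧ h z₁ ≠ 0 ∧ ∀ z, h z ≠ 0 →
      ∀ t : ℂ, r ≤ (poissonMatrix e z + t • poissonMatrix e (star z)).rank := by
  obtain ⟨ρ, hρ, hrank⟩ := exists_ne_zero_forall_le_rank_pencil (A := poissonAnalytic e)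
    (B := poissonStarAnalytic e) (φ := analyticEval z₁) hB hAB
  exact ⟨ρ, ρ.2, hρ, fun z => hrank (analyticEval z)⟩

end AnalyticFunctions

section RealPencil

lemma complexPencil_ofReal {V : Type*} [AddCommGroup V] [Module ℝ V]
    (b₁ b₂ : LinearMap.BilinForm ℝ V) (s t : ℝ) :
    complexPencil b₁ b₂ s t = (s • b₁ + t • b₂).baseChange ℂ := by
  ext v w
  simp [complexPencil]

lemma finrank_range_complexPencil_eq_zero_iff {V : Type*} [AddCommGroup V] [Module ℝ V]
    [FiniteDimensional ℝ V] (b₁ b₂ : LinearMap.BilinForm ℝ V) (s t : ℝ) :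
    Module.finrank ℂ (LinearMap.range (complexPencil b₁ b₂ s t)) = 0 ↔ s • b₁ + t • b₂ = 0 := by
  rw [Submodule.finrank_eq_zero, LinearMap.range_eq_bot, complexPencil_ofReal,
    LinearMap.BilinForm.baseChange_eq_zero_iff]

lemma pencilRank_eq_zero_iff {E : Type*} [NormedAddCommGroup E] [NormedSpace ℝ E]
    [FiniteDimensional ℝ E] {N : Type*} [TopologicalSpace N] [ChartedSpace E N]
    (c₁ c₂ : BivectorField E N) (s t : ℝ) (x : N) :
    pencilRank c₁ c₂ s t x = 0 ↔ s • c₁ x + t • c₂ x = 0 := by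
  have : FiniteDimensional ℝ (Module.Dual ℝ (TangentSpace 𝓘(ℝ, E) x)) :=
    inferInstanceAs (FiniteDimensional ℝ (Module.Dual ℝ E))
  exact finrank_range_complexPencil_eq_zero_iff (V := Module.Dual ℝ (TangentSpace 𝓘(ℝ, E) x)) ..

end RealPencil

section IncompletenessSet

variable {𝔤₀ : Type*} [LieRing 𝔤₀] [LieAlgebra ℝ 𝔤₀] {ι : Type*} [Fintype ι]
  {e : Module.Basis ι ℝ 𝔤₀} {z : ι → ℂ}

lemma rank_pencil_of_notMem_incompletenessSet (hz : z ∉ incompletenessSet e) {l₁ l₂ : ℂ}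
    (hl : (l₁, l₂) ≠ (0, 0)) : (poissonMatrix e (l₁ • z + l₂ • star z)).rank = genericRank e :=
  (rank_le_genericRank e _).antisymm (not_lt.1 fun h => hz ⟨l₁, l₂, hl, h⟩)

lemma rank_of_notMem_incompletenessSet (hz : z ∉ incompletenessSet e) :
    (poissonMatrix e z).rank = genericRank e := by
  simpa using rank_pencil_of_notMem_incompletenessSet hz (l₁ := 1) (l₂ := 0) (by simp)

lemma notMem_incompletenessSet (hz : (poissonMatrix e z).rank = genericRank e)
    (h : ∀ t : ℂ, genericRank e ≤ (poissonMatrix e z + t • poissonMatrix e (star z)).rank) :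
    z ∉ incompletenessSet e := by
  rintro ⟨l₁, l₂, hl, hs⟩
  suffices hrank : genericRank e ≤ (poissonMatrix e (l₁ • z + l₂ • star z)).rank from
    not_lt.2 hrank hs
  rw [poissonMatrix_smul_add_smul]
  rcases eq_or_ne l₁ 0 with rfl | hl₁
  · have hl₂ : l₂ ≠ 0 := fun h => hl (by rw [h])
    rw [zero_smul, zero_add, rank_smul_of_mem_nonZeroDivisors _
      (mem_nonZeroDivisors_of_ne_zero hl₂), rank_poissonMatrix_star, hz]
  · have hnormalize : l₁ • poissonMatrix e z + l₂ • poissonMatrix e (star z) =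
        l₁ • (poissonMatrix e z + (l₂ / l₁) • poissonMatrix e (star z)) := by
      rw [smul_add, smul_smul, mul_div_cancel₀ _ hl₁]
    rw [hnormalize, rank_smul_of_mem_nonZeroDivisors _ (mem_nonZeroDivisors_of_ne_zero hl₁)]
    exact h _

end IncompletenessSet

section Completeness

open Set Filter

variable {𝔤₀ : Type*} [LieRing 𝔤₀] [LieAlgebra ℝ 𝔤₀] {ι : Type*} [Fintype ι] [DecidableEq ι]
  {E : Type*} [NormedAddCommGroup E] [NormedSpace ℝ E] [FiniteDimensional ℝ E]
  {N : Type*} [TopologicalSpace N] [ChartedSpace E N]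
  {e : Module.Basis ι ℝ 𝔤₀} {U : Set (ι → ℂ)} {p : U → N} {z₀ : ι → ℂ}
  (hp : IsQuotientByRealForm E e p) (hU : IsOpen[orbitTopology e] U)
include hp hU

lemma pencilRank_pushBivector_of_notMem {z : U} (hz : (z : ι → ℂ) ∉ incompletenessSet e)
    {l₁ l₂ : ℂ} (hl : (l₁, l₂) ≠ (0, 0)) :
    pencilRank (pushBivector hp 1) (pushBivector hp (-Complex.I)) l₁ l₂ (p z) +
      2 * Fintype.card ι = 3 * genericRank e + 2 * commonKernelDim e z := by
  rw [pencilRank_pushBivector hp hU z (rank_of_notMem_incompletenessSet hz) hl,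
    rank_pencil_of_notMem_incompletenessSet hz (pencil_coefficients_ne_zero hl)]
  ring

variable (hUM : U ⊆ coadjointOrbit e z₀) {z : U} (hz : (z : ι → ℂ) ∉ incompletenessSet e)
include hUM hz

lemma pencilRank_pushBivector_le {l₁ l₂ : ℂ} (hl : (l₁, l₂) ≠ (0, 0)) (a b : ℝ) (w : U) :
    pencilRank (pushBivector hp 1) (pushBivector hp (-Complex.I)) a b (p w) ≤
      pencilRank (pushBivector hp 1) (pushBivector hp (-Complex.I)) l₁ l₂ (p z) := by
  by_cases hab : ((a : ℂ), (b : ℂ)) = (0, 0)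
  · obtain ⟨rfl, rfl⟩ : a = 0 ∧ b = 0 := by simpa using hab
    rw [(pencilRank_eq_zero_iff _ _ 0 0 _).2 (by simp)]
    exact Nat.zero_le _
  · have hw : (poissonMatrix e (w : ι → ℂ)).rank = genericRank e := by
      rw [rank_poissonMatrix_of_mem_coadjointOrbit e (hUM w.2),
        ← rank_poissonMatrix_of_mem_coadjointOrbit e (hUM z.2),
        rank_of_notMem_incompletenessSet hz]
    have hrankz := pencilRank_pushBivector_of_notMem hp hU hz hl
    have hrankw := pencilRank_pushBivector hp hU w hw hab
    have hgeneric := rank_le_genericRank e ((((a : ℂ) + Complex.I * b) / 2) • (w : ι → ℂ) +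
      (((a : ℂ) - Complex.I * b) / 2) • star (w : ι → ℂ))
    rw [commonKernelDim_eq hp hU hUM w z] at hrankw
    lia

lemma isGreatest_pencilRank {l₁ l₂ : ℂ} (hl : (l₁, l₂) ≠ (0, 0)) :
    IsGreatest {k | ∃ (a b : ℝ) (x : N), k = pencilRank (pushBivector hp 1)
      (pushBivector hp (-Complex.I)) a b x}
      (pencilRank (pushBivector hp 1) (pushBivector hp (-Complex.I)) l₁ l₂ (p z)) := by
  constructor
  · have hone := pencilRank_pushBivector_of_notMem hp hU hz (l₁ := (1 : ℝ)) (l₂ := (0 : ℝ))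
      (by simp)
    have hrank := pencilRank_pushBivector_of_notMem hp hU hz hl
    exact ⟨1, 0, p z, by lia⟩
  · rintro _ ⟨a, b, x, rfl⟩
    obtain ⟨w, rfl⟩ := hp.surjective x
    exact pencilRank_pushBivector_le hp hU hUM hz hl a b w

lemma isCompleteAt_pushBivector :
    IsCompleteAt (pushBivector hp 1) (pushBivector hp (-Complex.I)) (p z) := fun _ _ hl =>
  (isGreatest_pencilRank hp hU hUM hz hl).csSup_eq.symm

lemma isBihamiltonian_pushBivector :
    IsBihamiltonian (pushBivector hp 1) (pushBivector hp (-Complex.I)) where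
  poisson a b := by
    rw [funext fun x => smul_pushBivector_add_smul_pushBivector hp a b x]
    exact isPoisson_pushBivector hp hU _
  indep_or_trivial := by
    by_cases hmax : maxRank (pushBivector hp 1) (pushBivector hp (-Complex.I)) = 0
    · right
      have hzero (a b : ℝ) (x : N) :
          a • pushBivector hp 1 x + b • pushBivector hp (-Complex.I) x = 0 := by
        rw [← pencilRank_eq_zero_iff, ← Nat.le_zero, ← hmax]
        exact le_csSup ⟨_, (isGreatest_pencilRank hp hU hUM hz
          (l₁ := 1) (l₂ := 0) (by simp)).2⟩ ⟨a, b, x, rfl⟩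
      exact ⟨fun x => by simpa using hzero 1 0 x, fun x => by simpa using hzero 0 1 x⟩
    · left
      intro a b hab
      by_contra hne
      have hne' : ((a : ℂ), (b : ℂ)) ≠ (0, 0) := by simpa using hne
      refine hmax ((isCompleteAt_pushBivector hp hU hUM hz a b hne').symm.trans ?_)
      exact (pencilRank_eq_zero_iff _ _ a b (p z)).2 (hab (p z))

end Completeness

section GenericCompleteness

open Set Filter

variable {𝔤₀ : Type*} [LieRing 𝔤₀] [LieAlgebra ℝ 𝔤₀] {ι : Type*} [Fintype ι] [DecidableEq ι]
  {E : Type*} [NormedAddCommGroup E] [NormedSpace ℝ E]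
  {N : Type*} [TopologicalSpace N] [ChartedSpace E N]
  {e : Module.Basis ι ℝ 𝔤₀} {U : Set (ι → ℂ)} {p : U → N} {z₀ : ι → ℂ} {h : (ι → ℂ) → ℂ}
  (hp : IsQuotientByRealForm E e p) (hU : IsOpen[orbitTopology e] U)
include hp hU

lemma isOpen_image_ne_zero [FiniteDimensional ℝ E] (hh : Continuous h) :
    IsOpen (p '' {z | h (z : ι → ℂ) ≠ 0}) := by
  rw [isOpen_iff_mem_nhds]
  rintro _ ⟨z, hz, rfl⟩
  obtain ⟨s, hs, hs0, hsp⟩ := exists_contMDiffAt_section hp z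
  have hst : Tendsto s (𝓝 (p z)) (𝓝 0) := hs0 ▸ hs.continuousAt.tendsto
  have hne : ∀ᶠ w in 𝓝 (z : ι → ℂ), h w ≠ 0 := hh.continuousAt.eventually_ne hz
  filter_upwards [hsp, hst.eventually ((tendsto_coadExp e (z : ι → ℂ)).eventually hne),
    hst.eventually (hU z z.2)] with x hx hhx hUx
  refine ⟨expAt e z (s x), ?_, hx⟩
  rwa [mem_ofPred_eq, expAt_coe hUx]

lemma dense_image_ne_zero (hUM : U ⊆ coadjointOrbit e z₀) (hh : ∀ w, AnalyticAt ℝ h w)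
    {z₁ : U} (hne : h z₁ ≠ 0) : Dense (p '' {z | h (z : ι → ℂ) ≠ 0}) := by
  intro x
  obtain ⟨z, rfl⟩ := hp.surjective x
  rw [mem_closure_iff_frequently]
  refine (tendsto_comp_expAt hp z).frequently ?_
  refine ((frequently_coadExp_ne_zero e hh (hUM z₁.2) (hUM z.2) hne).and_eventually
    (hU z z.2)).mono fun ξ hξ => ⟨expAt e z ξ, ?_, rfl⟩
  rw [mem_ofPred_eq, expAt_coe hξ.2]
  exact hξ.1

lemma isComplete_pushBivector [FiniteDimensional ℝ E] (hUM : U ⊆ coadjointOrbit e z₀) {z₁ : U}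
    (hz₁ : (z₁ : ι → ℂ) ∉ incompletenessSet e) :
    IsComplete (pushBivector hp 1) (pushBivector hp (-Complex.I)) := by
  have hrank₁ := rank_of_notMem_incompletenessSet hz₁
  obtain ⟨h, hh, hne, hrank⟩ := exists_analytic_forall_le_rank e
    ((rank_poissonMatrix_star e (z₁ : ι → ℂ)).trans hrank₁).ge fun t => by
      have := rank_pencil_of_notMem_incompletenessSet hz₁ (l₁ := 1) (l₂ := t) (by simp)
      rw [poissonMatrix_smul_add_smul, one_smul] at this
      exact this.ge
  have hcont : Continuous h := continuous_iff_continuousAt.2 fun w => (hh w).continuousAt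
  refine ⟨p '' {z | h (z : ι → ℂ) ≠ 0}, isOpen_image_ne_zero hp hU hcont,
    dense_image_ne_zero hp hU hUM hh hne, ?_⟩
  rintro _ ⟨z, hz, rfl⟩
  refine isCompleteAt_pushBivector hp hU hUM (notMem_incompletenessSet ?_ (hrank z hz))
  rw [rank_poissonMatrix_of_mem_coadjointOrbit e (hUM z.2),
    ← rank_poissonMatrix_of_mem_coadjointOrbit e (hUM z₁.2), hrank₁]

end GenericCompleteness

end Coadjoint

end

open Coadjoint in
theorem mainTheorem1_general {𝔤₀ : Type*} [LieRing 𝔤₀] [LieAlgebra ℝ 𝔤₀]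
    {ι : Type*} [Fintype ι] [DecidableEq ι] (e : Module.Basis ι ℝ 𝔤₀)
    (z₀ : ι → ℂ) (U : Set (ι → ℂ)) (hUM : U ⊆ coadjointOrbit e z₀)
    (hU : IsOpen[orbitTopology e] U)
    {E : Type*} [NormedAddCommGroup E] [NormedSpace ℝ E] [FiniteDimensional ℝ E]
    {N : Type*} [TopologicalSpace N] [ChartedSpace E N]
    (p : U → N) (hp : IsQuotientByRealForm E e p) :
    ∃ c₁ c₂ : BivectorField E N,
      IsReduction e p c₁ c₂ ∧
      (∀ x : N, x ∉ p '' {z : U | (z : ι → ℂ) ∈ irregularitySet e} →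
        IsCompleteAt c₁ c₂ x) ∧
      (¬ U ⊆ irregularitySet e →
        IsBihamiltonian c₁ c₂ ∧ IsComplete c₁ c₂ ∧
          IsMinimalRealization e p c₁ c₂) ∧
      (z₀ ∉ singularSet e → IsCRIsotropicFoliation E e p) := by
  have hred := isReduction_pushBivector hp hU
  refine ⟨_, _, hred, fun x hx => ?_, fun hne => ?_, fun hz₀ => ?_⟩
  · obtain ⟨z, rfl⟩ := hp.surjective x
    exact isCompleteAt_pushBivector hp hU hUM fun hz => hx ⟨z, Or.inl hz, rfl⟩
  · obtain ⟨z₁, hz₁U, hz₁⟩ := Set.not_subset.1 hne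
    have hz₁' : z₁ ∉ incompletenessSet e := fun hz => hz₁ (Or.inl hz)
    have hcomplete := isComplete_pushBivector hp hU hUM (z₁ := ⟨z₁, hz₁U⟩) hz₁'
    have hrank : (poissonMatrix e z₀).rank = genericRank e := by
      rw [← rank_poissonMatrix_of_mem_coadjointOrbit e (hUM hz₁U),
        rank_of_notMem_incompletenessSet hz₁']
    exact ⟨isBihamiltonian_pushBivector hp hU hUM (z := ⟨z₁, hz₁U⟩) hz₁', hcomplete,
      hred, hcomplete, isCRIsotropicFoliation hp hU hUM hrank⟩
  · exact isCRIsotropicFoliation hp hU hUM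
      ((rank_le_genericRank e z₀).antisymm (not_lt.1 hz₀))

theorem mainTheorem1 {𝔤₀ : Type*} [LieRing 𝔤₀] [LieAlgebra ℝ 𝔤₀]
    {ι : Type*} [Fintype ι] [DecidableEq ι] (e : Module.Basis ι ℝ 𝔤₀)
    (hna : ¬ IsLieAbelian 𝔤₀) (hsing : 3 ≤ Coadjoint.singularCodim e)
    (z₀ : ι → ℂ) (U : Set (ι → ℂ)) (hUM : U ⊆ Coadjoint.coadjointOrbit e z₀)
    (hU : IsOpen[Coadjoint.orbitTopology e] U)
    {E : Type*} [NormedAddCommGroup E] [NormedSpace ℝ E] [FiniteDimensional ℝ E]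
    {N : Type*} [TopologicalSpace N] [ChartedSpace E N] [IsManifold 𝓘(ℝ, E) ∞ N]
    (p : U → N) (hp : Coadjoint.IsQuotientByRealForm E e p) :
    ∃ c₁ c₂ : Coadjoint.BivectorField E N,
      Coadjoint.IsReduction e p c₁ c₂ ∧
      (∀ x : N, x ∉ p '' {z : U | (z : ι → ℂ) ∈ Coadjoint.irregularitySet e} →
        Coadjoint.IsCompleteAt c₁ c₂ x) ∧
      (¬ U ⊆ Coadjoint.irregularitySet e →
        Coadjoint.IsBihamiltonian c₁ c₂ ∧ Coadjoint.IsComplete c₁ c₂ ∧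
          Coadjoint.IsMinimalRealization e p c₁ c₂) ∧
      (z₀ ∉ Coadjoint.singularSet e → Coadjoint.IsCRIsotropicFoliation E e p) :=
  mainTheorem1_general e z₀ U hUM hU p hp
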